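/- **Model.** Products $1,\dots,n$ have prices $r_1\ge\dots\ge r_n>0$; there are $1\le M\le n$ display slots; $r_{\max}=\max_j r_j$. A ranking $\sigma$ is an ordered list of at most $M$ distinct products. A customer with attention span $x$ views the displayed products in order, buys the first one she finds satisfactory, and leaves empty-handed after $x$ products or at the end of the list. If product $j$ is satisfactory with probability $\lambda_j$, independently of everything else, put $$R(\sigma,x;\lambda)=\sum_{k=1}^{x\wedge|\sigma|}\prod_{i<k}(1-\lambda_{\sigma(i)})\,\lambda_{\sigma(k)}r_{\sigma(k)}.$$ The attention span $X\ge1$ has tail $G^*_x=\Pr(X\ge x)$; put $\mathcal R(\sigma;\lambda,G^*)=\mathbb E[R(\sigma,X;\lambda)]$. Customers $t=1,\dots,T$ ($T\ge 1$) arrive with known features $y_t\in\mathbb R^{d_c}$; products have known features $s_j\in\mathbb R^{d_p}$; for an unknown matrix $\Theta^*$, customer $t$ finds product $j$ satisfactory with probability $\lambda_{t,j}=s_j^\top\Theta^*y_t\in(0,1)$. Put $x_{t,j}=\mathrm{vec}(s_jy_t^\top)$, $\theta^*=\mathrm{vec}(\Theta^*)$, $d=d_pd_c$. The attention spans are i.i.d.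 with unknown tail $G^*$, and all attention spans and satisfaction events are independent. **Observations.** After displaying $\sigma_t$ the firm sees whether customer $t$ bought ($\Psi_t=1$) and the position $\Upsilon_t$ of the product bought, or, if she did not buy ($\Psi_t=0$), the number $\Upsilon_t$ of products viewed. Let $O^Z_{t,k}=\mathbf 1\{k\le\Upsilon_t\}$, $Z_{t,k}=\mathbf 1\{\Psi_t=1,k=\Upsilon_t\}$, $Y_{t,k}=\mathbf 1\{\Psi_t=0,k=\Upsilon_t\}$, and $O^Y_{t,k}=\mathbf 1\{k\le\Upsilon_t-1\}$ if $\Psi_t=1$, $O^Y_{t,k}=\mathbf 1\{k\le\Upsilon_t\}$ if $\Psi_t=0$, except that $O^Y_{t,k}=0$ at $k=|\sigma_t|$ when $|\sigma_t|<M$ (leaving at the end of a list shorter than $M$ says nothing about the end of the attention span). **Best-x** on input $(r,\lambda,G)$: put $\sigma^0=\emptyset$; for $x=1,\dots,M$ obtain $\sigma^x$ from $\sigma^{x-1}$ by adding a product so as to maximize $R(\cdot,x;\lambda)$, products always being ranked by increasing index; return a $\sigma^x$, $1\le x\le M$, that maximizes $R(\sigma^x,x;\lambda)\,G_x$. Ties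 are broken arbitrarily. **RankUCB** with parameters $\gamma\ge1$, $D>0$: let $V_t=\gamma I+\sum_{s\le t}\sum_kO^Z_{s,k}x_{s,\sigma_s(k)}x_{s,\sigma_s(k)}^\top$, $B_t=\sum_{s\le t}\sum_kO^Z_{s,k}Z_{s,k}x_{s,\sigma_s(k)}$, $\hat\theta_t=V_t^{-1}B_t$, $N_{t,k}=\sum_{s\le t}O^Y_{s,k}$, $\hat h_{t,k}=\sum_{s\le t}O^Y_{s,k}Y_{s,k}/N_{t,k}$, and $$\rho_t=\tfrac12\sqrt{d\log\big(1+\tfrac{tM}{\gamma d}\big)+4\log(t+1)}+D\gamma^{1/2}.$$ In round $t$ let $u_{t,j}=\mathrm{Proj}_{[0,1]}\big(x_{t,j}^\top\hat\theta_{t-1}+\rho_{t-1}(x_{t,j}^\top V_{t-1}^{-1}x_{t,j})^{1/2}\big)$, $h^L_{t,k}=\mathrm{Proj}_{[0,1]}\big(\hat h_{t-1,k}-\sqrt{\ln t/N_{t-1,k}}\big)$ (and $h^L_{t,k}=0$ if $N_{t-1,k}=0$), $G^U_{t,x}=\prod_{k<x}(1-h^L_{t,k})$; display as $\sigma_t$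 an output of Best-x on $(r,u_t,G^U_t)$, where slots left empty below it may stay empty or be filled with any other products. **Theorem.** Assume that $G^*$ has increasing failure rate, $G^*_{x+1}G^*_{x-1}\le(G^*_x)^2$ for $2\le x\le M-1$, and that $\|x_{t,j}\|_2\le1$ for all $t,j$ and $\|\theta^*\|_2\le D$. Then the expected cumulative $e$-scaled regret of RankUCB satisfies $$\mathbb E\Big[\sum_{t=1}^T\Big(\max_{|\sigma|=M}\mathcal R(\sigma;\lambda_t,G^*)-e\,\mathcal R(\sigma_t;\lambda_t,G^*)\Big)\Big]\le4eMr_{\max}\sqrt{T\ln T}+2e\rho_{T-1}Mr_{\max}\sqrt{2Td\log\Big(1+\frac{TM}{\gamma d}\Big)}+\frac{M\pi^2r_{\max}}6 .$$ -/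

import Mathlib

open MeasureTheory ProbabilityTheory Matrix

namespace ProductRanking

noncomputable section

/-! ### Rankings and revenue

Products are the elements of `Fin n`. A ranking is a list of distinct products; its entry of index
`k` is displayed in position `k + 1`. -/

/-- Expected revenue of the ranking `σ` from a customer with attention span `x`, when product `j`
has price `r j` and conditional purchase probability `lam j`: she views at most `x` products, and
buys the first satisfactory one. -/
def fixedSpanRevenue {n : ℕ} (r lam : Fin n → ℝ) (σ : List (Fin n)) (x : ℕ) : ℝ :=
  ∑ k : Fin σ.length,
    if (k : ℕ) < x then
      ((σ.take k).map fun i => 1 - lam i).prod * lam (σ.get k) * r (σ.get k)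
    else 0

/-- Expected revenue of `σ` when the attention span has law `ν`. -/
def expectedRevenue {n : ℕ} (r lam : Fin n → ℝ) (ν : Measure ℕ) (σ : List (Fin n)) : ℝ :=
  ∫ x, fixedSpanRevenue r lam σ x ∂ν

/-- The optimal expected revenue over the rankings that fill all `M` slots. -/
def optimalRevenue {n : ℕ} (M : ℕ) (r lam : Fin n → ℝ) (ν : Measure ℕ) : ℝ :=
  ⨆ p : Fin M ↪ Fin n, expectedRevenue r lam ν (List.ofFn p)

/-- The tail probability `G_x = P(X ≥ x)` of an attention span with law `ν`. -/
def tail (ν : Measure ℕ) (x : ℕ) : ℝ := ν.real (Set.Ici x)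

/-- Increasing failure rate up to position `M`: `G_{x+1} G_{x-1} ≤ G_x ^ 2` for `2 ≤ x ≤ M - 1`. -/
def HasIFR (M : ℕ) (ν : Measure ℕ) : Prop :=
  ∀ x : ℕ, 2 ≤ x → x + 1 ≤ M → tail ν (x + 1) * tail ν (x - 1) ≤ tail ν x ^ 2

/-! ### The offline algorithm -/

/-- The ranking of an assortment by increasing product index (prices decrease with the index). -/
def indexRanking {n : ℕ} (S : Finset (Fin n)) : List (Fin n) := S.sort (· ≤ ·)

/-- `S 0, S 1, …, S M` is a run of AssortOpt on prices `r` and purchase probabilities `lam`: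
starting from the empty assortment, step `x + 1` adds a product that maximizes the revenue for the
fixed attention span `x + 1`. Ties may be broken in any way. -/
def IsAssortOpt {n : ℕ} (M : ℕ) (r lam : Fin n → ℝ) (S : ℕ → Finset (Fin n)) : Prop :=
  S 0 = ∅ ∧
  ∀ x < M, ∃ j ∉ S x, S (x + 1) = insert j (S x) ∧
    ∀ i ∉ S x, fixedSpanRevenue r lam (indexRanking (insert i (S x))) (x + 1) ≤
      fixedSpanRevenue r lam (indexRanking (insert j (S x))) (x + 1)

/-- `σ` is an output of Best-x on prices `r`, purchase probabilities `lam` and tail probabilities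
`G`: among the rankings `σ^x` computed by AssortOpt, it maximizes `R(σ^x, x) G_x` over
`1 ≤ x ≤ M`. -/
def IsBestX {n : ℕ} (M : ℕ) (r lam : Fin n → ℝ) (G : ℕ → ℝ) (σ : List (Fin n)) : Prop :=
  ∃ S : ℕ → Finset (Fin n), IsAssortOpt M r lam S ∧
    ∃ x, 1 ≤ x ∧ x ≤ M ∧ σ = indexRanking (S x) ∧
      ∀ x', 1 ≤ x' → x' ≤ M →
        fixedSpanRevenue r lam (indexRanking (S x')) x' * G x' ≤
          fixedSpanRevenue r lam (indexRanking (S x)) x * G x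

/-! ### Customers and what the firm observes -/

/-- A customer: her attention span, and which products she finds satisfactory on viewing them. -/
abbrev Customer (n : ℕ) := ℕ × (Fin n → Bool)

/-- What the firm records of one customer: the ranking it displayed, whether she purchased, and
her last position: the position of the purchased product if she purchased, and the
number of products she viewed otherwise. -/
structure Round (n : ℕ) where
  ranking : List (Fin n)
  purchased : Bool
  last : ℕ

/-- The customer views the products of `σ` in order until one is satisfactory, her attention span
is exhausted, or the list ends. -/
def observe {n : ℕ} (σ : List (Fin n)) (c : Customer n) : Round n where
  ranking := σ
  purchased := (σ.take c.1).any c.2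
  last := if (σ.take c.1).any c.2 then (σ.take c.1).findIdx c.2 + 1 else (σ.take c.1).length

/-- `Z_k`: the product in position `k` is purchased. -/
def Round.Z {n : ℕ} (o : Round n) (k : ℕ) : ℝ :=
  if o.purchased = true ∧ k = o.last then 1 else 0

/-- `O^Z_k`: position `k` is viewed. -/
def Round.OZ {n : ℕ} (o : Round n) (k : ℕ) : ℝ := if k ≤ o.last then 1 else 0

/-- `Y_k`: the customer leaves, without a purchase, after position `k`. -/
def Round.Y {n : ℕ} (o : Round n) (k : ℕ) : ℝ :=
  if o.purchased = false ∧ k = o.last then 1 else 0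

/-- `O^Y_k`: it is observed whether the attention span ends at position `k`. This is so for the
positions viewed and not purchased, except the last position of a ranking that leaves some of the
`M` slots empty: there the customer leaves because the list ends. -/
def Round.OY {n : ℕ} (M : ℕ) (o : Round n) (k : ℕ) : ℝ :=
  if o.purchased = true then (if k + 1 ≤ o.last then 1 else 0)
  else if k ≤ o.last ∧ (k < o.ranking.length ∨ o.ranking.length = M) then 1 else 0

/-- A (deterministic) display policy: the ranking shown to a customer as a function of the number
`t` of earlier customers and of the records of those customers. -/
abbrev Policy (n : ℕ) := (t : ℕ) → (Fin t → Round n) → List (Fin n)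

/-- The records of the first `t` customers when the firm follows the policy `p`. -/
def history {n : ℕ} (p : Policy n) : (t : ℕ) → (Fin t → Customer n) → (Fin t → Round n)
  | 0, _ => Fin.elim0
  | t + 1, c =>
    Fin.snoc (α := fun _ => Round n) (history p t (Fin.init c))
      (observe (p t (history p t (Fin.init c))) (c (Fin.last t)))

/-! ### RankUCB -/

/-- The data known to the firm: `M` slots, prices `r`, product features `s`, the customer
features `y` (the customer who arrives after `t` others has feature `y t`), the regularization
parameter `γ` and the bound `D` on the norm of the unknown parameter. -/
structure Setting (n dp dc : ℕ) where
  M : ℕ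
  r : Fin n → ℝ
  s : Fin n → Fin dp → ℝ
  y : ℕ → Fin dc → ℝ
  γ : ℝ
  D : ℝ

namespace Setting

variable {n dp dc : ℕ} (P : Setting n dp dc)

/-- The vectorized feature `x_{t,j} = vec(s_j y_tᵀ)`. -/
def x (t : ℕ) (j : Fin n) : Fin dp × Fin dc → ℝ := fun q => P.s j q.1 * P.y t q.2

/-- The conditional purchase probabilities `λ_{t,j} = s_jᵀ Θ y_t`. -/
def lam (Θ : Matrix (Fin dp) (Fin dc) ℝ) (t : ℕ) (j : Fin n) : ℝ := P.s j ⬝ᵥ (Θ *ᵥ P.y t)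

/-- The largest price. -/
def rmax : ℝ := ⨆ j, P.r j

/-- The compounded dimension `d = d_p d_c`. -/
def d (_P : Setting n dp dc) : ℝ := (dp : ℝ) * dc

/-- The confidence radius `ρ_t`. -/
def rho (t : ℕ) : ℝ :=
  1 / 2 * √(P.d * Real.log (1 + t * P.M / (P.γ * P.d)) + 4 * Real.log (t + 1)) + P.D * √P.γ

/-- `V_t = γ I + ∑_{s, k} O^Z_{s,k} x_{s,σ_s(k)} x_{s,σ_s(k)}ᵀ`. -/
def V (t : ℕ) (h : Fin t → Round n) : Matrix (Fin dp × Fin dc) (Fin dp × Fin dc) ℝ :=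
  P.γ • (1 : Matrix (Fin dp × Fin dc) (Fin dp × Fin dc) ℝ) +
    ∑ s : Fin t, ∑ k : Fin (h s).ranking.length,
      (h s).OZ (k + 1) •
        vecMulVec (P.x s ((h s).ranking.get k)) (P.x s ((h s).ranking.get k))

/-- `B_t = ∑_{s, k} O^Z_{s,k} Z_{s,k} x_{s,σ_s(k)}`. -/
def B (t : ℕ) (h : Fin t → Round n) : Fin dp × Fin dc → ℝ :=
  ∑ s : Fin t, ∑ k : Fin (h s).ranking.length,
    ((h s).OZ (k + 1) * (h s).Z (k + 1)) • P.x s ((h s).ranking.get k)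

/-- The ridge estimator `V_t⁻¹ B_t` of the unknown parameter. -/
def thetaHat (t : ℕ) (h : Fin t → Round n) : Fin dp × Fin dc → ℝ := (P.V t h)⁻¹ *ᵥ P.B t h

/-- The projection of the real line onto `[0, 1]`. -/
def proj (a : ℝ) : ℝ := max 0 (min 1 a)

/-- The optimistic estimator of the purchase probability of product `j` for the customer who
arrives after the `t` customers recorded in `h`. -/
def u (t : ℕ) (h : Fin t → Round n) (j : Fin n) : ℝ :=
  proj (P.x t j ⬝ᵥ P.thetaHat t h + P.rho t * √(P.x t j ⬝ᵥ ((P.V t h)⁻¹ *ᵥ P.x t j)))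

/-- `N_{t,k}`: how often it was observed whether the attention span ends at position `k`. -/
def N (t : ℕ) (h : Fin t → Round n) (k : ℕ) : ℝ := ∑ s : Fin t, (h s).OY P.M k

/-- The empirical failure rate at position `k`. -/
def hHat (t : ℕ) (h : Fin t → Round n) (k : ℕ) : ℝ :=
  (∑ s : Fin t, (h s).OY P.M k * (h s).Y k) / P.N t h k

/-- The lower confidence bound of the failure rate at position `k`, for the customer who arrives
after `t` others; it is `0` as long as there is no observation. -/
def hLow (t : ℕ) (h : Fin t → Round n) (k : ℕ) : ℝ :=
  if P.N t h k = 0 then 0 else proj (P.hHat t h k - √(Real.log (t + 1) / P.N t h k))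

/-- The optimistic estimator `∏_{k < x} (1 - h^L_k)` of the tail probability at `x`. -/
def GUp (t : ℕ) (h : Fin t → Round n) (x : ℕ) : ℝ := ∏ k ∈ Finset.Ico 1 x, (1 - P.hLow t h k)

/-- The policy `p` is RankUCB for the first `T` customers: after any records `h` of `t < T`
customers it displays an output of Best-x on the optimistic estimators. The slots which that output
leaves empty may stay empty or be filled, in part or in full, by any other products. -/
def IsRankUCB (T : ℕ) (p : Policy n) : Prop :=
  ∀ t < T, ∀ h : Fin t → Round n, ∃ σ rest : List (Fin n),
    IsBestX P.M P.r (P.u t h) (P.GUp t h) σ ∧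
      p t h = σ ++ rest ∧ (σ ++ rest).Nodup ∧ (σ ++ rest).length ≤ P.M

/-! ### Law of the customers and regret -/

/-- The joint law of the first `T` customers: everything is independent, every attention span has
law `ν`, and customer `t` finds product `j` satisfactory with probability `λ_{t,j}`. (The
projection onto the unit interval is only there to make the definition total.) -/
def customerLaw (Θ : Matrix (Fin dp) (Fin dc) ℝ) (ν : Measure ℕ) (T : ℕ) :
    Measure (Fin T → Customer n) :=
  Measure.pi fun t : Fin T =>
    ν.prod (Measure.pi fun j : Fin n =>
      bernoulliMeasure true false (Set.projIcc (0 : ℝ) 1 zero_le_one (P.lam Θ t j)))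

/-- The cumulative `e`-scaled regret of the policy `p` over the customers `c`. -/
def regret (Θ : Matrix (Fin dp) (Fin dc) ℝ) (ν : Measure ℕ) (p : Policy n) (T : ℕ)
    (c : Fin T → Customer n) : ℝ :=
  ∑ t : Fin T, (optimalRevenue P.M P.r (P.lam Θ t) ν -
    Real.exp 1 * expectedRevenue P.r (P.lam Θ t) ν (history p T c t).ranking)

end Setting

end

end ProductRanking

open ProductRanking

namespace ProductRanking

noncomputable section

/-! ### Revenue of a list viewed to its end -/

/-! The regret of a round splits into an approximation loss, which costs the factor `e`, and an
estimation loss.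

Approximation. When dearer products come first, the best revenue of at most `k` products obeys the
recursion `bestRevenue`, and the amount by which it falls short of a price bound is log-convex in
`k` (`bestRevenue_logConvex`). This has two consequences. Optimal assortments can be nested, so the
greedy AssortOpt is exact (`IsAssortOpt.optimal`), and the best revenue `H` is concave in the number
of products viewed. For a concave `H` and a tail `G` with increasing failure rate, `E H(X ∧ M) ≤ e *
max_x H x * G x` (`integral_concave_le`): the odds of failure have convex partial sums `ψ` with `E
ψ(X ∧ M) ≤ 1` and `1 / G ≤ exp ψ`, and Jensen's inequality at the mean of `X ∧ M` produces `exp 1`.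
Since `bestRevenue` increases with the purchase probabilities, Best-x on optimistic estimates loses
no more than `e` against the true optimum (`optimalRevenue_le_exp_mul`).

Estimation. The optimistic value exceeds the true revenue of the displayed list by at most `rmax`
times the estimation errors, each weighted with the true probability that the corresponding quantity
is observed (`optimistic_sub_cascadeSum_le`). Hence an error is only paid for when new data make it
smaller.

For the purchase probabilities, `exp (2 S V⁻¹ S) / √det V` with `S` the accumulated noise is a
supermartingale (`selfNormalized_step`). Markov's inequality at each fixed time bounds the failure
probability of the confidence ellipsoid by `1 / (t + 1) ^ 2`, which sums to at most `π ^ 2 / 6`, and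
the widths are summed through the growth of `log det V` (`expect_width_le`).

For the failure rates, Chernoff bounds and a union over the possible numbers of observations give
failure probability at most `t / (t + 1) ^ 2` per position, at most `log T` in total. The errors are
summed by a potential which uses the mean square of the actual deviations (`expect_spanWidth_le`);
this leaves enough room below `4 e √(T log T)` to absorb the logarithm (`exp_mul_add_log_le`). -/

/-- Expected revenue of the list `l` from a customer who views it until she is satisfied. -/
def cascadeRevenue {α : Type*} (r lam : α → ℝ) : List α → ℝ
  | [] => 0
  | j :: l => lam j * r j + (1 - lam j) * cascadeRevenue r lam l

/-- The largest revenue of a sublist of `L` with at most `k` entries. -/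
def bestRevenue {α : Type*} (r lam : α → ℝ) : List α → ℕ → ℝ
  | _, 0 => 0
  | [], _ + 1 => 0
  | j :: L, k + 1 =>
    max (bestRevenue r lam L (k + 1)) (lam j * r j + (1 - lam j) * bestRevenue r lam L k)

/-! ### Log-convexity of optimal revenues and nestedness of optimal lists. -/

section List

variable {α : Type*} {r lam : α → ℝ}

@[simp] lemma bestRevenue_zero (L : List α) : bestRevenue r lam L 0 = 0 := by
  cases L <;> rfl

@[simp] lemma bestRevenue_nil (k : ℕ) : bestRevenue r lam [] k = 0 := by
  cases k <;> rfl

lemma bestRevenue_cons_succ (j : α) (L : List α) (k : ℕ) :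
    bestRevenue r lam (j :: L) (k + 1) =
      max (bestRevenue r lam L (k + 1)) (lam j * r j + (1 - lam j) * bestRevenue r lam L k) := rfl

lemma cascadeRevenue_nonneg (hr : ∀ j, 0 ≤ r j) (h0 : ∀ j, 0 ≤ lam j) (h1 : ∀ j, lam j ≤ 1)
    (l : List α) : 0 ≤ cascadeRevenue r lam l := by
  induction l with
  | nil => exact le_rfl
  | cons j l ih =>
    exact add_nonneg (mul_nonneg (h0 j) (hr j)) (mul_nonneg (sub_nonneg.2 (h1 j)) ih)

lemma cascadeRevenue_le {ρ : ℝ} (hρ : 0 ≤ ρ) (h0 : ∀ j, 0 ≤ lam j) (h1 : ∀ j, lam j ≤ 1)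
    (l : List α) (hr : ∀ j ∈ l, r j ≤ ρ) : cascadeRevenue r lam l ≤ ρ := by
  induction l with
  | nil => exact hρ
  | cons j l ih =>
    have ih := ih fun i hi => hr i (List.mem_cons_of_mem _ hi)
    have hj := hr j List.mem_cons_self
    have a := mul_le_mul_of_nonneg_left hj (h0 j)
    have b := mul_le_mul_of_nonneg_left ih (sub_nonneg.2 (h1 j))
    show lam j * r j + (1 - lam j) * cascadeRevenue r lam l ≤ ρ
    linarith

lemma bestRevenue_nonneg (L : List α) (k : ℕ) : 0 ≤ bestRevenue r lam L k := by
  induction L generalizing k with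
  | nil => simp
  | cons j L ih =>
    cases k with
    | zero => simp
    | succ k => exact (ih (k + 1)).trans (le_max_left _ _)

lemma bestRevenue_le {ρ : ℝ} (hρ : 0 ≤ ρ) (h0 : ∀ j, 0 ≤ lam j) (h1 : ∀ j, lam j ≤ 1)
    (L : List α) (hr : ∀ j ∈ L, r j ≤ ρ) (k : ℕ) : bestRevenue r lam L k ≤ ρ := by
  induction L generalizing k with
  | nil => simpa using hρ
  | cons j L ih =>
    cases k with
    | zero => simpa using hρ
    | succ k =>
      have ih := ih fun i hi => hr i (List.mem_cons_of_mem _ hi)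
      have hj := hr j List.mem_cons_self
      refine max_le (ih _) ?_
      have a := mul_le_mul_of_nonneg_left hj (h0 j)
      have b := mul_le_mul_of_nonneg_left (ih k) (sub_nonneg.2 (h1 j))
      linarith

lemma bestRevenue_le_succ (h1 : ∀ j, lam j ≤ 1) (L : List α) (k : ℕ) : bestRevenue r lam L k ≤ bestRevenue r lam L (k + 1) := by
  induction L generalizing k with
  | nil => simp
  | cons j L ih =>
    cases k with
    | zero => simpa using bestRevenue_nonneg (j :: L) 1
    | succ k =>
      refine max_le_max (ih _) ?_
      have := mul_le_mul_of_nonneg_left (ih k) (sub_nonneg.2 (h1 j))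
      linarith

lemma bestRevenue_mono (h1 : ∀ j, lam j ≤ 1) (L : List α) : Monotone (bestRevenue r lam L) :=
  monotone_nat_of_le_succ (bestRevenue_le_succ h1 L)

lemma bestRevenue_succ_of_length_le (L : List α) (k : ℕ) (hk : L.length ≤ k) :
    bestRevenue r lam L (k + 1) = bestRevenue r lam L k := by
  induction L generalizing k with
  | nil => simp
  | cons j L ih =>
    cases k with
    | zero => simp at hk
    | succ k =>
      have hk : L.length ≤ k := by simpa using hk
      rw [bestRevenue_cons_succ, bestRevenue_cons_succ, ih k hk, ih (k + 1) (by omega), ih k hk]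

lemma cascadeRevenue_le_bestRevenue (h1 : ∀ j, lam j ≤ 1) {l L : List α} (h : l.Sublist L) :
    cascadeRevenue r lam l ≤ bestRevenue r lam L l.length := by
  induction h with
  | slnil => exact le_rfl
  | @cons l L j _ ih =>
    cases l with
    | nil => simp [cascadeRevenue]
    | cons i l => exact ih.trans (le_max_left _ _)
  | @cons_cons l L j _ ih =>
    refine le_trans ?_ (le_max_right _ _)
    have := mul_le_mul_of_nonneg_left ih (sub_nonneg.2 (h1 j))
    show lam j * r j + (1 - lam j) * cascadeRevenue r lam l ≤ _
    linarith

/-- Optimal revenues increase with the purchase probabilities when dearer products come first. -/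
lemma bestRevenue_mono_prob {lam' : α → ℝ} (hr : ∀ j, 0 ≤ r j) (h0 : ∀ j, 0 ≤ lam j)
    (h1' : ∀ j, lam' j ≤ 1) (hle : ∀ j, lam j ≤ lam' j) (L : List α)
    (hL : L.Pairwise fun i j => r j ≤ r i) (k : ℕ) :
    bestRevenue r lam L k ≤ bestRevenue r lam' L k := by
  induction L generalizing k with
  | nil => simp
  | cons j L ih =>
    cases k with
    | zero => simp
    | succ k =>
      rw [List.pairwise_cons] at hL
      refine max_le_max (ih hL.2 _) ?_
      have a := mul_le_mul_of_nonneg_left (ih hL.2 k) (sub_nonneg.2 ((hle j).trans (h1' j)))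
      -- A larger probability for `j` trades the continuation value for the price `r j`, which is no
      -- smaller because all later products are cheaper.
      have b := bestRevenue_le (hr j) (fun i => (h0 i).trans (hle i)) h1' L hL.1 k
      have c := mul_nonneg (sub_nonneg.2 (hle j)) (sub_nonneg.2 b)
      linarith

/-- Multiply the two log-convexity inequalities and cancel `b * c`. -/
lemma mul_le_mul_of_logConvex {a b c d : ℝ} (ha : 0 ≤ a) (hb : 0 ≤ b) (hc : 0 ≤ c) (hd : 0 ≤ d)
    (h1 : b ^ 2 ≤ a * c) (h2 : c ^ 2 ≤ b * d) : b * c ≤ a * d := by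
  rcases hb.eq_or_lt with rfl | hb
  · simpa using mul_nonneg ha hd
  rcases hc.eq_or_lt with rfl | hc
  · simpa using mul_nonneg ha hd
  have h : b ^ 2 * c ^ 2 ≤ (a * c) * (b * d) := mul_le_mul h1 h2 (by positivity) (by positivity)
  have hbc : 0 < b * c := mul_pos hb hc
  nlinarith

/-- The amount by which optimal revenues fall short of an upper bound of the prices is log-convex
in the number of products when dearer products come first. -/
lemma bestRevenue_logConvex (hr : ∀ j, 0 ≤ r j) (h0 : ∀ j, 0 ≤ lam j) (h1 : ∀ j, lam j ≤ 1)
    (L : List α) (hL : L.Pairwise fun i j => r j ≤ r i) (ρ : ℝ) (hρ0 : 0 ≤ ρ)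
    (hρ : ∀ j ∈ L, r j ≤ ρ) (k : ℕ) :
    (ρ - bestRevenue r lam L (k + 1)) ^ 2 ≤
      (ρ - bestRevenue r lam L k) * (ρ - bestRevenue r lam L (k + 2)) := by
  induction L generalizing ρ k with
  | nil => simp [sq]
  | cons j L ih =>
    rw [List.pairwise_cons] at hL
    -- It suffices to treat the price bound `r j`: for it the recursion of the deficits is `min (D
    -- (k + 1)) (q * D k)`, which inherits log-convexity from `D`. Raising the bound adds a constant
    -- to the deficits, and log-convexity survives because it entails convexity.
    have key : (r j - bestRevenue r lam (j :: L) (k + 1)) ^ 2 ≤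
        (r j - bestRevenue r lam (j :: L) k) * (r j - bestRevenue r lam (j :: L) (k + 2)) := by
      set D : ℕ → ℝ := fun k => r j - bestRevenue r lam L k with hD
      have hDn : ∀ k, 0 ≤ D k := fun k => sub_nonneg.2 (bestRevenue_le (hr j) h0 h1 L hL.1 k)
      have hDc : ∀ k, D (k + 1) ^ 2 ≤ D k * D (k + 2) := ih hL.2 (r j) (hr j) hL.1
      have hq : 0 ≤ 1 - lam j := sub_nonneg.2 (h1 j)
      set q := 1 - lam j with hqd
      have hstep : ∀ k, r j - bestRevenue r lam (j :: L) (k + 1) = min (D (k + 1)) (q * D k) := by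
        intro k
        rw [bestRevenue_cons_succ, ← min_sub_sub_left]
        congr 1
        simp only [hD, hqd]; ring
      rw [hstep, hstep]
      have hm1 := min_le_left (D (k + 1)) (q * D k)
      have hm2 := min_le_right (D (k + 1)) (q * D k)
      have hm0 : 0 ≤ min (D (k + 1)) (q * D k) := le_min (hDn _) (mul_nonneg hq (hDn _))
      set m := min (D (k + 1)) (q * D k)
      have hmm : m ^ 2 ≤ D (k + 1) * (q * D k) := by
        rw [sq]; exact mul_le_mul hm1 hm2 hm0 (hDn _)
      have hm1s : m ^ 2 ≤ D (k + 1) ^ 2 := pow_le_pow_left₀ hm0 hm1 2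
      -- At `k = 0` the deficit is `D 0` itself and not a minimum.
      cases k with
      | zero =>
        have e : r j - bestRevenue r lam (j :: L) 0 = D 0 := by simp [hD]
        rw [e, mul_min_of_nonneg _ _ (hDn 0)]
        refine le_min (hm1s.trans (hDc 0)) (hmm.trans (le_of_eq (by ring)))
      | succ k =>
        rw [hstep, mul_min_of_nonneg _ _ (le_min (hDn _) (mul_nonneg hq (hDn _))),
          min_mul_of_nonneg _ _ (hDn _), min_mul_of_nonneg _ _ (mul_nonneg hq (hDn _))]
        have hm2s : m ^ 2 ≤ (q * D (k + 1)) ^ 2 := pow_le_pow_left₀ hm0 hm2 2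
        refine le_min (le_min (hm1s.trans (hDc _)) ?_) (le_min ?_ ?_)
        · have := mul_le_mul_of_logConvex (hDn k) (hDn (k + 1)) (hDn (k + 2)) (hDn (k + 3))
            (hDc k) (hDc (k + 1))
          have := mul_le_mul_of_nonneg_left this hq
          refine hmm.trans (le_trans (le_of_eq ?_) (this.trans (le_of_eq ?_))) <;> ring
        · refine hmm.trans (le_of_eq (by ring))
        · have := mul_le_mul_of_nonneg_left (hDc k) (mul_nonneg hq hq)
          refine hm2s.trans (le_trans (le_of_eq ?_) (this.trans (le_of_eq ?_))) <;> ring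
    have hc : 0 ≤ ρ - r j := sub_nonneg.2 (hρ j List.mem_cons_self)
    have hb := bestRevenue_le (r := r) (hr j) h0 h1 (j :: L) (by simpa using hL.1)
    have ha := sub_nonneg.2 (hb k)
    have hd := sub_nonneg.2 (hb (k + 2))
    have he := sub_nonneg.2 (hb (k + 1))
    generalize bestRevenue r lam (j :: L) k = A at *
    generalize bestRevenue r lam (j :: L) (k + 1) = B at *
    generalize bestRevenue r lam (j :: L) (k + 2) = C at *
    have h2 : 2 * (r j - B) ≤ (r j - A) + (r j - C) := by
      refine abs_le_of_sq_le_sq' ?_ (add_nonneg ha hd) |>.2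
      nlinarith [sq_nonneg ((r j - A) - (r j - C))]
    nlinarith [mul_le_mul_of_nonneg_left h2 hc]

/-- By the arithmetic-geometric mean inequality, nonnegative log-convex deficits are convex. -/
lemma bestRevenue_concave (hr : ∀ j, 0 ≤ r j) (h0 : ∀ j, 0 ≤ lam j) (h1 : ∀ j, lam j ≤ 1)
    (L : List α) (hL : L.Pairwise fun i j => r j ≤ r i) (k : ℕ) :
    bestRevenue r lam L (k + 2) - bestRevenue r lam L (k + 1) ≤
      bestRevenue r lam L (k + 1) - bestRevenue r lam L k := by
  obtain ⟨ρ, hρ0, hρ⟩ : ∃ ρ, 0 ≤ ρ ∧ ∀ j ∈ L, r j ≤ ρ := by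
    cases L with
    | nil => exact ⟨0, le_rfl, by simp⟩
    | cons j L => exact ⟨r j, hr j, by simpa using (List.pairwise_cons.1 hL).1⟩
  have hb := bestRevenue_le hρ0 h0 h1 L hρ
  have h := bestRevenue_logConvex hr h0 h1 L hL ρ hρ0 hρ k
  have ha := sub_nonneg.2 (hb k)
  have hd := sub_nonneg.2 (hb (k + 2))
  have h2 : 2 * (ρ - bestRevenue r lam L (k + 1)) ≤
      (ρ - bestRevenue r lam L k) + (ρ - bestRevenue r lam L (k + 2)) := by
    refine abs_le_of_sq_le_sq' ?_ (add_nonneg ha hd) |>.2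
    nlinarith [sq_nonneg ((ρ - bestRevenue r lam L k) - (ρ - bestRevenue r lam L (k + 2)))]
  linarith

lemma exists_sublist_between {l L : List α} (h : l.Sublist L) (hlt : l.length < L.length) :
    ∃ l', l.Sublist l' ∧ l'.Sublist L ∧ l'.length = l.length + 1 := by
  induction h with
  | slnil => simp at hlt
  | @cons l L j h ih =>
    exact ⟨j :: l, List.sublist_cons_self _ _, h.cons_cons j, rfl⟩
  | @cons_cons l L j h ih =>
    obtain ⟨l', h1, h2, h3⟩ := ih (by simpa using hlt)
    exact ⟨j :: l', h1.cons_cons j, h2.cons_cons j, by simp [h3]⟩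

/-- Greedy extension: an optimal list of `k` products is contained in an optimal list of `k + 1`
products. -/
lemma exists_bestRevenue_extension (hr : ∀ j, 0 ≤ r j) (h0 : ∀ j, 0 ≤ lam j)
    (h1 : ∀ j, lam j ≤ 1) {l L : List α} (hL : L.Pairwise fun i j => r j ≤ r i)
    (h : l.Sublist L) (hlt : l.length < L.length)
    (hopt : cascadeRevenue r lam l = bestRevenue r lam L l.length) :
    ∃ l', l.Sublist l' ∧ l'.Sublist L ∧ l'.length = l.length + 1 ∧
      cascadeRevenue r lam l' = bestRevenue r lam L (l.length + 1) := by
  induction h with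
  | slnil => simp at hlt
  | @cons l L j h ih =>
    rw [List.pairwise_cons] at hL
    have hle := cascadeRevenue_le_bestRevenue (r := r) h1 h
    have hopt' : cascadeRevenue r lam l = bestRevenue r lam L l.length := by
      refine le_antisymm hle ?_
      rw [hopt]
      cases l with
      | nil => simp
      | cons i l => exact le_max_left _ _
    -- Either an optimal list of one more product starts with `j`, and then `j :: l` is one, or it
    -- may skip `j`, and induction applies to the tail.
    by_cases hc : bestRevenue r lam L (l.length + 1) ≤
        lam j * r j + (1 - lam j) * bestRevenue r lam L l.length
    · refine ⟨j :: l, List.sublist_cons_self _ _, h.cons_cons j, rfl, ?_⟩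
      rw [bestRevenue_cons_succ, max_eq_right hc, ← hopt']; rfl
    · push Not at hc
      have hl : l.length < L.length := by
        by_contra hge
        rw [bestRevenue_succ_of_length_le _ _ (not_lt.1 hge)] at hc
        have := mul_nonneg (h0 j)
          (sub_nonneg.2 (bestRevenue_le (hr j) h0 h1 L hL.1 l.length))
        linarith
      obtain ⟨l', a, b, c, e⟩ := ih hL.2 hl hopt'
      exact ⟨l', a, b.cons j, c, by rw [bestRevenue_cons_succ, max_eq_left hc.le, e]⟩
  | @cons_cons l L j h ih =>
    rw [List.pairwise_cons] at hL
    have hlt' : l.length < L.length := by simpa using hlt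
    have hle := cascadeRevenue_le_bestRevenue (r := r) h1 h
    have hb := bestRevenue_le (hr j) h0 h1 L hL.1
    rw [List.length_cons, bestRevenue_cons_succ] at hopt
    have hcas : ∀ l, cascadeRevenue r lam (j :: l) =
      lam j * r j + (1 - lam j) * cascadeRevenue r lam l := fun _ => rfl
    rw [hcas] at hopt
    -- If `lam j = 1`, nothing behind `j` matters: `l` need not be optimal, and any extension will
    -- do.
    rcases (h1 j).eq_or_lt with hj | hj
    · obtain ⟨l', a, b, c⟩ := exists_sublist_between h hlt'
      refine ⟨j :: l', a.cons_cons j, b.cons_cons j, by simp [c], ?_⟩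
      rw [hcas, List.length_cons, bestRevenue_cons_succ, hj]
      simp [hb]
    · have hq : 0 < 1 - lam j := sub_pos.2 hj
      have hopt' : cascadeRevenue r lam l = bestRevenue r lam L l.length := by
        refine le_antisymm hle ?_
        have := (le_max_right (bestRevenue r lam L (l.length + 1))
          (lam j * r j + (1 - lam j) * bestRevenue r lam L l.length)).trans hopt.ge
        exact le_of_mul_le_mul_left (by linarith) hq
      obtain ⟨l', a, b, c, e⟩ := ih hL.2 hlt' hopt'
      refine ⟨j :: l', a.cons_cons j, b.cons_cons j, by simp [c], ?_⟩
      rw [hcas, List.length_cons, bestRevenue_cons_succ, e, eq_comm, max_eq_right]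
      -- Optimality of `j :: l` against lists without `j` says `(1 - lam j) * D k ≤ D (k + 1)` for
      -- the deficits `D` below `r j`. Log-convexity passes this ratio bound on to `D (k + 1)` and
      -- `D (k + 2)`.
      have hx := (le_max_left (bestRevenue r lam L (l.length + 1))
          (lam j * r j + (1 - lam j) * bestRevenue r lam L l.length)).trans hopt.ge
      rw [hopt'] at hx
      have hlc := bestRevenue_logConvex hr h0 h1 L hL.2 (r j) (hr j) hL.1 l.length
      have d0 := sub_nonneg.2 (hb l.length)
      have d1 := sub_nonneg.2 (hb (l.length + 1))
      have d2 := sub_nonneg.2 (hb (l.length + 2))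
      show bestRevenue r lam L (l.length + 2) ≤ _
      have dm := bestRevenue_mono (r := r) h1 L (Nat.le_succ l.length)
      simp only [Nat.succ_eq_add_one] at dm
      generalize bestRevenue r lam L l.length = A at *
      generalize bestRevenue r lam L (l.length + 1) = B at *
      generalize bestRevenue r lam L (l.length + 2) = C at *
      have h3 : (1 - lam j) * (r j - A) ≤ r j - B := by linarith
      suffices (1 - lam j) * (r j - B) ≤ r j - C by linarith
      rcases d0.eq_or_lt with hA | hA
      · have : r j - B = 0 := by linarith
        rw [this]; simpa using d2
      · refine le_of_mul_le_mul_left ?_ hA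
        have := mul_le_mul_of_nonneg_right h3 d1
        nlinarith

/-- Exchange argument: moving `j` behind a product `i` of smaller index gains `lam i * lam j * (r i
- r j) ≥ 0`. -/
lemma cascadeRevenue_orderedInsert_le [LinearOrder α] (h0 : ∀ j, 0 ≤ lam j)
    (h1 : ∀ j, lam j ≤ 1) (hr : Antitone r) (j : α) (l : List α) :
    cascadeRevenue r lam (j :: l) ≤ cascadeRevenue r lam (l.orderedInsert (· ≤ ·) j) := by
  induction l with
  | nil => simp
  | cons i l ih =>
    by_cases h : j ≤ i
    · simp [List.orderedInsert, h]
    · simp only [List.orderedInsert, h, if_false]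
      have a := mul_le_mul_of_nonneg_left ih (sub_nonneg.2 (h1 i))
      have b := mul_le_mul_of_nonneg_left (hr (le_of_not_ge h)) (mul_nonneg (h0 i) (h0 j))
      simp only [cascadeRevenue] at a ⊢
      linarith

lemma cascadeRevenue_insertionSort_le [LinearOrder α] (h0 : ∀ j, 0 ≤ lam j)
    (h1 : ∀ j, lam j ≤ 1) (hr : Antitone r) (l : List α) :
    cascadeRevenue r lam l ≤ cascadeRevenue r lam (l.insertionSort (· ≤ ·)) := by
  induction l with
  | nil => simp
  | cons j l ih =>
    refine le_trans ?_ (cascadeRevenue_orderedInsert_le h0 h1 hr j _)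
    have := mul_le_mul_of_nonneg_left ih (sub_nonneg.2 (h1 j))
    exact add_le_add le_rfl this

end List

/-! ### Optimality of AssortOpt. -/

section Rankings

variable {n : ℕ} {r lam : Fin n → ℝ}

lemma fixedSpanRevenue_eq (σ : List (Fin n)) (x : ℕ) :
    fixedSpanRevenue r lam σ x = cascadeRevenue r lam (σ.take x) := by
  induction σ generalizing x with
  | nil => simp [fixedSpanRevenue, cascadeRevenue]
  | cons j σ ih =>
    cases x with
    | zero => simp [fixedSpanRevenue, cascadeRevenue]
    | succ x =>
      rw [List.take_succ_cons, cascadeRevenue, ← ih]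
      unfold fixedSpanRevenue
      refine (Fin.sum_univ_succ (n := σ.length) _).trans ?_
      rw [Finset.mul_sum]
      congr 1
      · simp
      · refine Finset.sum_congr rfl fun k _ => ?_
        simp [mul_assoc]

lemma finRange_pairwise_price (hr : Antitone r) :
    (List.finRange n).Pairwise fun i j => r j ≤ r i :=
  (List.pairwise_lt_finRange n).imp fun h => hr h.le

lemma sublist_finRange {l : List (Fin n)} (hl : l.Nodup) (hs : l.Pairwise (· ≤ ·)) :
    l.Sublist (List.finRange n) := by
  refine List.sublist_of_subperm_of_pairwise (r := (· ≤ ·)) ?_ hs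
    ((List.pairwise_lt_finRange n).imp fun h => h.le)
  exact List.subperm_of_subset hl fun _ _ => List.mem_finRange _

lemma cascadeRevenue_le_bestRevenue_finRange (hr : Antitone r)
    (h0 : ∀ j, 0 ≤ lam j) (h1 : ∀ j, lam j ≤ 1) {l : List (Fin n)} (hl : l.Nodup) :
    cascadeRevenue r lam l ≤ bestRevenue r lam (List.finRange n) l.length := by
  refine (cascadeRevenue_insertionSort_le h0 h1 hr l).trans ?_
  rw [← List.length_insertionSort (· ≤ ·) l]
  refine cascadeRevenue_le_bestRevenue h1 (sublist_finRange ?_ ?_)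
  · exact (List.perm_insertionSort (· ≤ ·) l).nodup_iff.2 hl
  · exact List.pairwise_insertionSort _ l

lemma indexRanking_sublist (S : Finset (Fin n)) : (indexRanking S).Sublist (List.finRange n) :=
  sublist_finRange (Finset.sort_nodup _ _) (Finset.pairwise_sort _ _)

/-- AssortOpt computes optimal assortments of all sizes. -/
lemma IsAssortOpt.optimal {M : ℕ} (hMn : M ≤ n) (hr0 : ∀ j, 0 ≤ r j) (hr : Antitone r)
    (h0 : ∀ j, 0 ≤ lam j) (h1 : ∀ j, lam j ≤ 1) {S : ℕ → Finset (Fin n)}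
    (h : IsAssortOpt M r lam S) {x : ℕ} (hx : x ≤ M) :
    (S x).card = x ∧
      cascadeRevenue r lam (indexRanking (S x)) = bestRevenue r lam (List.finRange n) x := by
  induction x with
  | zero => simp [h.1, indexRanking, cascadeRevenue]
  | succ x ih =>
    obtain ⟨hc, ho⟩ := ih (by omega)
    obtain ⟨j, hj, hS, hmax⟩ := h.2 x (by omega)
    have hlen : ∀ i ∉ S x, (indexRanking (insert i (S x))).length = x + 1 := by
      intro i hi
      rw [indexRanking, Finset.length_sort, Finset.card_insert_of_notMem hi, hc]
    refine ⟨by rw [hS, Finset.card_insert_of_notMem hj, hc], le_antisymm ?_ ?_⟩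
    · have := cascadeRevenue_le_bestRevenue (r := r) h1 (indexRanking_sublist (S (x + 1)))
      rwa [hS, hlen j hj, ← hS] at this
    have hl : (indexRanking (S x)).length = x := by rw [indexRanking, Finset.length_sort, hc]
    -- Some optimal assortment of size `x + 1` contains `S x`; its extra product is one of the
    -- candidates that the greedy choice has to beat.
    obtain ⟨l', a, b, c, e⟩ := exists_bestRevenue_extension hr0 h0 h1 (finRange_pairwise_price hr)
      (indexRanking_sublist (S x)) (by rw [hl, List.length_finRange]; omega) (by rw [hl, ho])
    rw [hl] at c e
    have hnd : l'.Nodup := b.nodup (List.nodup_finRange n)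
    have hsub : S x ⊆ l'.toFinset := by
      intro i hi
      rw [List.mem_toFinset]
      exact a.subset ((Finset.mem_sort _).2 hi)
    have hcard : l'.toFinset.card = (S x).card + 1 := by
      rw [List.toFinset_card_of_nodup hnd, c, hc]
    obtain ⟨i, hi, hins⟩ := (Finset.covBy_iff_exists_insert).1
      ((Finset.covBy_iff_card_sdiff_eq_one).2 ⟨hsub, by
        rw [Finset.card_sdiff_of_subset hsub, hcard]; omega⟩)
    have hl' : indexRanking (insert i (S x)) = l' := by
      rw [hins, indexRanking]
      exact (List.toFinset_sort (· ≤ ·) hnd).2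
        (((List.pairwise_lt_finRange n).imp fun h => h.le).sublist b)
    have := hmax i hi
    rw [fixedSpanRevenue_eq, fixedSpanRevenue_eq, List.take_of_length_le (hlen i hi).le,
      List.take_of_length_le (hlen j hj).le, hl', e, ← hS] at this
    exact this

end Rankings

/-! ### Attention spans with increasing failure rate -/

section Tail

variable {ν : Measure ℕ}

lemma tail_nonneg (x : ℕ) : 0 ≤ tail ν x := measureReal_nonneg

lemma integral_indicator_le (x : ℕ) : ∫ y, (if x ≤ y then (1 : ℝ) else 0) ∂ν = tail ν x := by
  have : (fun y => if x ≤ y then (1 : ℝ) else 0) = (Set.Ici x).indicator 1 := by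
    ext y; simp [Set.indicator_apply]
  rw [this, integral_indicator_one measurableSet_Ici, tail]

lemma ae_one_le (hν : ν {0} = 0) : ∀ᵐ x ∂ν, 1 ≤ x := by
  rw [ae_iff]
  convert hν using 2
  ext x; simp

variable [IsProbabilityMeasure ν]

lemma tail_antitone : Antitone (tail ν) := fun _ _ h =>
  measureReal_mono (Set.Ici_subset_Ici.2 h)

lemma tail_one (hν : ν {0} = 0) : tail ν 1 = 1 := by
  have h : (Set.Ici 1 : Set ℕ) = {0}ᶜ := by
    ext x; simp [Nat.one_le_iff_ne_zero]
  rw [tail, h, measureReal_compl (measurableSet_singleton 0), probReal_univ, measureReal_def, hν]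
  simp

lemma tail_sub_tail_succ (x : ℕ) : tail ν x - tail ν (x + 1) = ν.real {x} := by
  have h : (Set.Ici x : Set ℕ) = {x} ∪ Set.Ici (x + 1) := by
    ext y; simp; omega
  rw [tail, tail, h, measureReal_union (by simp) measurableSet_Ici]
  ring

lemma integrable_of_bounded_nat {f : ℕ → ℝ} (C : ℝ) (h : ∀ x, |f x| ≤ C) : Integrable f ν :=
  Integrable.of_bound (by fun_prop) C (Filter.Eventually.of_forall h)

lemma integrable_comp_min (f : ℕ → ℝ) (M : ℕ) : Integrable (fun x => f (min x M)) ν :=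
  integrable_of_bounded_nat (∑ i ∈ Finset.range (M + 1), |f i|) fun x =>
    Finset.single_le_sum (f := fun i => |f i|) (fun _ _ => abs_nonneg _)
      (Finset.mem_range.2 (Nat.lt_succ_of_le (min_le_right x M)))

end Tail

/-- Decreasing increments keep the sequence below the secant through `a` and `a + 1` on both sides;
the induction is on the distance from `a`. -/
lemma le_tangent_of_concave {H : ℕ → ℝ} {M a : ℕ}
    (hc : ∀ k, 1 ≤ k → k + 2 ≤ M → H (k + 2) - H (k + 1) ≤ H (k + 1) - H k)
    (ha : 1 ≤ a) (haM : a + 1 ≤ M) {x : ℕ} (hx : 1 ≤ x) (hxM : x ≤ M) :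
    H x ≤ H a + (H (a + 1) - H a) * ((x : ℝ) - a) := by
  rcases le_total a x with h | h
  · obtain ⟨i, rfl⟩ := Nat.exists_eq_add_of_le h
    have key : ∀ i, a + i ≤ M → H (a + i) ≤ H a + (H (a + 1) - H a) * i ∧
        (a + i + 1 ≤ M → H (a + i + 1) - H (a + i) ≤ H (a + 1) - H a) := by
      intro i
      induction i with
      | zero => simp
      | succ i ih =>
        intro hi
        obtain ⟨h1, h2⟩ := ih (by omega)
        have h3 := h2 (by omega)
        refine ⟨?_, fun hi' => (hc (a + i) (by omega) (by omega)).trans h3⟩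
        rw [← add_assoc]; push_cast; linarith
    have := (key i hxM).1
    push_cast; linarith
  · obtain ⟨i, rfl⟩ := Nat.exists_eq_add_of_le h
    have key : ∀ i y, y + i = x + i → 1 ≤ y → y + i + 1 ≤ M →
        H (y + i + 1) - H (y + i) ≤ H (y + 1) - H y := by
      intro i y _ hy
      induction i with
      | zero => simp
      | succ i ih =>
        intro hi
        exact (hc (y + i) (by omega) (by omega)).trans (ih (by omega) (by omega))
    have key2 : ∀ i y, 1 ≤ y → y + i + 1 ≤ M →
        H y ≤ H (y + i) - (H (y + i + 1) - H (y + i)) * i := by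
      intro i
      induction i with
      | zero => simp
      | succ i ih =>
        intro y hy hi
        have h1 := ih (y + 1) (by omega) (by omega)
        have h2 := key (i + 1) x rfl
        have h3 : H (y + (i + 1) + 1) - H (y + (i + 1)) ≤ H (y + 1) - H y := by
          clear h1 h2 ih
          generalize i + 1 = m at *
          induction m with
          | zero => simp
          | succ m ih => exact (hc (y + m) (by omega) (by omega)).trans (ih (by omega))
        rw [show y + 1 + i = y + (i + 1) by ring] at h1
        push_cast
        linarith
    have := key2 i x hx haM
    push_cast; linarith

/-- An attention span with increasing failure rate whose tail does not vanish up to `M`: the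
mean of a concave reward is at most `e` times the best value of reward times tail. -/
lemma integral_concave_le_of_tail_pos {ν : Measure ℕ} [IsProbabilityMeasure ν] (hν : ν {0} = 0)
    {M : ℕ} (hM : 1 ≤ M) (hIFR : HasIFR M ν) (hpos : 0 < tail ν M) {H : ℕ → ℝ} {W : ℝ}
    (hH0 : 0 ≤ H 1)
    (hc : ∀ k, 1 ≤ k → k + 2 ≤ M → H (k + 2) - H (k + 1) ≤ H (k + 1) - H k)
    (hW : ∀ x, 1 ≤ x → x ≤ M → H x * tail ν x ≤ W) :
    ∫ x, H (min x M) ∂ν ≤ Real.exp 1 * W := by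
  have hae := ae_one_le hν
  have hW0 : 0 ≤ W := by
    have := hW 1 le_rfl hM
    rw [tail_one hν] at this; linarith
  have hG : ∀ x ≤ M, 0 < tail ν x := fun x hx => hpos.trans_le (tail_antitone hx)
  -- The secant used below needs two positions `a`, `a + 1` in `[1, M]`.
  rcases hM.eq_or_lt with rfl | hM2
  · have : ∫ x, H (min x 1) ∂ν = ∫ x, H 1 ∂ν := by
      refine integral_congr_ae ?_
      filter_upwards [hae] with x hx
      rw [min_eq_right hx]
    rw [this, integral_const, probReal_univ, one_smul]
    have h1 := hW 1 le_rfl le_rfl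
    rw [tail_one hν] at h1
    have := Real.add_one_le_exp 1
    nlinarith
  set μ := ∫ x, ((min x M : ℕ) : ℝ) ∂ν with hμ
  have hintμ := integrable_comp_min (ν := ν) (fun i => (i : ℝ)) M
  have hμ1 : 1 ≤ μ := by
    have : ∫ _, (1 : ℝ) ∂ν ≤ μ := by
      refine integral_mono_ae (integrable_const _) hintμ ?_
      filter_upwards [hae] with x hx
      exact_mod_cast le_min hx hM
    simpa using this
  have hμM : μ ≤ M := by
    have : μ ≤ ∫ _, (M : ℝ) ∂ν := by
      refine integral_mono hintμ (integrable_const _) fun x => ?_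
      exact Nat.cast_le.2 (min_le_right x M)
    simpa using this
  -- `a` is the integer part of the mean, except when the mean equals `M`, where `M - 1` keeps `a +
  -- 1` in range.
  obtain ⟨a, ha, haM, haμ, hμa⟩ : ∃ a : ℕ, 1 ≤ a ∧ a + 1 ≤ M ∧ (a : ℝ) ≤ μ ∧ μ ≤ a + 1 := by
    by_cases h : ⌊μ⌋₊ + 1 ≤ M
    · exact ⟨⌊μ⌋₊, Nat.le_floor (by simpa using hμ1), h, Nat.floor_le (by linarith),
        (Nat.lt_floor_add_one μ).le⟩
    · refine ⟨M - 1, by omega, by omega, ?_, ?_⟩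
      · refine le_trans ?_ (Nat.floor_le (by linarith : (0 : ℝ) ≤ μ))
        exact_mod_cast (by omega : M - 1 ≤ ⌊μ⌋₊)
      · rw [Nat.cast_sub hM]; push_cast; linarith
  have hint : ∀ c d : ℝ, ∫ x, (c + d * (((min x M : ℕ) : ℝ) - a)) ∂ν = c + d * (μ - a) := by
    intro c d
    have hs : Integrable (fun x => ((min x M : ℕ) : ℝ) - a) ν := hintμ.sub (integrable_const _)
    rw [integral_add (integrable_const _) (hs.const_mul d),
      integral_const_mul, integral_sub hintμ (integrable_const _)]
    simp [hμ]
  have hH : ∫ x, H (min x M) ∂ν ≤ H a + (H (a + 1) - H a) * (μ - a) := by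
    rw [← hint]
    refine integral_mono_ae (integrable_comp_min _ _)
      (integrable_comp_min (fun i : ℕ => H a + (H (a + 1) - H a) * ((i : ℝ) - a)) M) ?_
    filter_upwards [hae] with x hx
    exact le_tangent_of_concave hc ha haM (le_min hx hM) (min_le_right _ _)
  -- `o i` is the odds of failure at `i`, nondecreasing by the increasing failure rate, so that its
  -- partial sums `ψ` are convex. The products `o i * tail ν (i + 1)` telescope, which bounds the
  -- mean of `ψ` by `1`.
  set o : ℕ → ℝ := fun i => tail ν i / tail ν (i + 1) - 1 with ho
  set ψ : ℕ → ℝ := fun x => ∑ i ∈ Finset.Ico 1 x, o i with hψ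
  have hψs : ∀ x, 1 ≤ x → ψ (x + 1) = ψ x + o x := fun x hx => Finset.sum_Ico_succ_top hx _
  have hψint : ∫ x, ψ (min x M) ∂ν ≤ 1 := by
    have e : ∀ x, ψ (min x M) = ∑ i ∈ Finset.Ico 1 M, o i * (if i + 1 ≤ x then 1 else 0) := by
      intro x
      simp only [mul_ite, mul_one, mul_zero, ← Finset.sum_filter, hψ]
      refine Finset.sum_congr ?_ fun _ _ => rfl
      ext i; simp; omega
    simp_rw [e]
    rw [integral_finsetSum _ fun i _ => (integrable_of_bounded_nat 1 fun x => by
      split_ifs <;> simp).const_mul _]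
    simp_rw [integral_const_mul, integral_indicator_le]
    have e2 : ∀ i ∈ Finset.Ico 1 M, o i * tail ν (i + 1) = tail ν i - tail ν (i + 1) := by
      intro i hi
      have := (hG (i + 1) (by simp at hi; omega)).ne'
      simp only [ho]; field_simp
    rw [Finset.sum_congr rfl e2, Finset.sum_Ico_eq_sum_range]
    have := Finset.sum_range_sub' (fun i => tail ν (1 + i)) (M - 1)
    simp only [← add_assoc] at this
    rw [this, add_zero, tail_one hν]
    linarith [tail_nonneg (ν := ν) (1 + (M - 1))]
  -- Jensen's inequality for `ψ`, with the same secant as for `H`.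
  have hψa : ψ a + o a * (μ - a) ≤ 1 := by
    refine le_trans ?_ hψint
    rw [← hint]
    refine integral_mono_ae (integrable_comp_min (fun i : ℕ => ψ a + o a * ((i : ℝ) - a)) M)
      (integrable_comp_min _ _) ?_
    filter_upwards [hae] with x hx
    have hcv : ∀ k, 1 ≤ k → k + 2 ≤ M →
        (-ψ) (k + 2) - (-ψ) (k + 1) ≤ (-ψ) (k + 1) - (-ψ) k := by
      intro k hk hkM
      simp only [Pi.neg_apply]
      rw [hψs (k + 1) (by omega), hψs k hk]
      have h1 := hIFR (k + 1) (by omega) (by omega)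
      simp only [Nat.add_sub_cancel] at h1
      have h2 : o k ≤ o (k + 1) := by
        simp only [ho]
        have := (div_le_div_iff₀ (hG (k + 1) (by omega)) (hG (k + 1 + 1) (by omega))).2
          (show tail ν k * tail ν (k + 1 + 1) ≤ tail ν (k + 1) * tail ν (k + 1) by nlinarith)
        linarith
      linarith
    have := le_tangent_of_concave hcv ha haM (le_min hx hM) (min_le_right x M)
    simp only [Pi.neg_apply] at this
    rw [hψs a ha] at this
    show ψ a + o a * (((min x M : ℕ) : ℝ) - a) ≤ ψ (min x M)
    linarith
  -- `1 / tail` is the product of the factors `1 + o i ≤ exp (o i)`.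
  have hψexp : ∀ x, x + 1 ≤ M → 1 / tail ν (x + 1) ≤ Real.exp (ψ (x + 1)) := by
    intro x
    induction x with
    | zero => intro _; simp [hψ, tail_one hν]
    | succ x ih =>
      intro hx
      have h1 := ih (by omega)
      rw [hψs (x + 1) (by omega), Real.exp_add]
      have h2 := Real.add_one_le_exp (o (x + 1))
      have g1 := hG (x + 1) (by omega)
      have g2 := hG (x + 1 + 1) hx
      have h3 : 1 / tail ν (x + 1 + 1) = 1 / tail ν (x + 1) * (o (x + 1) + 1) := by
        simp only [ho]; field_simp; ring
      rw [h3]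
      refine mul_le_mul h1 h2 ?_ (Real.exp_pos _).le
      simp only [ho]
      have := div_pos g1 g2
      linarith
  have ga := hG a (by omega)
  have gb := hG (a + 1) haM
  have hHa : H a ≤ W * (1 / tail ν a) := by
    rw [mul_one_div, le_div_iff₀ ga]; exact hW a ha (by omega)
  -- Written with `1 / tail ν a`, the bounds at `a` and `a + 1` interpolate to the factor `1 + o a *
  -- (μ - a)`, again at most an exponential.
  have hHb : H (a + 1) ≤ W * (1 / tail ν a) * (o a + 1) := by
    have : W * (1 / tail ν a) * (o a + 1) = W / tail ν (a + 1) := by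
      simp only [ho]; field_simp; ring
    rw [this, le_div_iff₀ gb]; exact hW (a + 1) (by omega) haM
  have ha' : 1 / tail ν a ≤ Real.exp (ψ a) := by
    obtain ⟨b, rfl⟩ := Nat.exists_eq_add_of_le' ha
    exact hψexp b (by omega)
  have oa : 0 ≤ o a := by
    simp only [ho]
    have := (one_le_div gb).2 (tail_antitone (Nat.le_succ a))
    linarith
  have hδ : 0 ≤ μ - a := sub_nonneg.2 haμ
  calc ∫ x, H (min x M) ∂ν ≤ (1 - (μ - a)) * H a + (μ - a) * H (a + 1) := by linarith
    _ ≤ (1 - (μ - a)) * (W * (1 / tail ν a)) + (μ - a) * (W * (1 / tail ν a) * (o a + 1)) :=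
        add_le_add (mul_le_mul_of_nonneg_left hHa (by linarith))
          (mul_le_mul_of_nonneg_left hHb hδ)
    _ = W * (1 / tail ν a * (o a * (μ - a) + 1)) := by ring
    _ ≤ W * (Real.exp (ψ a) * Real.exp (o a * (μ - a))) := by
        refine mul_le_mul_of_nonneg_left (mul_le_mul ha' (Real.add_one_le_exp _) ?_
          (Real.exp_pos _).le) hW0
        positivity
    _ ≤ W * Real.exp 1 := by
        rw [← Real.exp_add]
        exact mul_le_mul_of_nonneg_left (Real.exp_le_exp.2 hψa) hW0
    _ = _ := mul_comm _ _

/-- Where the tail vanishes, the span almost surely stays below and `M` can be lowered; otherwise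
the odds of failure are finite and `integral_concave_le_of_tail_pos` applies. -/
lemma integral_concave_le {ν : Measure ℕ} [IsProbabilityMeasure ν] (hν : ν {0} = 0)
    {M : ℕ} (hM : 1 ≤ M) (hIFR : HasIFR M ν) {H : ℕ → ℝ} {W : ℝ} (hH0 : 0 ≤ H 1)
    (hc : ∀ k, 1 ≤ k → k + 2 ≤ M → H (k + 2) - H (k + 1) ≤ H (k + 1) - H k)
    (hW : ∀ x, 1 ≤ x → x ≤ M → H x * tail ν x ≤ W) :
    ∫ x, H (min x M) ∂ν ≤ Real.exp 1 * W := by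
  induction M, hM using Nat.le_induction with
  | base => exact integral_concave_le_of_tail_pos hν le_rfl hIFR (by simp [tail_one hν]) hH0 hc hW
  | succ M hM ih =>
    rcases (tail_nonneg (ν := ν) (M + 1)).eq_or_lt with h | h
    · have e : ∫ x, H (min x (M + 1)) ∂ν = ∫ x, H (min x M) ∂ν := by
        refine integral_congr_ae ?_
        have : ν (Set.Ici (M + 1)) = 0 := (measureReal_eq_zero_iff (by simp)).1 h.symm
        have h2 : ∀ᵐ x ∂ν, ¬ M + 1 ≤ x := by
          rw [ae_iff]; simpa [Set.Ici] using this
        filter_upwards [h2] with x hx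
        rw [min_eq_left (by omega), min_eq_left (by omega)]
      rw [e]
      exact ih (fun x h1 h2 => hIFR x h1 (by omega)) (fun k h1 h2 => hc k h1 (by omega))
        (fun x h1 h2 => hW x h1 (by omega))
    · exact integral_concave_le_of_tail_pos hν (by omega) hIFR h hH0 hc hW

/-! ### The record of a single customer -/

section Observe

variable {n : ℕ}

@[simp] lemma observe_ranking (σ : List (Fin n)) (c : Customer n) :
    (observe σ c).ranking = σ := rfl

@[simp] lemma observe_nil_purchased (c : Customer n) : (observe [] c).purchased = false := by
  simp [observe]

@[simp] lemma observe_nil_last (c : Customer n) : (observe [] c).last = 0 := by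
  simp [observe]

@[simp] lemma observe_zero_purchased (σ : List (Fin n)) (b : Fin n → Bool) :
    (observe σ (0, b)).purchased = false := by
  simp [observe]

@[simp] lemma observe_zero_last (σ : List (Fin n)) (b : Fin n → Bool) :
    (observe σ (0, b)).last = 0 := by
  simp [observe]

lemma observe_cons_purchased (j : Fin n) (σ : List (Fin n)) (x : ℕ) (b : Fin n → Bool) :
    (observe (j :: σ) (x + 1, b)).purchased = (b j || (observe σ (x, b)).purchased) := by
  simp [observe]

lemma observe_cons_last (j : Fin n) (σ : List (Fin n)) (x : ℕ) (b : Fin n → Bool) :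
    (observe (j :: σ) (x + 1, b)).last = if b j then 1 else (observe σ (x, b)).last + 1 := by
  cases hj : b j <;> simp [observe, hj, List.findIdx_cons]
  split_ifs
  all_goals rfl

lemma observe_last_pos (σ : List (Fin n)) (c : Customer n) (h : (observe σ c).purchased = true) :
    0 < (observe σ c).last := by
  have h' : (σ.take c.1).any c.2 = true := h
  simp [observe, h']

lemma observe_last_le (σ : List (Fin n)) (c : Customer n) :
    (observe σ c).last ≤ σ.length := by
  obtain ⟨x, b⟩ := c
  induction σ generalizing x with
  | nil => simp
  | cons j σ ih =>
    cases x with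
    | zero => simp
    | succ x =>
      rw [observe_cons_last]
      have := ih x
      split_ifs
      · simp
      · simp; omega

lemma succ_le_observe_last_iff (σ : List (Fin n)) (x : ℕ) (b : Fin n → Bool) (k : ℕ) :
    k + 1 ≤ (observe σ (x, b)).last ↔
      k + 1 ≤ x ∧ k < σ.length ∧ ∀ i ∈ σ.take k, b i = false := by
  induction σ generalizing x k with
  | nil => simp
  | cons j σ ih =>
    cases x with
    | zero => simp
    | succ x =>
      rw [observe_cons_last]
      cases k with
      | zero => cases hj : b j <;> simp
      | succ k => cases hj : b j <;> simp [hj, ih]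

/-- The right-hand side combines an event about the span with one about the products, so its
probability factorizes by independence. -/
lemma OY_condition_iff (σ : List (Fin n)) (x : ℕ) (b : Fin n → Bool) (k : ℕ) :
    (if (observe σ (x, b)).purchased = true then k + 1 ≤ (observe σ (x, b)).last
      else k ≤ (observe σ (x, b)).last ∧ k < σ.length) ↔
      k ≤ x ∧ k < σ.length ∧ ∀ i ∈ σ.take k, b i = false := by
  induction σ generalizing x k with
  | nil => simp
  | cons j σ ih =>
    cases x with
    | zero => simp; rintro rfl; simp
    | succ x =>
      rw [observe_cons_last, observe_cons_purchased]
      cases k with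
      | zero => cases hj : b j <;> simp
      | succ k =>
        have := ih x k
        cases hj : b j <;> simp_all

/-- Leaving without a purchase before the list ends reveals the attention span. -/
lemma Y_condition_iff (σ : List (Fin n)) (x : ℕ) (b : Fin n → Bool) (k : ℕ) :
    ((observe σ (x, b)).purchased = false ∧ k = (observe σ (x, b)).last ∧ k < σ.length) ↔
      x = k ∧ k < σ.length ∧ ∀ i ∈ σ.take k, b i = false := by
  induction σ generalizing x k with
  | nil => simp
  | cons j σ ih =>
    cases x with
    | zero => simp; constructor <;> (intro h; have := h.1; subst this; simp_all)
    | succ x =>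
      rw [observe_cons_last, observe_cons_purchased]
      cases k with
      | zero => cases hj : b j <;> simp
      | succ k =>
        have := ih x k
        cases hj : b j <;> simp_all

/-- For `k < M` the alternatives in `Round.OY` merge: a list that fills all slots has length `M`, so
`k` is not its last position. -/
lemma OY_observe {M k : ℕ} (hk : k < M) (σ : List (Fin n)) (x : ℕ) (b : Fin n → Bool) :
    (observe σ (x, b)).OY M k =
      if k ≤ x ∧ k < σ.length ∧ ∀ i ∈ σ.take k, b i = false then 1 else 0 := by
  have h := OY_condition_iff σ x b k
  have hl := observe_last_le σ (x, b)
  rw [Round.OY, observe_ranking]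
  simp only [← h]
  by_cases hp : (observe σ (x, b)).purchased = true
  · simp [hp]
  · simp only [hp]
    simp only [Bool.false_eq_true, if_false]
    refine if_congr ?_ rfl rfl
    constructor
    · rintro ⟨h1, h2 | h2⟩
      · exact ⟨h1, h2⟩
      · exact ⟨h1, by omega⟩
    · exact fun h => ⟨h.1, Or.inl h.2⟩

lemma OY_mul_Y_observe {M k : ℕ} (hk : k < M) (σ : List (Fin n)) (x : ℕ) (b : Fin n → Bool) :
    (observe σ (x, b)).OY M k * (observe σ (x, b)).Y k =
      if x = k ∧ k < σ.length ∧ ∀ i ∈ σ.take k, b i = false then 1 else 0 := by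
  have h := Y_condition_iff σ x b k
  rw [OY_observe hk, Round.Y]
  by_cases h1 : k < σ.length ∧ ∀ i ∈ σ.take k, b i = false
  · by_cases h2 : k ≤ x
    · have e1 : k ≤ x ∧ k < σ.length ∧ ∀ i ∈ σ.take k, b i = false := ⟨h2, h1⟩
      rw [if_pos e1, one_mul]
      refine if_congr ?_ rfl rfl
      rw [← h]
      simp only [h1.1, and_true]
    · have : x ≠ k := by omega
      simp [h2, this]
  · have e1 : ¬ (k ≤ x ∧ k < σ.length ∧ ∀ i ∈ σ.take k, b i = false) := fun h => h1 h.2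
    have e2 : ¬ (x = k ∧ k < σ.length ∧ ∀ i ∈ σ.take k, b i = false) := fun h => h1 h.2
    rw [if_neg e1, if_neg e2, zero_mul]

lemma OZ_observe (σ : List (Fin n)) (x : ℕ) (b : Fin n → Bool) (k : ℕ) :
    (observe σ (x, b)).OZ (k + 1) =
      if k + 1 ≤ x ∧ k < σ.length ∧ ∀ i ∈ σ.take k, b i = false then 1 else 0 := by
  rw [Round.OZ]
  simp only [succ_le_observe_last_iff]

/-- Sum over the viewed positions of a term which depends on the product and on whether it is
purchased. -/
def Round.sumViewed {E : Type*} [AddCommGroup E] [Module ℝ E] (f : Fin n → ℝ → E) (o : Round n) :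
    E :=
  ∑ k : Fin o.ranking.length, o.OZ (k + 1) • f (o.ranking.get k) (o.Z (k + 1))

variable {E : Type*} [AddCommGroup E] [Module ℝ E]

lemma sumViewed_observe_nil (f : Fin n → ℝ → E) (c : Customer n) :
    (observe [] c).sumViewed f = 0 := by
  show ∑ k : Fin 0, _ = _
  simp

lemma sumViewed_observe_zero (f : Fin n → ℝ → E) (σ : List (Fin n)) (b : Fin n → Bool) :
    (observe σ (0, b)).sumViewed f = 0 := by
  simp [Round.sumViewed, Round.OZ]

lemma sumViewed_observe_cons (f : Fin n → ℝ → E) (j : Fin n) (σ : List (Fin n)) (x : ℕ)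
    (b : Fin n → Bool) :
    (observe (j :: σ) (x + 1, b)).sumViewed f =
      if b j then f j 1 else f j 0 + (observe σ (x, b)).sumViewed f := by
  unfold Round.sumViewed
  refine (Fin.sum_univ_succ (n := σ.length) _).trans ?_
  simp only [Round.OZ, Round.Z, observe_cons_last, observe_cons_purchased]
  have hp := observe_last_pos σ (x, b)
  cases hj : b j
  · simp only [Bool.false_or, Bool.false_eq_true, if_false]
    congr 1
    · by_cases h : (observe σ (x, b)).purchased = true
      · have := hp h
        simp [h, this.ne']
      · simp [h]
    · refine Finset.sum_congr rfl fun k _ => ?_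
      simp
  · simp

end Observe

/-! ### Expectations over a single customer -/

/-- The law of the set of products that a customer finds satisfactory. -/
def satisfactionLaw {n : ℕ} (lam : Fin n → ℝ) : Measure (Fin n → Bool) :=
  Measure.pi fun j => bernoulliMeasure true false (Set.projIcc (0 : ℝ) 1 zero_le_one (lam j))

instance {n : ℕ} (lam : Fin n → ℝ) : IsProbabilityMeasure (satisfactionLaw lam) := by
  unfold satisfactionLaw; infer_instance

/-- Spans are unbounded, but records take finitely many values, so every functional of the records
is integrable. -/
lemma integrable_of_finite_range {Ω β : Type*} [MeasurableSpace Ω] [DiscreteMeasurableSpace Ω]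
    [Countable Ω] {μ : Measure Ω} [IsFiniteMeasure μ] {f : Ω → β} (hf : (Set.range f).Finite)
    (g : β → ℝ) :
    Integrable (fun ω => g (f ω)) μ := by
  obtain ⟨C, hC⟩ := (hf.image fun b => ‖g b‖).bddAbove
  refine Integrable.of_bound (by fun_prop) C (Filter.Eventually.of_forall fun ω => ?_)
  exact hC ⟨f ω, ⟨ω, rfl⟩, rfl⟩

lemma observe_range_finite {n : ℕ} (σ : List (Fin n)) : (Set.range (observe σ)).Finite := by
  refine (Set.finite_range fun q : Bool × Fin (σ.length + 1) =>
    (⟨σ, q.1, q.2⟩ : Round n)).subset ?_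
  rintro _ ⟨c, rfl⟩
  exact ⟨⟨(observe σ c).purchased, (observe σ c).last, by
    have := observe_last_le σ c; omega⟩, rfl⟩

lemma integrable_observe {n : ℕ} (σ : List (Fin n)) (μ : Measure (Customer n)) [IsFiniteMeasure μ]
    (g : Round n → ℝ) : Integrable (fun c => g (observe σ c)) μ :=
  integrable_of_finite_range (observe_range_finite σ) g

section SatisfactionLaw

variable {n : ℕ} {lam : Fin n → ℝ}

/-- Conditioning on the coordinate `j`, which is independent of the coordinates that `F` depends on.
-/
lemma integral_satisfaction_split (hl : ∀ j, lam j ∈ Set.Icc (0 : ℝ) 1) (j : Fin n) (c : ℝ)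
    (F : (Fin n → Bool) → ℝ) (hF : ∀ b v, F (Function.update b j v) = F b) :
    ∫ b, (if b j then c else F b) ∂satisfactionLaw lam =
      lam j * c + (1 - lam j) * ∫ b, F b ∂satisfactionLaw lam := by
  have hind : iIndepFun (fun (i : Fin n) (b : Fin n → Bool) => b i) (satisfactionLaw lam) :=
    iIndepFun_pi (X := fun _ => id) fun _ => by fun_prop
  have h2 := hind.indepFun_finset {j} (Finset.univ.erase j) (by simp) fun i => by fun_prop
  have h3 := h2.comp (φ := fun v : ((i : ({j} : Finset (Fin n))) → Bool) =>
      if v ⟨j, by simp⟩ then (0 : ℝ) else 1)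
    (ψ := fun v : ((i : (Finset.univ.erase j : Finset (Fin n))) → Bool) =>
      F fun i => if h : i ∈ Finset.univ.erase j then v ⟨i, h⟩ else false)
    (measurable_of_finite _) (measurable_of_finite _)
  have e2 : ((fun v : ((i : (Finset.univ.erase j : Finset (Fin n))) → Bool) =>
      F fun i => if h : i ∈ Finset.univ.erase j then v ⟨i, h⟩ else false) ∘
      fun (b : Fin n → Bool) (i : (Finset.univ.erase j : Finset (Fin n))) => b i) = F := by
    funext b
    rw [← hF b false]
    simp only [Function.comp]
    congr 1
    funext i
    by_cases h : i = j
    · subst h; simp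
    · simp [h]
  rw [e2] at h3
  have h4 := h3.integral_mul_eq_mul_integral (by exact (measurable_of_finite _).aestronglyMeasurable)
    (measurable_of_finite _).aestronglyMeasurable
  have hcoord : ∀ g : Bool → ℝ, ∫ b, g (b j) ∂satisfactionLaw lam =
      lam j * g true + (1 - lam j) * g false := by
    intro g
    have hm := measurePreserving_eval (fun j => bernoulliMeasure true false
      (Set.projIcc (0 : ℝ) 1 zero_le_one (lam j))) j
    have h5 := integral_map (f := g) (φ := Function.eval j) (μ := satisfactionLaw lam)
      (measurable_pi_apply j).aemeasurable (measurable_of_finite _).aestronglyMeasurable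
    rw [satisfactionLaw, hm.map_eq, integral_bernoulliMeasure] at h5
    rw [satisfactionLaw]
    refine h5.symm.trans ?_
    rw [Set.projIcc_of_mem _ (hl j)]
    simp
  have h6 : ∀ b : Fin n → Bool, (if b j then c else F b) =
      (if b j then c else 0) + (if b j then 0 else 1) * F b := by
    intro b; split_ifs <;> simp
  simp_rw [h6]
  rw [integral_add Integrable.of_finite Integrable.of_finite,
    hcoord fun v => if v = true then c else 0]
  have h7 := hcoord fun v => if v then 0 else 1
  refine congrArg₂ _ (by simp) (h4.trans ?_)
  congr 1
  exact h7.trans (by simp)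

/-- The probability that none of the products of `l` is satisfactory. -/
def noneProb (lam : Fin n → ℝ) (l : List (Fin n)) : ℝ := (l.map fun i => 1 - lam i).prod

lemma noneProb_nonneg (h1 : ∀ j, lam j ≤ 1) (l : List (Fin n)) : 0 ≤ noneProb lam l :=
  List.prod_nonneg (by simpa [noneProb] using fun i _ => h1 i)

lemma integral_none (hl : ∀ j, lam j ∈ Set.Icc (0 : ℝ) 1) {l : List (Fin n)} (hn : l.Nodup) :
    ∫ b, (if ∀ i ∈ l, b i = false then (1 : ℝ) else 0) ∂satisfactionLaw lam = noneProb lam l := by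
  induction l with
  | nil => simp [noneProb]
  | cons j l ih =>
    rw [List.nodup_cons] at hn
    have h := integral_satisfaction_split hl j 0
      (fun b => if ∀ i ∈ l, b i = false then (1 : ℝ) else 0) (by
        intro b v
        have : (∀ i ∈ l, Function.update b j v i = false) ↔ ∀ i ∈ l, b i = false := by
          refine forall₂_congr fun i hi => ?_
          rw [Function.update_of_ne (by rintro rfl; exact hn.1 hi)]
        simp only [this])
    rw [ih hn.2, mul_zero, zero_add] at h
    have e : noneProb lam (j :: l) = (1 - lam j) * noneProb lam l := by simp [noneProb]
    rw [e, ← h]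
    refine integral_congr_ae (Filter.Eventually.of_forall fun b => ?_)
    cases hj : b j <;> simp [hj]

end SatisfactionLaw

section CustomerLaw

variable {n : ℕ} {lam : Fin n → ℝ} {ν : Measure ℕ}

lemma integral_span_mul_none (hl : ∀ j, lam j ∈ Set.Icc (0 : ℝ) 1) {l : List (Fin n)}
    (hn : l.Nodup) (f : ℕ → ℝ) :
    ∫ c : Customer n, f c.1 * (if ∀ i ∈ l, c.2 i = false then (1 : ℝ) else 0)
      ∂ν.prod (satisfactionLaw lam) = (∫ x, f x ∂ν) * noneProb lam l := by
  rw [← integral_none hl hn]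
  exact integral_prod_mul f fun b : Fin n → Bool => if ∀ i ∈ l, b i = false then (1 : ℝ) else 0

/-- The probability that the end of the attention span can be observed at position `k`. -/
def spanObsProb (lam : Fin n → ℝ) (ν : Measure ℕ) (σ : List (Fin n)) (k : ℕ) : ℝ :=
  if k < σ.length then tail ν k * noneProb lam (σ.take k) else 0

lemma spanObsProb_nonneg (h1 : ∀ j, lam j ≤ 1) (σ : List (Fin n)) (k : ℕ) :
    0 ≤ spanObsProb lam ν σ k := by
  unfold spanObsProb
  split_ifs
  · exact mul_nonneg (tail_nonneg _) (noneProb_nonneg h1 _)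
  · exact le_rfl

/-- The failure rate of the attention span at position `k`. -/
def failureRate (ν : Measure ℕ) (k : ℕ) : ℝ := 1 - tail ν (k + 1) / tail ν k

lemma failureRate_le_one (k : ℕ) : failureRate ν k ≤ 1 :=
  sub_le_self _ (div_nonneg (tail_nonneg _) (tail_nonneg _))

lemma integral_OZ (hl : ∀ j, lam j ∈ Set.Icc (0 : ℝ) 1) {σ : List (Fin n)} (hn : σ.Nodup)
    {k : ℕ} (hk : k < σ.length) :
    ∫ c, (observe σ c).OZ (k + 1) ∂ν.prod (satisfactionLaw lam) =
      tail ν (k + 1) * noneProb lam (σ.take k) := by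
  have := integral_span_mul_none (ν := ν) hl (hn.sublist (List.take_sublist k σ))
    fun x => if k + 1 ≤ x then 1 else 0
  rw [integral_indicator_le] at this
  rw [← this]
  refine integral_congr_ae (Filter.Eventually.of_forall fun c => ?_)
  obtain ⟨x, b⟩ := c
  simp only [OZ_observe, hk, true_and, ite_and, ite_mul, one_mul, zero_mul]

variable [IsProbabilityMeasure ν]

lemma failureRate_nonneg (k : ℕ) : 0 ≤ failureRate ν k :=
  sub_nonneg.2 (div_le_one_of_le₀ (tail_antitone k.le_succ) (tail_nonneg _))

/-- This includes a vanishing tail, where the convention for division makes the failure rate `1`. -/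
lemma tail_succ_eq (k : ℕ) : tail ν (k + 1) = tail ν k * (1 - failureRate ν k) := by
  rcases (tail_nonneg (ν := ν) k).eq_or_lt with h | h
  · rw [← h, zero_mul]
    exact le_antisymm ((tail_antitone k.le_succ).trans_eq h.symm) (tail_nonneg _)
  · rw [failureRate]; field_simp; ring

/-- The pair takes the values `(0, 0)`, `(1, 1)`, `(1, 0)`: a trial takes place with probability
`spanObsProb` and, given that, fails with probability `failureRate`. A general `φ` serves both the
exponential supermartingale and the quadratic potential. -/
lemma integral_span_observation (hl : ∀ j, lam j ∈ Set.Icc (0 : ℝ) 1) {σ : List (Fin n)}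
    (hn : σ.Nodup) {M k : ℕ} (hk : k < M) (φ : ℝ → ℝ → ℝ) :
    ∫ c, φ ((observe σ c).OY M k) ((observe σ c).OY M k * (observe σ c).Y k)
      ∂ν.prod (satisfactionLaw lam) =
      φ 0 0 + spanObsProb lam ν σ k *
        (failureRate ν k * φ 1 1 + (1 - failureRate ν k) * φ 1 0 - φ 0 0) := by
  have hsingle : ∫ x, (if x = k then (1 : ℝ) else 0) ∂ν = tail ν k * failureRate ν k := by
    have h1 : (fun x => if x = k then (1 : ℝ) else 0) = ({k} : Set ℕ).indicator 1 := by
      ext y; simp [Set.indicator_apply]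
    have h2 := tail_succ_eq (ν := ν) k
    have h3 := tail_sub_tail_succ (ν := ν) k
    rw [h1, integral_indicator_one (measurableSet_singleton k), ← h3, h2]
    ring
  by_cases hks : k < σ.length
  · set f : ℕ → ℝ := fun x => (if k ≤ x then (1 : ℝ) else 0) * (φ 1 0 - φ 0 0) +
      (if x = k then (1 : ℝ) else 0) * (φ 1 1 - φ 1 0) with hf
    have e : ∀ c : Customer n,
        φ ((observe σ c).OY M k) ((observe σ c).OY M k * (observe σ c).Y k) =
          φ 0 0 + f c.1 * (if ∀ i ∈ σ.take k, c.2 i = false then (1 : ℝ) else 0) := by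
      rintro ⟨x, b⟩
      rw [OY_mul_Y_observe hk, OY_observe hk]
      simp only [hks, true_and, hf]
      by_cases h : ∀ i ∈ σ.take k, b i = false
      · simp only [eq_true h, and_true, if_true, mul_one]
        by_cases h1 : x = k
        · subst h1; simp
        · by_cases h2 : k ≤ x <;> simp [h1, h2]
      · simp only [eq_false h, and_false, if_false, mul_zero, add_zero]
    have hb1 : Integrable (fun x => if k ≤ x then (1 : ℝ) else 0) ν :=
      integrable_of_bounded_nat 1 fun x => by split_ifs <;> simp
    have hb2 : Integrable (fun x => if x = k then (1 : ℝ) else 0) ν :=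
      integrable_of_bounded_nat 1 fun x => by split_ifs <;> simp
    have hfi : ∫ x, f x ∂ν = tail ν k * (φ 1 0 - φ 0 0) +
        tail ν k * failureRate ν k * (φ 1 1 - φ 1 0) := by
      rw [integral_add (hb1.mul_const _) (hb2.mul_const _), integral_mul_const,
        integral_mul_const, integral_indicator_le, hsingle]
    have hint : Integrable (fun c : Customer n =>
        f c.1 * (if ∀ i ∈ σ.take k, c.2 i = false then (1 : ℝ) else 0))
        (ν.prod (satisfactionLaw lam)) :=
      ((hb1.mul_const _).add (hb2.mul_const _)).mul_prod
        (g := fun b : Fin n → Bool => if ∀ i ∈ σ.take k, b i = false then (1 : ℝ) else 0)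
        Integrable.of_finite
    simp_rw [e]
    rw [integral_add (integrable_const _) hint,
      integral_span_mul_none hl (hn.sublist (List.take_sublist k σ)), hfi, spanObsProb, if_pos hks]
    simp
    ring
  · have e : ∀ c : Customer n,
        φ ((observe σ c).OY M k) ((observe σ c).OY M k * (observe σ c).Y k) = φ 0 0 := by
      rintro ⟨x, b⟩
      rw [OY_mul_Y_observe hk, OY_observe hk]
      simp [hks]
    simp_rw [e]
    simp [spanObsProb, hks]

/-- A function `W` of a running sum that does not increase in mean with the satisfaction of one
product does not increase in mean over the products viewed by a customer. -/
lemma integral_sumViewed_le {E : Type*} [AddCommGroup E] [Module ℝ E]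
    (hl : ∀ j, lam j ∈ Set.Icc (0 : ℝ) 1) (f : Fin n → ℝ → E) (W : E → ℝ) (good : E → Prop)
    (hgood : ∀ e j z, good e → good (e + f j z))
    (hstep : ∀ e j, good e → lam j * W (e + f j 1) + (1 - lam j) * W (e + f j 0) ≤ W e)
    {σ : List (Fin n)} (hn : σ.Nodup) (e : E) (he : good e) :
    ∫ c, W (e + (observe σ c).sumViewed f) ∂ν.prod (satisfactionLaw lam) ≤ W e := by
  -- The span is fixed and the list unrolled: satisfaction with `j` ends the sum, and otherwise the
  -- rest of the list starts from `e + f j 0`.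
  have key : ∀ x : ℕ, ∫ b, W (e + (observe σ (x, b)).sumViewed f) ∂satisfactionLaw lam ≤ W e := by
    induction σ generalizing e with
    | nil => intro x; simp [sumViewed_observe_nil]
    | cons j σ ih =>
      intro x
      cases x with
      | zero => simp [sumViewed_observe_zero]
      | succ x =>
        rw [List.nodup_cons] at hn
        have h := integral_satisfaction_split hl j (W (e + f j 1))
          (fun b => W (e + f j 0 + (observe σ (x, b)).sumViewed f)) (by
            intro b v
            congr 2
            have hb : ∀ i ∈ σ, Function.update b j v i = b i := by
              intro i hi
              rw [Function.update_of_ne (by rintro rfl; exact hn.1 hi)]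
            have : observe σ (x, Function.update b j v) = observe σ (x, b) := by
              have h1 : ∀ l : List (Fin n), (∀ i ∈ l, Function.update b j v i = b i) →
                  l.any (Function.update b j v) = l.any b ∧
                    l.findIdx (Function.update b j v) = l.findIdx b := by
                intro l hl'
                induction l with
                | nil => simp
                | cons i l ih2 =>
                  have := ih2 fun i hi => hl' i (List.mem_cons_of_mem _ hi)
                  simp [List.findIdx_cons, hl' i List.mem_cons_self, this]
              have h2 := h1 (σ.take x) fun i hi => hb i (List.mem_of_mem_take hi)
              simp only [observe, h2]
            rw [this])
        have h2 : ∀ b : Fin n → Bool, W (e + (observe (j :: σ) (x + 1, b)).sumViewed f) =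
            if b j then W (e + f j 1) else W (e + f j 0 + (observe σ (x, b)).sumViewed f) := by
          intro b
          rw [sumViewed_observe_cons, add_assoc]
          split_ifs <;> rfl
        simp_rw [h2]
        rw [h]
        refine le_trans ?_ (hstep e j he)
        have := mul_le_mul_of_nonneg_left (ih hn.2 (e + f j 0) (hgood e j 0 he) x)
          (sub_nonneg.2 (hl j).2)
        linarith
  rw [integral_prod _ (integrable_observe σ _ fun o => W (e + o.sumViewed f))]
  calc ∫ x, ∫ b, W (e + (observe σ (x, b)).sumViewed f) ∂satisfactionLaw lam ∂ν
      ≤ ∫ _, W e ∂ν := by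
        refine integral_mono ?_ (integrable_const _) key
        exact (integrable_observe σ (ν.prod (satisfactionLaw lam))
          fun o => W (e + o.sumViewed f)).integral_prod_left
    _ = W e := by simp

end CustomerLaw

/-! ### Regret of an optimistic ranking -/

/-- The sum of `F k j` over the positions `k = m, m + 1, …` of a list of products `j`, each term
weighted with the probability that no earlier product is satisfactory. -/
def cascadeSum {α : Type*} (lam : α → ℝ) (F : ℕ → α → ℝ) : List α → ℕ → ℝ
  | [], _ => 0
  | j :: l, m => F m j + (1 - lam j) * cascadeSum lam F l (m + 1)

section CascadeSum

variable {n : ℕ} {lam : Fin n → ℝ}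

lemma sum_noneProb_mul (F : ℕ → Fin n → ℝ) (l : List (Fin n)) (m : ℕ) :
    ∑ k : Fin l.length, noneProb lam (l.take k) * F (m + k) (l.get k) =
      cascadeSum lam F l m := by
  induction l generalizing m with
  | nil => simp [cascadeSum]
  | cons j l ih =>
    refine (Fin.sum_univ_succ (n := l.length) _).trans ?_
    rw [cascadeSum, ← ih, Finset.mul_sum]
    congr 1
    · simp [noneProb]
    · refine Finset.sum_congr rfl fun k _ => ?_
      simp [noneProb, mul_assoc, add_assoc, add_comm 1]

lemma cascadeSum_nonneg {F : ℕ → Fin n → ℝ} (h1 : ∀ j, lam j ≤ 1) (hF : ∀ k j, 0 ≤ F k j)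
    (l : List (Fin n)) (m : ℕ) : 0 ≤ cascadeSum lam F l m := by
  induction l generalizing m with
  | nil => exact le_rfl
  | cons j l ih => exact add_nonneg (hF _ _) (mul_nonneg (sub_nonneg.2 (h1 j)) (ih _))

lemma cascadeSum_le_append {F : ℕ → Fin n → ℝ} (h1 : ∀ j, lam j ≤ 1) (hF : ∀ k j, 0 ≤ F k j)
    (l l' : List (Fin n)) (m : ℕ) :
    cascadeSum lam F l m ≤ cascadeSum lam F (l ++ l') m := by
  induction l generalizing m with
  | nil => exact cascadeSum_nonneg h1 hF _ _
  | cons j l ih =>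
    exact add_le_add le_rfl (mul_le_mul_of_nonneg_left (ih _) (sub_nonneg.2 (h1 j)))

/-- The factor `1 - lam j` at position `k` extends the event "no earlier product is satisfactory" to
position `k` itself, which is what makes the failure rate there observable. -/
lemma cascadeSum_span (g : ℕ → ℝ) {x : ℕ} (l : List (Fin n)) (m : ℕ)
    (hm : m + l.length = x + 1) :
    cascadeSum lam (fun k j => if k < x then (1 - lam j) * g k else 0) l m =
      ∑ k ∈ Finset.Ico m x, noneProb lam (l.take (k - m + 1)) * g k := by
  induction l generalizing m with
  | nil => simp at hm; simp [cascadeSum, hm]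
  | cons j l ih =>
    have hm' : m + 1 + l.length = x + 1 := by simp at hm; omega
    rw [cascadeSum, ih (m + 1) hm']
    by_cases hmx : m < x
    · rw [if_pos hmx, Finset.sum_eq_sum_Ico_succ_bot hmx, Finset.mul_sum]
      congr 1
      · simp [noneProb]
      · refine Finset.sum_congr rfl fun k hk => ?_
        rw [Finset.mem_Ico] at hk
        rw [show k - m = k - (m + 1) + 1 by omega]
        simp [noneProb, mul_assoc]
    · rw [if_neg hmx, Finset.Ico_eq_empty hmx, Finset.Ico_eq_empty (by omega)]
      simp

lemma integral_fixedSpanRevenue {r : Fin n → ℝ} {ν : Measure ℕ} [IsProbabilityMeasure ν]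
    (σ : List (Fin n)) :
    expectedRevenue r lam ν σ = cascadeSum lam (fun k j => tail ν k * (lam j * r j)) σ 1 := by
  rw [← sum_noneProb_mul, expectedRevenue]
  unfold fixedSpanRevenue
  have hb : ∀ k : ℕ, Integrable (fun x => if k + 1 ≤ x then (1 : ℝ) else 0) ν := fun k =>
    integrable_of_bounded_nat 1 fun x => by split_ifs <;> simp
  have e : ∀ x (k : Fin σ.length), (if (k : ℕ) < x then
      ((σ.take k).map fun i => 1 - lam i).prod * lam (σ.get k) * r (σ.get k) else 0) =
      (if (k : ℕ) + 1 ≤ x then (1 : ℝ) else 0) *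
        (noneProb lam (σ.take k) * lam (σ.get k) * r (σ.get k)) := by
    intro x k
    simp only [Nat.succ_le_iff, ite_mul, one_mul, zero_mul, noneProb]
  simp_rw [e]
  rw [integral_finsetSum _ fun (k : Fin σ.length) _ => (hb k).mul_const _]
  refine Finset.sum_congr rfl fun k _ => ?_
  rw [integral_mul_const, integral_indicator_le, add_comm 1 (k : ℕ)]
  ring

/-- The gap between the optimistic value `P(X ≥ m) R(l; u) ∏ (1 - a)` and the revenue of `l` at
the positions `m, m + 1, …, x` is at most `ρ` times the expected estimation errors. -/
lemma optimistic_sub_cascadeSum_le {r u : Fin n → ℝ} {ν : Measure ℕ} [IsProbabilityMeasure ν]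
    {ρ : ℝ} (hr0 : ∀ j, 0 ≤ r j) (hρ : ∀ j, r j ≤ ρ) (hρ0 : 0 ≤ ρ) (h0 : ∀ j, 0 ≤ lam j)
    (hu : ∀ j, lam j ≤ u j) (hu1 : ∀ j, u j ≤ 1) {a : ℕ → ℝ} {x : ℕ}
    (l : List (Fin n)) (m : ℕ) (hm : m + l.length = x + 1)
    (ha0 : ∀ k, m ≤ k → k < x → 0 ≤ a k) (ha : ∀ k, m ≤ k → k < x → a k ≤ failureRate ν k) :
    tail ν m * (cascadeRevenue r u l * ∏ k ∈ Finset.Ico m x, (1 - a k)) -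
        cascadeSum lam (fun k j => tail ν k * (lam j * r j)) l m ≤
      ρ * (cascadeSum lam (fun k j => tail ν k * (u j - lam j)) l m +
        cascadeSum lam (fun k j => if k < x then
          (1 - lam j) * (tail ν k * (failureRate ν k - a k)) else 0) l m) := by
  induction l generalizing m with
  | nil => simp [cascadeRevenue, cascadeSum]
  | cons j l ih =>
    have hm' : m + 1 + l.length = x + 1 := by simp at hm; omega
    have ih := ih (m + 1) hm' (fun k hk => ha0 k (by omega)) (fun k hk => ha k (by omega))
    have hG := tail_nonneg (ν := ν) m
    simp only [cascadeRevenue, cascadeSum]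
    set T := cascadeSum lam (fun k j => tail ν k * (lam j * r j)) l (m + 1)
    set A := cascadeSum lam (fun k j => tail ν k * (u j - lam j)) l (m + 1)
    set B := cascadeSum lam (fun k j => if k < x then
          (1 - lam j) * (tail ν k * (failureRate ν k - a k)) else 0) l (m + 1)
    have hd := sub_nonneg.2 (hu j)
    have hl1 := (hu j).trans (hu1 j)
    by_cases hmx : m < x
    · rw [Finset.prod_eq_prod_Ico_succ_bot hmx]
      rw [if_pos hmx]
      have hp0 : 0 ≤ ∏ k ∈ Finset.Ico (m + 1) x, (1 - a k) := by
        refine Finset.prod_nonneg fun k hk => ?_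
        rw [Finset.mem_Ico] at hk
        linarith [ha k (by omega) hk.2, failureRate_le_one (ν := ν) k]
      have hp1 : ∏ k ∈ Finset.Ico (m + 1) x, (1 - a k) ≤ 1 := by
        refine Finset.prod_le_one (fun k hk => ?_) fun k hk => ?_
        · rw [Finset.mem_Ico] at hk
          linarith [ha k (by omega) hk.2, failureRate_le_one (ν := ν) k]
        · rw [Finset.mem_Ico] at hk
          linarith [ha0 k (by omega) hk.2]
      have hR0 := cascadeRevenue_nonneg hr0 (fun j => (h0 j).trans (hu j)) hu1 l
      have hR1 := cascadeRevenue_le hρ0 (fun j => (h0 j).trans (hu j)) hu1 l fun j _ => hρ j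
      set R := cascadeRevenue r u l
      set p := ∏ k ∈ Finset.Ico (m + 1) x, (1 - a k)
      have hU0 : 0 ≤ R * p := mul_nonneg hR0 hp0
      have hU1 : R * p ≤ ρ := (mul_le_of_le_one_right hR0 hp1).trans hR1
      have h2 := tail_succ_eq (ν := ν) m
      have a0 := ha0 m le_rfl hmx
      have a1 := ha m le_rfl hmx
      have f1 := failureRate_le_one (ν := ν) m
      set h := failureRate ν m
      rw [h2] at ih
      -- the price collected now is discounted at most as much as the bound
      have s1 : (u j * r j + (1 - u j) * R) * ((1 - a m) * p) ≤
          u j * r j + (1 - u j) * (1 - a m) * (R * p) := by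
        have : (1 - a m) * p ≤ 1 := mul_le_one₀ (by linarith) hp0 hp1
        have := mul_le_mul_of_nonneg_left this
          (mul_nonneg ((h0 j).trans (hu j)) (hr0 j))
        linarith
      -- `s2` pays for replacing `u j` by `lam j`, `s3` for replacing `a m` by the failure rate, and
      -- `s4` carries along the gap of the later positions.
      have s2 : (u j - lam j) * (r j - (1 - a m) * (R * p)) ≤ (u j - lam j) * ρ := by
        refine mul_le_mul_of_nonneg_left ?_ hd
        have := mul_nonneg (show 0 ≤ 1 - a m by linarith) hU0
        linarith [hρ j]
      have s3 : (1 - lam j) * ((h - a m) * (R * p)) ≤ (1 - lam j) * ((h - a m) * ρ) :=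
        mul_le_mul_of_nonneg_left (mul_le_mul_of_nonneg_left hU1 (by linarith)) (by linarith)
      have s4 := mul_le_mul_of_nonneg_left ih (show 0 ≤ 1 - lam j by linarith)
      have t1 := mul_le_mul_of_nonneg_left s1 hG
      have t2 := mul_le_mul_of_nonneg_left s2 hG
      have t3 := mul_le_mul_of_nonneg_left s3 hG
      linarith
    · have hl : l = [] := List.length_eq_zero_iff.1 (by omega)
      have hxm : Finset.Ico m x = ∅ := Finset.Ico_eq_empty hmx
      have hT : T = 0 := by simp only [T, hl, cascadeSum]
      have hA : A = 0 := by simp only [A, hl, cascadeSum]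
      have hB : B = 0 := by simp only [B, hl, cascadeSum]
      rw [hT, hA, hB, hxm, if_neg hmx, hl]
      simp only [cascadeRevenue, Finset.prod_empty]
      have := mul_le_mul_of_nonneg_left (mul_le_mul_of_nonneg_left (hρ j) hd) hG
      linarith

lemma tail_eq_prod {ν : Measure ℕ} [IsProbabilityMeasure ν] (hν : ν {0} = 0) {x : ℕ}
    (hx : 1 ≤ x) : tail ν x = ∏ k ∈ Finset.Ico 1 x, (1 - failureRate ν k) := by
  induction x, hx using Nat.le_induction with
  | base => simp [tail_one hν]
  | succ x hx ih => rw [Finset.prod_Ico_succ_top hx, ← ih, tail_succ_eq]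

lemma expectedRevenue_nonneg {r : Fin n → ℝ} {ν : Measure ℕ} [IsProbabilityMeasure ν]
    (hr0 : ∀ j, 0 ≤ r j) (h0 : ∀ j, 0 ≤ lam j) (h1 : ∀ j, lam j ≤ 1) (σ : List (Fin n)) :
    0 ≤ expectedRevenue r lam ν σ := by
  rw [integral_fixedSpanRevenue]
  exact cascadeSum_nonneg h1
    (fun k j => mul_nonneg (tail_nonneg _) (mul_nonneg (h0 j) (hr0 j))) _ _

lemma expectedRevenue_le {r : Fin n → ℝ} {ν : Measure ℕ} [IsProbabilityMeasure ν] {ρ : ℝ}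
    (hρ : ∀ j, r j ≤ ρ) (hρ0 : 0 ≤ ρ) (hr0 : ∀ j, 0 ≤ r j) (h0 : ∀ j, 0 ≤ lam j)
    (h1 : ∀ j, lam j ≤ 1) (σ : List (Fin n)) : expectedRevenue r lam ν σ ≤ ρ := by
  have h : ∀ x, fixedSpanRevenue r lam σ x ≤ ρ := fun x => by
    rw [fixedSpanRevenue_eq]
    exact cascadeRevenue_le hρ0 h0 h1 _ fun j _ => hρ j
  have : ∫ x, fixedSpanRevenue r lam σ x ∂ν ≤ ∫ _, ρ ∂ν := by
    refine integral_mono (integrable_of_bounded_nat ρ fun x => ?_) (integrable_const _) h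
    rw [abs_of_nonneg]
    · exact h x
    · rw [fixedSpanRevenue_eq]
      exact cascadeRevenue_nonneg hr0 h0 h1 _
  simpa [expectedRevenue] using this

lemma optimalRevenue_le {M : ℕ} (hMn : M ≤ n) {r : Fin n → ℝ} {ν : Measure ℕ}
    [IsProbabilityMeasure ν] {ρ : ℝ} (hρ : ∀ j, r j ≤ ρ) (hρ0 : 0 ≤ ρ) (hr0 : ∀ j, 0 ≤ r j)
    (h0 : ∀ j, 0 ≤ lam j) (h1 : ∀ j, lam j ≤ 1) : optimalRevenue M r lam ν ≤ ρ := by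
  have : Nonempty (Fin M ↪ Fin n) := ⟨Fin.castLEEmb hMn⟩
  exact ciSup_le fun p => expectedRevenue_le hρ hρ0 hr0 h0 h1 _

/-- Best-x on optimistic estimates is optimal up to a factor `e`. -/
lemma optimalRevenue_le_exp_mul {M : ℕ} (hM : 1 ≤ M) (hMn : M ≤ n) {r u : Fin n → ℝ}
    {ν : Measure ℕ} [IsProbabilityMeasure ν] (hν : ν {0} = 0) (hIFR : HasIFR M ν)
    (hr0 : ∀ j, 0 ≤ r j) (hr : Antitone r) (h0 : ∀ j, 0 ≤ lam j) (hu : ∀ j, lam j ≤ u j)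
    (hu1 : ∀ j, u j ≤ 1) {G : ℕ → ℝ} (hG : ∀ x, 1 ≤ x → x ≤ M → tail ν x ≤ G x)
    {σ : List (Fin n)} (hσ : IsBestX M r u G σ) :
    1 ≤ σ.length ∧ σ.length ≤ M ∧
    optimalRevenue M r lam ν ≤ Real.exp 1 * (cascadeRevenue r u σ * G σ.length) := by
  obtain ⟨S, hS, x, hx1, hxM, rfl, hmax⟩ := hσ
  have h1 : ∀ j, lam j ≤ 1 := fun j => (hu j).trans (hu1 j)
  have hu0 : ∀ j, 0 ≤ u j := fun j => (h0 j).trans (hu j)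
  have hopt := fun {x} (hx : x ≤ M) => hS.optimal hMn hr0 hr hu0 hu1 hx
  have hlen : ∀ x ≤ M, (indexRanking (S x)).length = x := fun x hx => by
    rw [indexRanking, Finset.length_sort, (hopt hx).1]
  rw [hlen x hxM]
  refine ⟨hx1, hxM, ?_⟩
  have : Nonempty (Fin M ↪ Fin n) := ⟨Fin.castLEEmb hMn⟩
  refine ciSup_le fun p => ?_
  have hp : (List.ofFn p).Nodup := List.nodup_ofFn.2 p.injective
  set H := bestRevenue r lam (List.finRange n)
  -- A customer with span `x` views at most `min x M` products, whatever the ranking.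
  have hb : ∫ x, fixedSpanRevenue r lam (List.ofFn p) x ∂ν ≤ ∫ x, H (min x M) ∂ν := by
    refine integral_mono ?_ (integrable_comp_min _ _) fun x => ?_
    · refine (integrable_comp_min (fixedSpanRevenue r lam (List.ofFn p)) M).congr
        (Filter.Eventually.of_forall fun x => ?_)
      simp only [fixedSpanRevenue_eq]
      congr 1
      have := List.take_eq_take_min (l := List.ofFn p) (i := x)
      rw [List.length_ofFn] at this
      exact this.symm
    · show fixedSpanRevenue r lam (List.ofFn p) x ≤ H (min x M)
      rw [fixedSpanRevenue_eq]
      have := cascadeRevenue_le_bestRevenue_finRange hr h0 h1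
        (hp.sublist (List.take_sublist x _))
      rwa [List.length_take, List.length_ofFn] at this
  refine hb.trans (integral_concave_le hν hM hIFR (bestRevenue_nonneg _ _)
    (fun k _ _ => bestRevenue_concave hr0 h0 h1 _ (finRange_pairwise_price hr) k) ?_)
  intro y hy1 hyM
  have h2 := hmax y hy1 hyM
  rw [fixedSpanRevenue_eq, fixedSpanRevenue_eq, List.take_of_length_le (hlen y hyM).le,
    List.take_of_length_le (hlen x hxM).le, (hopt hyM).2] at h2
  refine le_trans ?_ h2
  exact mul_le_mul (bestRevenue_mono_prob hr0 h0 hu1 hu _ (finRange_pairwise_price hr) y)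
    (hG y hy1 hyM) (tail_nonneg _) (bestRevenue_nonneg _ _)

/-- Regret of a round in which all estimates are optimistic. -/
lemma optimistic_regret_le {M : ℕ} (hM : 1 ≤ M) (hMn : M ≤ n) {r u : Fin n → ℝ}
    {ν : Measure ℕ} [IsProbabilityMeasure ν] (hν : ν {0} = 0) (hIFR : HasIFR M ν)
    (hr0 : ∀ j, 0 ≤ r j) (hr : Antitone r) {ρ : ℝ} (hρ : ∀ j, r j ≤ ρ) (hρ0 : 0 ≤ ρ)
    (h0 : ∀ j, 0 ≤ lam j) (hu : ∀ j, lam j ≤ u j) (hu1 : ∀ j, u j ≤ 1) {a : ℕ → ℝ}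
    (ha0 : ∀ k, 1 ≤ k → k < M → 0 ≤ a k)
    (ha : ∀ k, 1 ≤ k → k < M → a k ≤ failureRate ν k) {σ rest : List (Fin n)}
    (hσ : IsBestX M r u (fun x => ∏ k ∈ Finset.Ico 1 x, (1 - a k)) σ) :
    optimalRevenue M r lam ν - Real.exp 1 * expectedRevenue r lam ν (σ ++ rest) ≤
      Real.exp 1 * ρ * (∑ k : Fin (σ ++ rest).length, tail ν (k + 1) *
          noneProb lam ((σ ++ rest).take k) * (u ((σ ++ rest).get k) - lam ((σ ++ rest).get k)) +
        ∑ k ∈ Finset.Ico 1 M, spanObsProb lam ν (σ ++ rest) k * (failureRate ν k - a k)) := by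
  have h1 : ∀ j, lam j ≤ 1 := fun j => (hu j).trans (hu1 j)
  obtain ⟨hx1, hxM, hopt⟩ := optimalRevenue_le_exp_mul hM hMn hν hIFR hr0 hr h0 hu hu1
    (fun x hx1 hxM => by
      rw [tail_eq_prod hν hx1]
      refine Finset.prod_le_prod (fun k _ => ?_) fun k hk => ?_
      · linarith [failureRate_le_one (ν := ν) k]
      · rw [Finset.mem_Ico] at hk
        linarith [ha k hk.1 (by omega)]) hσ
  have hsim := optimistic_sub_cascadeSum_le hr0 hρ hρ0 h0 hu hu1 (ν := ν) (a := a) σ 1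
    (x := σ.length) (by omega) (fun k hk1 hk2 => ha0 k hk1 (by omega))
    (fun k hk1 hk2 => ha k hk1 (by omega))
  rw [tail_one hν, one_mul] at hsim
  -- The filler products add only nonnegative revenue and nonnegative error terms, so the bounds for
  -- `σ` pass to the displayed list.
  have hrev : cascadeSum lam (fun k j => tail ν k * (lam j * r j)) σ 1 ≤
      expectedRevenue r lam ν (σ ++ rest) := by
    rw [integral_fixedSpanRevenue]
    exact cascadeSum_le_append h1
      (fun k j => mul_nonneg (tail_nonneg _) (mul_nonneg (h0 j) (hr0 j))) _ _ _
  have hA : cascadeSum lam (fun k j => tail ν k * (u j - lam j)) σ 1 ≤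
      ∑ k : Fin (σ ++ rest).length, tail ν (k + 1) *
          noneProb lam ((σ ++ rest).take k) *
            (u ((σ ++ rest).get k) - lam ((σ ++ rest).get k)) := by
    refine (cascadeSum_le_append h1
      (fun k j => mul_nonneg (tail_nonneg _) (sub_nonneg.2 (hu j))) _ rest _).trans (le_of_eq ?_)
    rw [← sum_noneProb_mul]
    refine Finset.sum_congr rfl fun k _ => ?_
    rw [add_comm 1 (k : ℕ)]; ring
  have hB : cascadeSum lam (fun k j => if k < σ.length then
        (1 - lam j) * (tail ν k * (failureRate ν k - a k)) else 0) σ 1 ≤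
      ∑ k ∈ Finset.Ico 1 M, spanObsProb lam ν (σ ++ rest) k * (failureRate ν k - a k) := by
    have hsub : Finset.Ico 1 σ.length ⊆ Finset.Ico 1 M := Finset.Ico_subset_Ico_right hxM
    refine le_trans (le_of_eq ?_) (Finset.sum_le_sum_of_subset_of_nonneg hsub fun k hk _ => ?_)
    · rw [cascadeSum_span _ σ 1 (by omega)]
      refine Finset.sum_congr rfl fun k hk => ?_
      rw [Finset.mem_Ico] at hk
      rw [Nat.sub_add_cancel hk.1, spanObsProb, if_pos (by rw [List.length_append]; omega),
        List.take_append_of_le_length hk.2.le]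
      ring
    · rw [Finset.mem_Ico] at hk
      exact mul_nonneg (spanObsProb_nonneg h1 _ _) (sub_nonneg.2 (ha k hk.1 hk.2))
  have he := (Real.exp_pos 1).le
  have := mul_le_mul_of_nonneg_left (hsim.trans (mul_le_mul_of_nonneg_left (add_le_add hA hB) hρ0)) he
  have := mul_le_mul_of_nonneg_left hrev he
  linarith

end CascadeSum

/-! ### Quadratic forms of the inverse design matrix -/

section Design

variable {ι : Type*} [Fintype ι]

lemma vecMulVec_mulVec' (x v : ι → ℝ) : vecMulVec x x *ᵥ v = (x ⬝ᵥ v) • x := by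
  rw [vecMulVec_mulVec]
  ext i; simp [mul_comm]

lemma posDef_add_vecMulVec {V : Matrix ι ι ℝ} (hV : V.PosDef) (x : ι → ℝ) :
    (V + vecMulVec x x).PosDef :=
  hV.add_posSemidef (by simpa using posSemidef_vecMulVec_self_star x)

variable [DecidableEq ι]

lemma mulVec_inv_mulVec {V : Matrix ι ι ℝ} (hV : V.PosDef) (v : ι → ℝ) : V *ᵥ (V⁻¹ *ᵥ v) = v := by
  rw [mulVec_mulVec, mul_nonsing_inv _ hV.det_pos.ne'.isUnit, one_mulVec]

lemma inv_mulVec_mulVec {V : Matrix ι ι ℝ} (hV : V.PosDef) (v : ι → ℝ) : V⁻¹ *ᵥ (V *ᵥ v) = v := by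
  rw [mulVec_mulVec, nonsing_inv_mul _ hV.det_pos.ne'.isUnit, one_mulVec]

lemma dotProduct_inv_mulVec_comm {V : Matrix ι ι ℝ} (hV : V.PosDef) (a b : ι → ℝ) :
    a ⬝ᵥ (V⁻¹ *ᵥ b) = b ⬝ᵥ (V⁻¹ *ᵥ a) := by
  have h : (V⁻¹)ᵀ = V⁻¹ := hV.inv.isHermitian
  rw [dotProduct_comm, ← vecMul_transpose, h, dotProduct_mulVec]

lemma dotProduct_inv_mulVec_nonneg {V : Matrix ι ι ℝ} (hV : V.PosDef) (a : ι → ℝ) :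
    0 ≤ a ⬝ᵥ (V⁻¹ *ᵥ a) := by
  simpa using hV.inv.posSemidef.dotProduct_mulVec_nonneg a

lemma dotProduct_inv_mulVec_sq_le {V : Matrix ι ι ℝ} (hV : V.PosDef) (a b : ι → ℝ) :
    (a ⬝ᵥ (V⁻¹ *ᵥ b)) ^ 2 ≤ (a ⬝ᵥ (V⁻¹ *ᵥ a)) * (b ⬝ᵥ (V⁻¹ *ᵥ b)) := by
  have h : ∀ s : ℝ, 0 ≤ (b ⬝ᵥ (V⁻¹ *ᵥ b)) * (s * s) + (2 * (a ⬝ᵥ (V⁻¹ *ᵥ b))) * s +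
      a ⬝ᵥ (V⁻¹ *ᵥ a) := by
    intro s
    have := dotProduct_inv_mulVec_nonneg hV (a + s • b)
    simp only [mulVec_add, mulVec_smul, dotProduct_add, add_dotProduct, smul_dotProduct,
      dotProduct_smul, smul_eq_mul] at this
    rw [dotProduct_inv_mulVec_comm hV b a] at this
    linarith
  have := discrim_le_zero h
  rw [discrim] at this
  linarith

lemma det_add_vecMulVec {V : Matrix ι ι ℝ} (hV : V.PosDef) (x : ι → ℝ) :
    (V + vecMulVec x x).det = V.det * (1 + x ⬝ᵥ (V⁻¹ *ᵥ x)) := by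
  have h := det_add_replicateCol_mul_replicateRow (ι := Unit) hV.det_pos.ne'.isUnit x x
  rw [← vecMulVec_eq] at h
  rw [h]
  congr 1
  rw [det_unique, dotProduct_mulVec, Matrix.add_apply, one_apply_eq]
  rfl

/-- The Sherman–Morrison formula, checked by solving the updated linear system. -/
lemma dotProduct_inv_add_vecMulVec {V : Matrix ι ι ℝ} (hV : V.PosDef) (x s : ι → ℝ) :
    s ⬝ᵥ ((V + vecMulVec x x)⁻¹ *ᵥ s) =
      s ⬝ᵥ (V⁻¹ *ᵥ s) - (x ⬝ᵥ (V⁻¹ *ᵥ s)) ^ 2 / (1 + x ⬝ᵥ (V⁻¹ *ᵥ x)) := by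
  have hw := dotProduct_inv_mulVec_nonneg hV x
  set w := x ⬝ᵥ (V⁻¹ *ᵥ x) with hwd
  set m := x ⬝ᵥ (V⁻¹ *ᵥ s) with hm
  have h : (V + vecMulVec x x) *ᵥ (V⁻¹ *ᵥ s - (m / (1 + w)) • (V⁻¹ *ᵥ x)) = s := by
    rw [add_mulVec, mulVec_sub, mulVec_smul, mulVec_inv_mulVec hV, mulVec_inv_mulVec hV,
      vecMulVec_mulVec', dotProduct_sub, dotProduct_smul, ← hwd, ← hm]
    have : m - (m / (1 + w)) • w = m / (1 + w) := by
      rw [smul_eq_mul]; field_simp; ring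
    rw [this]
    abel
  have h2 := inv_mulVec_mulVec (posDef_add_vecMulVec hV x) (V⁻¹ *ᵥ s - (m / (1 + w)) • (V⁻¹ *ᵥ x))
  rw [h] at h2
  rw [h2, dotProduct_sub, dotProduct_smul, dotProduct_inv_mulVec_comm hV s x, ← hm, smul_eq_mul]
  ring

/-- `V ≥ γ I` gives `V⁻¹ ≤ γ⁻¹ I`: expand the square of `a - γ • V⁻¹ a`. -/
lemma dotProduct_inv_mulVec_le {V : Matrix ι ι ℝ} (hV : V.PosDef) {γ : ℝ} (hγ : 0 < γ)
    (h : ∀ v : ι → ℝ, γ * (v ⬝ᵥ v) ≤ v ⬝ᵥ (V *ᵥ v)) (a : ι → ℝ) :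
    a ⬝ᵥ (V⁻¹ *ᵥ a) ≤ (a ⬝ᵥ a) / γ := by
  set w := V⁻¹ *ᵥ a with hw
  have h1 := h w
  rw [hw, mulVec_inv_mulVec hV, ← hw, dotProduct_comm w a] at h1
  have h2 : 0 ≤ (a - γ • w) ⬝ᵥ (a - γ • w) := dotProduct_self_star_nonneg (a - γ • w)
  simp only [dotProduct_sub, sub_dotProduct, smul_dotProduct, dotProduct_smul, smul_eq_mul] at h2
  rw [dotProduct_comm w a] at h2
  rw [le_div_iff₀ hγ]
  nlinarith

/-- The arithmetic-geometric mean inequality for eigenvalues, from the tangent of the logarithm at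
`a`. -/
lemma log_det_le {V : Matrix ι ι ℝ} (hV : V.PosDef) {a : ℝ} (ha : 0 < a)
    (htr : V.trace ≤ Fintype.card ι * a) : Real.log V.det ≤ Fintype.card ι * Real.log a := by
  have hdet := hV.isHermitian.det_eq_prod_eigenvalues
  have htr' := hV.isHermitian.trace_eq_sum_eigenvalues
  simp only [RCLike.ofReal_real_eq_id, id] at hdet htr'
  rw [hdet, Real.log_prod fun i _ => (hV.eigenvalues_pos i).ne']
  have h : ∀ i, Real.log (hV.isHermitian.eigenvalues i) ≤
      hV.isHermitian.eigenvalues i / a - 1 + Real.log a := by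
    intro i
    have := Real.log_le_sub_one_of_pos (div_pos (hV.eigenvalues_pos i) ha)
    rw [Real.log_div (hV.eigenvalues_pos i).ne' ha.ne'] at this
    linarith
  refine (Finset.sum_le_sum fun i _ => h i).trans ?_
  rw [Finset.sum_add_distrib, Finset.sum_sub_distrib, ← Finset.sum_div, ← htr']
  simp only [Finset.sum_const, Finset.card_univ, nsmul_eq_mul, mul_one]
  have := (div_le_iff₀ ha).2 htr
  linarith

end Design

/-! ### Sub-Gaussian estimates for Bernoulli variables -/

/-- Hoeffding's lemma; the range `[0, 1]` gives variance proxy `1 / 4`. -/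
lemma bernoulli_mgf_le {p : ℝ} (hp : p ∈ Set.Icc (0 : ℝ) 1) (t : ℝ) :
    p * Real.exp (t * (1 - p)) + (1 - p) * Real.exp (-t * p) ≤ Real.exp (t ^ 2 / 8) := by
  have h := hasSubgaussianMGF_of_mem_Icc (X := id) (a := 0) (b := 1)
    (μ := bernoulliMeasure (1 : ℝ) 0 ⟨p, hp⟩) aemeasurable_id (by
      rw [ae_iff, bernoulliMeasure_def]
      simp)
  have h2 := h.mgf_le t
  rw [mgf, integral_bernoulliMeasure] at h2
  have h3 : ∫ x, id x ∂bernoulliMeasure (1 : ℝ) 0 ⟨p, hp⟩ = p := by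
    rw [integral_bernoulliMeasure]; simp
  rw [h3] at h2
  simp only [id, smul_eq_mul] at h2
  convert h2 using 2
  · ring_nf
  · norm_num; ring

lemma integrable_exp_neg_mul_sub_sq {c : ℝ} (hc : 0 < c) (d : ℝ) :
    Integrable fun g : ℝ => Real.exp (-c * (g - d) ^ 2) :=
  (integrable_exp_neg_mul_sq hc).comp_sub_right d

lemma integral_exp_neg_mul_sub_sq (c d : ℝ) :
    ∫ g : ℝ, Real.exp (-c * (g - d) ^ 2) = √(Real.pi / c) := by
  rw [integral_sub_right_eq_self (fun g : ℝ => Real.exp (-c * g ^ 2)) d, integral_gaussian]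

/-- The exponential moment of a quadratic function of a centred variable with two values is at
most the Gaussian one. -/
lemma exp_quadratic_le {p x y : ℝ}
    (hsub : ∀ t : ℝ, p * Real.exp (t * x) + (1 - p) * Real.exp (t * y) ≤ Real.exp (t ^ 2 / 2))
    (a : ℝ) {b : ℝ} (hb0 : 0 ≤ b) (hb1 : b < 1) :
    p * Real.exp (a * x + b * x ^ 2 / 2) + (1 - p) * Real.exp (a * y + b * y ^ 2 / 2) ≤
      Real.exp (a ^ 2 / (2 * (1 - b))) / √(1 - b) := by
  have hb : √b ^ 2 = b := Real.sq_sqrt hb0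
  -- The square is linearized: `exp (b x² / 2)` is the mean of `exp (√b g x)` over a standard
  -- Gaussian `g`. Then `hsub` applies with `t = a + √b * g`, and the Gaussian integral is evaluated
  -- by completing the square.
  have e1 : ∀ x g : ℝ, Real.exp (-(1 / 2) * g ^ 2) * Real.exp ((a + √b * g) * x) =
      Real.exp (a * x + b * x ^ 2 / 2) * Real.exp (-(1 / 2) * (g - √b * x) ^ 2) := by
    intro x g
    rw [← Real.exp_add, ← Real.exp_add]
    congr 1
    linear_combination (x ^ 2 / 2) * hb
  have hi : ∀ x : ℝ, Integrable fun g : ℝ =>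
      Real.exp (-(1 / 2) * g ^ 2) * Real.exp ((a + √b * g) * x) := by
    intro x
    simp_rw [e1]
    exact (integrable_exp_neg_mul_sub_sq (by norm_num) _).const_mul _
  have hI : ∀ x : ℝ, ∫ g : ℝ, Real.exp (-(1 / 2) * g ^ 2) * Real.exp ((a + √b * g) * x) =
      Real.exp (a * x + b * x ^ 2 / 2) * √(Real.pi / (1 / 2)) := by
    intro x
    simp_rw [e1]
    rw [integral_const_mul, integral_exp_neg_mul_sub_sq]
  have hc : 0 < 1 - b := sub_pos.2 hb1
  have e2 : ∀ g : ℝ, Real.exp (-(1 / 2) * g ^ 2) * Real.exp ((a + √b * g) ^ 2 / 2) =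
      Real.exp (a ^ 2 / (2 * (1 - b))) *
        Real.exp (-((1 - b) / 2) * (g - a * √b / (1 - b)) ^ 2) := by
    intro g
    rw [← Real.exp_add, ← Real.exp_add]
    congr 1
    field_simp
    linear_combination ((1 - b) * g ^ 2 + a ^ 2) * hb
  have hle : ∫ g : ℝ, (p * (Real.exp (-(1 / 2) * g ^ 2) * Real.exp ((a + √b * g) * x)) +
      (1 - p) * (Real.exp (-(1 / 2) * g ^ 2) * Real.exp ((a + √b * g) * y))) ≤
      ∫ g : ℝ, Real.exp (-(1 / 2) * g ^ 2) * Real.exp ((a + √b * g) ^ 2 / 2) := by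
    refine integral_mono (((hi x).const_mul _).add ((hi y).const_mul _)) ?_ fun g => ?_
    · simp_rw [e2]
      exact (integrable_exp_neg_mul_sub_sq (by positivity) _).const_mul _
    · have := mul_le_mul_of_nonneg_left (hsub (a + √b * g)) (Real.exp_pos (-(1 / 2) * g ^ 2)).le
      show _ ≤ _
      linarith
  rw [integral_add ((hi x).const_mul _) ((hi y).const_mul _), integral_const_mul,
    integral_const_mul, hI, hI] at hle
  simp_rw [e2] at hle
  rw [integral_const_mul, integral_exp_neg_mul_sub_sq] at hle
  have h3 : √(Real.pi / ((1 - b) / 2)) = √(Real.pi / (1 / 2)) / √(1 - b) := by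
    rw [← Real.sqrt_div (by positivity)]
    congr 1; field_simp
  rw [h3] at hle
  have hpi : 0 < √(Real.pi / (1 / 2)) := Real.sqrt_pos.2 (by positivity)
  refine le_of_mul_le_mul_right ?_ hpi
  calc _ = _ := by ring
    _ ≤ _ := hle
    _ = _ := by ring

/-- The potential of self-normalized martingales. -/
def selfNormalized {ι : Type*} [Fintype ι] [DecidableEq ι] (e : Matrix ι ι ℝ × (ι → ℝ)) : ℝ :=
  Real.exp (2 * (e.2 ⬝ᵥ (e.1⁻¹ *ᵥ e.2))) / √e.1.det

/-- By Sherman–Morrison the new exponent is quadratic in the noise of the new observation, and the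
determinant grows by `1 + w`. `exp_quadratic_le` with `b = w / (1 + w)` produces exactly the factor
`√(1 + w)` and the lost part of the exponent. -/
lemma selfNormalized_step {ι : Type*} [Fintype ι] [DecidableEq ι] {V : Matrix ι ι ℝ}
    (hV : V.PosDef) (s x : ι → ℝ) {p : ℝ} (hp : p ∈ Set.Icc (0 : ℝ) 1) :
    p * selfNormalized (V + vecMulVec x x, s + (1 - p) • x) +
      (1 - p) * selfNormalized (V + vecMulVec x x, s + (0 - p) • x) ≤
        selfNormalized (V, s) := by
  have hw := dotProduct_inv_mulVec_nonneg hV x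
  have hq : ∀ η : ℝ, (s + η • x) ⬝ᵥ ((V + vecMulVec x x)⁻¹ *ᵥ (s + η • x)) =
      s ⬝ᵥ (V⁻¹ *ᵥ s) + 2 * η * (x ⬝ᵥ (V⁻¹ *ᵥ s)) + η ^ 2 * (x ⬝ᵥ (V⁻¹ *ᵥ x)) -
        (x ⬝ᵥ (V⁻¹ *ᵥ s) + η * (x ⬝ᵥ (V⁻¹ *ᵥ x))) ^ 2 / (1 + x ⬝ᵥ (V⁻¹ *ᵥ x)) := by
    intro η
    rw [dotProduct_inv_add_vecMulVec hV]
    simp only [mulVec_add, mulVec_smul, dotProduct_add, add_dotProduct, smul_dotProduct,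
      dotProduct_smul, smul_eq_mul]
    rw [dotProduct_inv_mulVec_comm hV s x]
    ring
  simp only [selfNormalized, hq, det_add_vecMulVec hV]
  set w := x ⬝ᵥ (V⁻¹ *ᵥ x)
  set m := x ⬝ᵥ (V⁻¹ *ᵥ s)
  set Q := s ⬝ᵥ (V⁻¹ *ᵥ s)
  have hw1 : 0 < 1 + w := by linarith
  -- Twice a centred Bernoulli variable has variance proxy `1`; hence the `2` in the exponent of
  -- `selfNormalized`.
  have h := exp_quadratic_le (x := 2 * (1 - p)) (y := 2 * (0 - p)) (fun t => by
      have := bernoulli_mgf_le hp (2 * t)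
      convert this using 2
      · ring_nf
      · ring_nf
      · ring) (2 * m / (1 + w)) (b := w / (1 + w)) (by positivity)
      (by rw [div_lt_one hw1]; linarith)
  have hb : 1 - w / (1 + w) = (1 + w)⁻¹ := by field_simp; ring
  rw [hb, Real.sqrt_inv, div_inv_eq_mul] at h
  rw [Real.sqrt_mul hV.det_pos.le]
  have hd : 0 < √V.det := Real.sqrt_pos.2 hV.det_pos
  have hs : 0 < √(1 + w) := Real.sqrt_pos.2 hw1
  set K := Real.exp (2 * Q - 2 * m ^ 2 / (1 + w)) with hK
  have e : ∀ η : ℝ, Real.exp (2 * (Q + 2 * η * m + η ^ 2 * w - (m + η * w) ^ 2 / (1 + w))) =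
      K * Real.exp (2 * m / (1 + w) * (2 * η) + w / (1 + w) * (2 * η) ^ 2 / 2) := by
    intro η
    rw [hK, ← Real.exp_add]
    congr 1
    field_simp
    ring
  have e2 : Real.exp (2 * Q) = K * Real.exp ((2 * m / (1 + w)) ^ 2 / (2 * (1 + w)⁻¹)) := by
    rw [hK, ← Real.exp_add]
    congr 1
    field_simp
    ring
  rw [e, e, e2, ← mul_div_assoc, ← mul_div_assoc, ← add_div, div_le_div_iff₀ (by positivity) hd]
  have hKp : 0 < K := Real.exp_pos _
  have := mul_le_mul_of_nonneg_left h (mul_pos hKp hd).le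
  calc _ = _ := by ring
    _ ≤ _ := this
    _ = _ := by ring

/-! ### Expectations over histories -/

section History

variable {n : ℕ}

lemma history_succ (p : Policy n) (t : ℕ) (c : Fin (t + 1) → Customer n) :
    history p (t + 1) c = Fin.snoc (α := fun _ => Round n) (history p t (Fin.init c))
      (observe (p t (history p t (Fin.init c))) (c (Fin.last t))) := rfl

lemma history_range_finite (p : Policy n) (t : ℕ) : (Set.range (history p t)).Finite := by
  induction t with
  | zero => exact Set.toFinite _
  | succ t ih =>
    refine (ih.biUnion fun h _ => (observe_range_finite (p t h)).image
      fun o => (Fin.snoc (α := fun _ => Round n) h o : Fin (t + 1) → Round n)).subset ?_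
    rintro _ ⟨c, rfl⟩
    simp only [Set.mem_iUnion]
    exact ⟨history p t (Fin.init c), ⟨_, rfl⟩, _, ⟨c (Fin.last t), rfl⟩, rfl⟩

lemma history_ranking (p : Policy n) (t : ℕ) (c : Fin t → Customer n) (s : Fin t) :
    ∃ h, (history p t c s).ranking = p s h := by
  induction t with
  | zero => exact s.elim0
  | succ t ih =>
    rw [history_succ]
    induction s using Fin.lastCases with
    | last => rw [Fin.snoc_last]; exact ⟨_, rfl⟩
    | cast s => rw [Fin.snoc_castSucc]; exact ih _ s

end History

namespace Setting

variable {n dp dc : ℕ} (P : Setting n dp dc) (Θ : Matrix (Fin dp) (Fin dc) ℝ) (ν : Measure ℕ)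
  (p : Policy n)

/-- The law of the customer who arrives after `t` others. -/
def custLaw (t : ℕ) : Measure (Customer n) := ν.prod (satisfactionLaw (P.lam Θ t))

/-- The expectation of a functional of the records of the first `t` customers. -/
def expect (t : ℕ) (F : (Fin t → Round n) → ℝ) : ℝ :=
  ∫ c, F (history p t c) ∂P.customerLaw Θ ν t

lemma customerLaw_eq (t : ℕ) :
    P.customerLaw Θ ν t = Measure.pi fun s : Fin t => P.custLaw Θ ν s := rfl

variable [IsProbabilityMeasure ν]

instance (t : ℕ) : IsProbabilityMeasure (P.custLaw Θ ν t) := by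
  unfold custLaw; infer_instance

instance (t : ℕ) : IsProbabilityMeasure (P.customerLaw Θ ν t) := by
  rw [customerLaw_eq]; infer_instance

lemma integrable_history (t : ℕ) (F : (Fin t → Round n) → ℝ) :
    Integrable (fun c => F (history p t c)) (P.customerLaw Θ ν t) :=
  integrable_of_finite_range (history_range_finite p t) F

lemma expect_mono {t : ℕ} {F F' : (Fin t → Round n) → ℝ}
    (h : ∀ c, F (history p t c) ≤ F' (history p t c)) :
    P.expect Θ ν p t F ≤ P.expect Θ ν p t F' :=
  integral_mono (P.integrable_history Θ ν p t F) (P.integrable_history Θ ν p t F') h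

lemma expect_const (t : ℕ) (a : ℝ) : P.expect Θ ν p t (fun _ => a) = a := by
  simp [expect]

lemma expect_add {t : ℕ} (F F' : (Fin t → Round n) → ℝ) :
    P.expect Θ ν p t (fun h => F h + F' h) = P.expect Θ ν p t F + P.expect Θ ν p t F' :=
  integral_add (P.integrable_history Θ ν p t F) (P.integrable_history Θ ν p t F')

lemma expect_sub {t : ℕ} (F F' : (Fin t → Round n) → ℝ) :
    P.expect Θ ν p t (fun h => F h - F' h) = P.expect Θ ν p t F - P.expect Θ ν p t F' :=
  integral_sub (P.integrable_history Θ ν p t F) (P.integrable_history Θ ν p t F')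

lemma expect_sum {t : ℕ} {κ : Type*} (s : Finset κ) (F : κ → (Fin t → Round n) → ℝ) :
    P.expect Θ ν p t (fun h => ∑ k ∈ s, F k h) = ∑ k ∈ s, P.expect Θ ν p t (F k) :=
  integral_finsetSum s fun k _ => P.integrable_history Θ ν p t (F k)

omit [IsProbabilityMeasure ν] in
lemma expect_const_mul {t : ℕ} (a : ℝ) (F : (Fin t → Round n) → ℝ) :
    P.expect Θ ν p t (fun h => a * F h) = a * P.expect Θ ν p t F :=
  integral_const_mul a _

lemma expect_zero (F : (Fin 0 → Round n) → ℝ) : P.expect Θ ν p 0 F = F Fin.elim0 := by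
  have : ∀ c, history p 0 c = Fin.elim0 := fun c => rfl
  simp [expect, this]

/-- The records of `t + 1` customers arise by observing one more customer. -/
lemma expect_succ (t : ℕ) (F : (Fin (t + 1) → Round n) → ℝ) :
    P.expect Θ ν p (t + 1) F = P.expect Θ ν p t fun h =>
      ∫ c, F (Fin.snoc (α := fun _ => Round n) h (observe (p t h) c)) ∂P.custLaw Θ ν t := by
  have hmp := measurePreserving_piFinSuccAbove
    (fun s : Fin (t + 1) => P.custLaw Θ ν s) (Fin.last t)
  have hlaw : (Measure.pi fun j : Fin t => P.custLaw Θ ν ((Fin.last t).succAbove j)) =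
      P.customerLaw Θ ν t := by
    rw [customerLaw_eq]
    simp [Fin.succAbove_last]
  rw [hlaw] at hmp
  have hmp' := hmp.symm
  unfold expect
  rw [customerLaw_eq, ← hmp'.integral_comp', ← integral_prod_swap, integral_prod]
  · refine integral_congr_ae (Filter.Eventually.of_forall fun c => ?_)
    refine integral_congr_ae (Filter.Eventually.of_forall fun c' => ?_)
    simp only [Prod.swap_prod_mk, history_succ]
    have h1 : Fin.init ((MeasurableEquiv.piFinSuccAbove (fun _ => Customer n)
        (Fin.last t)).symm (c', c)) = c := by
      funext s
      simp [Fin.init, MeasurableEquiv.piFinSuccAbove]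
    have h2 : (MeasurableEquiv.piFinSuccAbove (fun _ => Customer n)
        (Fin.last t)).symm (c', c) (Fin.last t) = c' := by
      simp [MeasurableEquiv.piFinSuccAbove]
    rw [h1, h2]
  · refine integrable_of_finite_range
      (f := fun q : (Fin t → Customer n) × Customer n => history p (t + 1)
        ((MeasurableEquiv.piFinSuccAbove (fun _ => Customer n) (Fin.last t)).symm q.swap))
      ((history_range_finite p (t + 1)).subset ?_) F
    rintro _ ⟨q, rfl⟩
    exact ⟨_, rfl⟩

/-- Mean increments add up. -/
lemma expect_succ_sub (t : ℕ) (F : (Fin (t + 1) → Round n) → ℝ) (F' : (Fin t → Round n) → ℝ) :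
    P.expect Θ ν p (t + 1) F - P.expect Θ ν p t F' = P.expect Θ ν p t fun h =>
      (∫ c, F (Fin.snoc (α := fun _ => Round n) h (observe (p t h) c)) ∂P.custLaw Θ ν t) - F' h := by
  rw [expect_sub, expect_succ]

variable {Θ ν p P}

lemma IsRankUCB.nodup {T : ℕ} (hp : P.IsRankUCB T p) {t : ℕ} (ht : t < T)
    (h : Fin t → Round n) : (p t h).Nodup := by
  obtain ⟨σ, rest, _, e, hn, _⟩ := hp t ht h
  rwa [e]

lemma IsRankUCB.length_le {T : ℕ} (hp : P.IsRankUCB T p) {t : ℕ} (ht : t < T)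
    (h : Fin t → Round n) : (p t h).length ≤ P.M := by
  obtain ⟨σ, rest, _, e, _, hl⟩ := hp t ht h
  rwa [e]

lemma IsRankUCB.history_length_le {T : ℕ} (hp : P.IsRankUCB T p) {t : ℕ} (ht : t ≤ T)
    (c : Fin t → Customer n) (s : Fin t) : (history p t c s).ranking.length ≤ P.M := by
  obtain ⟨h, e⟩ := history_ranking p t c s
  rw [e]
  exact hp.length_le (s.2.trans_le ht) h

end Setting

/-! ### Estimation of the purchase probabilities -/

section Gram

variable {ι κ : Type*} [Fintype ι]

lemma posSemidef_vecMulVec_self (x : ι → ℝ) : (vecMulVec x x).PosSemidef :=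
  posSemidef_vecMulVec_self_star x

lemma posDef_add_sum_vecMulVec {V : Matrix ι ι ℝ} (hV : V.PosDef) (x : κ → ι → ℝ) {c : κ → ℝ}
    (hc : ∀ k, 0 ≤ c k) (s : Finset κ) : (V + ∑ k ∈ s, c k • vecMulVec (x k) (x k)).PosDef := by
  refine hV.add_posSemidef (posSemidef_sum s fun k _ => ?_)
  exact PosSemidef.smul (posSemidef_vecMulVec_self (x k)) (hc k)

variable [DecidableEq ι]

lemma det_le_det_add_sum_vecMulVec {V : Matrix ι ι ℝ} (hV : V.PosDef) (x : κ → ι → ℝ) {c : κ → ℝ}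
    (hc : ∀ k, 0 ≤ c k) (s : Finset κ) :
    V.det ≤ (V + ∑ k ∈ s, c k • vecMulVec (x k) (x k)).det := by
  classical
  induction s using Finset.induction_on with
  | empty => simp
  | insert k s hk ih =>
    have hP := posDef_add_sum_vecMulVec hV x hc s
    rw [Finset.sum_insert hk, add_comm (c k • _), ← add_assoc]
    refine ih.trans ?_
    have e : c k • vecMulVec (x k) (x k) = vecMulVec (√(c k) • x k) (√(c k) • x k) := by
      rw [smul_vecMulVec, vecMulVec_smul, smul_smul, Real.mul_self_sqrt (hc k)]
    rw [e, det_add_vecMulVec hP]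
    have := dotProduct_inv_mulVec_nonneg hP (√(c k) • x k)
    have hd := hP.det_pos
    nlinarith

lemma le_two_mul_log_one_add {z : ℝ} (h0 : 0 ≤ z) (h1 : z ≤ 1) : z ≤ 2 * Real.log (1 + z) := by
  have h := Real.one_sub_inv_le_log_of_pos (show 0 < 1 + z by linarith)
  have : z / 2 ≤ 1 - (1 + z)⁻¹ := by
    have : 1 - (1 + z)⁻¹ = z / (1 + z) := by field_simp; ring
    rw [this]
    exact div_le_div_of_nonneg_left h0 (by linarith) (by linarith)
  linarith

end Gram

namespace Setting

variable {n dp dc : ℕ} (P : Setting n dp dc) (Θ : Matrix (Fin dp) (Fin dc) ℝ)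

/-- The vectorized unknown parameter. -/
def thetaVec (Θ : Matrix (Fin dp) (Fin dc) ℝ) : Fin dp × Fin dc → ℝ := fun q => Θ q.1 q.2

lemma x_dotProduct_thetaVec (t : ℕ) (j : Fin n) : P.x t j ⬝ᵥ thetaVec Θ = P.lam Θ t j := by
  simp only [dotProduct, x, thetaVec, lam, mulVec, Fintype.sum_prod_type, Finset.mul_sum]
  refine Finset.sum_congr rfl fun a _ => Finset.sum_congr rfl fun b _ => ?_
  ring

/-- The contribution of a viewed product to the design matrix and to the noise. -/
def increment (t : ℕ) (j : Fin n) (z : ℝ) :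
    Matrix (Fin dp × Fin dc) (Fin dp × Fin dc) ℝ × (Fin dp × Fin dc → ℝ) :=
  (vecMulVec (P.x t j) (P.x t j), (z - P.lam Θ t j) • P.x t j)

/-- The design matrix and the accumulated noise of the purchase observations. -/
def designState (t : ℕ) (h : Fin t → Round n) :
    Matrix (Fin dp × Fin dc) (Fin dp × Fin dc) ℝ × (Fin dp × Fin dc → ℝ) :=
  (P.γ • (1 : Matrix (Fin dp × Fin dc) (Fin dp × Fin dc) ℝ), 0) +
    ∑ s : Fin t, (h s).sumViewed (P.increment Θ s)

lemma designState_fst (t : ℕ) (h : Fin t → Round n) : (P.designState Θ t h).1 = P.V t h := by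
  simp [designState, V, Round.sumViewed, increment, Prod.fst_sum]

/-- Applying `V_t⁻¹` splits the ridge error into a noise term and the bias of the regularization. -/
lemma designState_snd (t : ℕ) (h : Fin t → Round n) :
    (P.designState Θ t h).2 = P.B t h - P.V t h *ᵥ thetaVec Θ + P.γ • thetaVec Θ := by
  have e : P.V t h *ᵥ thetaVec Θ = P.γ • thetaVec Θ +
      ∑ s : Fin t, ∑ k : Fin (h s).ranking.length,
        ((h s).OZ (k + 1) * P.lam Θ s ((h s).ranking.get k)) • P.x s ((h s).ranking.get k) := by
    simp only [V, add_mulVec, smul_mulVec, one_mulVec, sum_mulVec, vecMulVec_mulVec',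
      x_dotProduct_thetaVec, smul_smul]
  rw [e]
  simp only [designState, Round.sumViewed, increment, B, Prod.snd_add, Prod.snd_sum, Prod.smul_snd,
    zero_add, smul_sub, sub_smul, smul_smul, Finset.sum_sub_distrib]
  abel

lemma designState_snoc (t : ℕ) (h : Fin t → Round n) (o : Round n) :
    P.designState Θ (t + 1) (Fin.snoc (α := fun _ => Round n) h o) =
      P.designState Θ t h + o.sumViewed (P.increment Θ t) := by
  simp [designState, Fin.sum_univ_castSucc, add_assoc]

lemma V_snoc (t : ℕ) (h : Fin t → Round n) (o : Round n) :
    P.V (t + 1) (Fin.snoc (α := fun _ => Round n) h o) =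
      P.V t h + ∑ k : Fin o.ranking.length,
        o.OZ (k + 1) • vecMulVec (P.x t (o.ranking.get k)) (P.x t (o.ranking.get k)) := by
  -- The matrix component does not involve the parameter, so any value of it serves.
  have h1 := congrArg Prod.fst (P.designState_snoc (0 : Matrix _ _ ℝ) t h o)
  simpa [designState_fst, Round.sumViewed, increment, Prod.fst_sum] using h1

variable {P}

lemma OZ_nonneg (o : Round n) (k : ℕ) : 0 ≤ o.OZ k := by
  unfold Round.OZ; split_ifs <;> norm_num

lemma OZ_le_one (o : Round n) (k : ℕ) : o.OZ k ≤ 1 := by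
  unfold Round.OZ; split_ifs <;> norm_num

lemma posDef_smul_one (hγ : 1 ≤ P.γ) :
    (P.γ • (1 : Matrix (Fin dp × Fin dc) (Fin dp × Fin dc) ℝ)).PosDef :=
  PosDef.smul PosDef.one (by linarith)

lemma V_posDef (hγ : 1 ≤ P.γ) (t : ℕ) (h : Fin t → Round n) : (P.V t h).PosDef := by
  refine (posDef_smul_one hγ).add_posSemidef (posSemidef_sum _ fun s _ => posSemidef_sum _ fun k _ => ?_)
  exact PosSemidef.smul (posSemidef_vecMulVec_self _) (OZ_nonneg _ _)

lemma mul_dotProduct_le_V (t : ℕ) (h : Fin t → Round n) (v : Fin dp × Fin dc → ℝ) :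
    P.γ * (v ⬝ᵥ v) ≤ v ⬝ᵥ (P.V t h *ᵥ v) := by
  have e : v ⬝ᵥ (P.V t h *ᵥ v) = P.γ * (v ⬝ᵥ v) +
      ∑ s : Fin t, ∑ k : Fin (h s).ranking.length,
        (h s).OZ (k + 1) * (P.x s ((h s).ranking.get k) ⬝ᵥ v) ^ 2 := by
    simp only [V, add_mulVec, smul_mulVec, one_mulVec, sum_mulVec, vecMulVec_mulVec', smul_smul,
      dotProduct_add, dotProduct_smul, dotProduct_sum, smul_eq_mul]
    congr 1
    refine Finset.sum_congr rfl fun s _ => Finset.sum_congr rfl fun k _ => ?_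
    rw [dotProduct_comm v]; ring
  rw [e]
  exact le_add_of_nonneg_right (Finset.sum_nonneg fun s _ => Finset.sum_nonneg fun k _ =>
    mul_nonneg (OZ_nonneg _ _) (sq_nonneg _))

lemma dotProduct_self_eq_norm_sq {ι : Type*} [Fintype ι] (v : ι → ℝ) :
    v ⬝ᵥ v = ‖WithLp.toLp 2 v‖ ^ 2 := by
  rw [EuclideanSpace.norm_sq_eq]
  simp [dotProduct, sq]

lemma width_le_one (hγ : 1 ≤ P.γ) {t : ℕ} (h : Fin t → Round n) {j : Fin n}
    (hx : ‖WithLp.toLp 2 (P.x t j)‖ ≤ 1) :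
    P.x t j ⬝ᵥ ((P.V t h)⁻¹ *ᵥ P.x t j) ≤ 1 := by
  refine (dotProduct_inv_mulVec_le (V_posDef hγ t h) (by linarith) (mul_dotProduct_le_V t h) _).trans
    (div_le_one_of_le₀ ?_ (by linarith))
  rw [dotProduct_self_eq_norm_sq]
  exact (pow_le_one₀ (norm_nonneg _) hx).trans hγ

lemma trace_V_le {t : ℕ} {h : Fin t → Round n} (hlen : ∀ s, (h s).ranking.length ≤ P.M)
    (hx : ∀ s < t, ∀ j, ‖WithLp.toLp 2 (P.x s j)‖ ≤ 1) :
    (P.V t h).trace ≤ P.γ * P.d + t * P.M := by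
  have htr : (P.V t h).trace = P.γ * P.d + ∑ s : Fin t, ∑ k : Fin (h s).ranking.length,
        (h s).OZ (k + 1) * (P.x s ((h s).ranking.get k) ⬝ᵥ P.x s ((h s).ranking.get k)) := by
    simp [V, trace_add, trace_smul, trace_sum, trace_vecMulVec, d]
  rw [htr]
  have : ∑ s : Fin t, ∑ k : Fin (h s).ranking.length, (h s).OZ (k + 1) *
      (P.x s ((h s).ranking.get k) ⬝ᵥ P.x s ((h s).ranking.get k)) ≤ ∑ s : Fin t, (P.M : ℝ) := by
    refine Finset.sum_le_sum fun s _ => ?_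
    calc _ ≤ ∑ k : Fin (h s).ranking.length, (1 : ℝ) := by
          refine Finset.sum_le_sum fun k _ => mul_le_one₀ (OZ_le_one _ _) ?_ ?_
          · exact dotProduct_self_star_nonneg _
          · rw [dotProduct_self_eq_norm_sq]
            exact pow_le_one₀ (norm_nonneg _) (hx s s.2 _)
      _ ≤ P.M := by simpa using hlen s
  simpa using this

lemma log_det_V_le (hγ : 1 ≤ P.γ) (hd : 0 < P.d) {t : ℕ} {h : Fin t → Round n}
    (hlen : ∀ s, (h s).ranking.length ≤ P.M)
    (hx : ∀ s < t, ∀ j, ‖WithLp.toLp 2 (P.x s j)‖ ≤ 1) :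
    Real.log (P.V t h).det ≤ P.d * Real.log P.γ + P.d * Real.log (1 + t * P.M / (P.γ * P.d)) := by
  have hγ0 : 0 < P.γ := by linarith
  have hc : (Fintype.card (Fin dp × Fin dc) : ℝ) = P.d := by simp [d]
  have h1 : 0 < 1 + t * P.M / (P.γ * P.d) := by positivity
  rw [← mul_add, ← Real.log_mul hγ0.ne' h1.ne', ← hc]
  refine log_det_le (V_posDef hγ t h) (mul_pos hγ0 (by rw [hc]; exact h1)) ?_
  rw [hc]
  refine (trace_V_le hlen hx).trans (le_of_eq ?_)
  field_simp

lemma log_det_V_zero (h : Fin 0 → Round n) : Real.log (P.V 0 h).det = P.d * Real.log P.γ := by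
  simp [V, d]

/-- One round of the elliptical potential argument. -/
lemma sum_width_le (hγ : 1 ≤ P.γ) {t : ℕ} (h : Fin t → Round n)
    (hx : ∀ j, ‖WithLp.toLp 2 (P.x t j)‖ ≤ 1) {o : Round n} (ho : o.ranking.length ≤ P.M) :
    ∑ k : Fin o.ranking.length, o.OZ (k + 1) *
        (P.x t (o.ranking.get k) ⬝ᵥ ((P.V t h)⁻¹ *ᵥ P.x t (o.ranking.get k))) ≤
      2 * P.M * (Real.log (P.V (t + 1) (Fin.snoc (α := fun _ => Round n) h o)).det -
        Real.log (P.V t h).det) := by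
  have hV := V_posDef hγ t h
  have hV' := V_posDef hγ (t + 1) (Fin.snoc (α := fun _ => Round n) h o)
  have hdet : (P.V t h).det ≤ (P.V (t + 1) (Fin.snoc (α := fun _ => Round n) h o)).det := by
    rw [V_snoc]
    exact det_le_det_add_sum_vecMulVec hV (fun k : Fin o.ranking.length => P.x t (o.ranking.get k))
      (c := fun k => o.OZ (k + 1)) (fun k => OZ_nonneg _ _) Finset.univ
  set Δ := Real.log (P.V (t + 1) (Fin.snoc (α := fun _ => Round n) h o)).det -
        Real.log (P.V t h).det with hΔ
  have hΔ0 : 0 ≤ Δ := sub_nonneg.2 (Real.log_le_log hV.det_pos hdet)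
  -- All widths of the round are measured before its updates. Product `k` alone raises `log det` by
  -- `log (1 + z)` and the others do not lower it, so each of the at most `M` terms is at most `2 *
  -- Δ`.
  have hterm : ∀ k : Fin o.ranking.length, o.OZ (k + 1) *
      (P.x t (o.ranking.get k) ⬝ᵥ ((P.V t h)⁻¹ *ᵥ P.x t (o.ranking.get k))) ≤ 2 * Δ := by
    intro k
    set z := P.x t (o.ranking.get k) ⬝ᵥ ((P.V t h)⁻¹ *ᵥ P.x t (o.ranking.get k)) with hz
    have hz0 : 0 ≤ z := dotProduct_inv_mulVec_nonneg hV _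
    have hz1 : z ≤ 1 := width_le_one hγ h (hx _)
    by_cases hk : (k : ℕ) + 1 ≤ o.last
    · have hO : o.OZ (k + 1) = 1 := by simp [Round.OZ, hk]
      rw [hO, one_mul]
      refine (le_two_mul_log_one_add hz0 hz1).trans ?_
      have hdk : (P.V t h).det * (1 + z) ≤
          (P.V (t + 1) (Fin.snoc (α := fun _ => Round n) h o)).det := by
        rw [V_snoc, ← Finset.add_sum_erase Finset.univ _ (Finset.mem_univ k), hO, one_smul,
          ← add_assoc, hz, ← det_add_vecMulVec hV]
        exact det_le_det_add_sum_vecMulVec (posDef_add_vecMulVec hV _)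
          (fun k : Fin o.ranking.length => P.x t (o.ranking.get k))
          (c := fun k => o.OZ (k + 1)) (fun k => OZ_nonneg _ _) _
      have := Real.log_le_log (mul_pos hV.det_pos (by linarith)) hdk
      rw [Real.log_mul hV.det_pos.ne' (by linarith)] at this
      linarith
    · have hO : o.OZ (k + 1) = 0 := by simp [Round.OZ, hk]
      rw [hO, zero_mul]; linarith
  calc _ ≤ ∑ k : Fin o.ranking.length, 2 * Δ := Finset.sum_le_sum fun k _ => hterm k
    _ = o.ranking.length * (2 * Δ) := by simp
    _ ≤ P.M * (2 * Δ) := by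
        refine mul_le_mul_of_nonneg_right (by exact_mod_cast ho) (by linarith)
    _ = _ := by ring

variable {Θ} {ν : Measure ℕ} [IsProbabilityMeasure ν] {p : Policy n} {T : ℕ}

/-! ### Confidence ellipsoids from the self-normalized process. -/

lemma sqrt_det_smul_one_pos (hγ : 1 ≤ P.γ) :
    0 < √(P.γ • (1 : Matrix (Fin dp × Fin dc) (Fin dp × Fin dc) ℝ)).det :=
  Real.sqrt_pos.2 (posDef_smul_one hγ).det_pos

/-- The self-normalized process of the purchase observations has bounded mean. -/
lemma expect_selfNormalized_le (hγ : 1 ≤ P.γ) (hp : P.IsRankUCB T p)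
    (hlam : ∀ t < T, ∀ j, P.lam Θ t j ∈ Set.Icc (0 : ℝ) 1) {t : ℕ} (ht : t ≤ T) :
    P.expect Θ ν p t (fun h => selfNormalized (P.designState Θ t h)) ≤
      1 / √(P.γ • (1 : Matrix (Fin dp × Fin dc) (Fin dp × Fin dc) ℝ)).det := by
  induction t with
  | zero => rw [expect_zero]; simp [selfNormalized, designState]
  | succ t ih =>
    refine le_trans ?_ (ih (by omega))
    rw [expect_succ]
    refine P.expect_mono Θ ν p fun c => ?_
    simp only [designState_snoc]
    refine integral_sumViewed_le (hlam t ht) (P.increment Θ t) selfNormalized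
      (fun e => e.1.PosDef) (fun e j z he => posDef_add_vecMulVec he _) (fun e j he => ?_)
      (hp.nodup ht _) _ ?_
    · exact selfNormalized_step he e.2 (P.x t j) (hlam t ht j)
    · rw [designState_fst]; exact V_posDef hγ _ _

/-- The confidence ellipsoid of round `t + 1` contains the unknown parameter, as far as the
products are concerned. -/
def ThetaGood (P : Setting n dp dc) (Θ : Matrix (Fin dp) (Fin dc) ℝ) (t : ℕ)
    (h : Fin t → Round n) : Prop :=
  ∀ j, |P.x t j ⬝ᵥ P.thetaHat t h - P.lam Θ t j| ≤
    P.rho t * √(P.x t j ⬝ᵥ ((P.V t h)⁻¹ *ᵥ P.x t j))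

open Classical in
-- Markov's inequality in pointwise form: outside the ellipsoid the quadratic form of the noise
-- exceeds `(d L + 4 log (t + 1)) / 4`, and with the trace bound on `det V_t` this makes the
-- right-hand side at least `1`.
lemma thetaBad_le (hγ : 1 ≤ P.γ) (hD : 0 < P.D) (hd : 0 < P.d)
    (hΘ : ‖WithLp.toLp 2 (thetaVec Θ)‖ ≤ P.D) {t : ℕ} {h : Fin t → Round n}
    (hlen : ∀ s, (h s).ranking.length ≤ P.M)
    (hx : ∀ s < t, ∀ j, ‖WithLp.toLp 2 (P.x s j)‖ ≤ 1) :
    (if P.ThetaGood Θ t h then (0 : ℝ) else 1) ≤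
      √(P.γ • (1 : Matrix (Fin dp × Fin dc) (Fin dp × Fin dc) ℝ)).det / ((t : ℝ) + 1) ^ 2 *
        selfNormalized (P.designState Θ t h) := by
  have hV := V_posDef hγ t h
  have hγ0 : 0 < P.γ := by linarith
  have hdet0 := (posDef_smul_one hγ).det_pos
  set s := (P.designState Θ t h).2 with hs
  set Q := s ⬝ᵥ ((P.V t h)⁻¹ *ᵥ s) with hQ
  set L := Real.log (1 + t * P.M / (P.γ * P.d)) with hL
  have hL0 : 0 ≤ L := Real.log_nonneg (le_add_of_nonneg_right (by positivity))
  have ht0 : (0 : ℝ) < t + 1 := by positivity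
  have hlt : 0 ≤ Real.log ((t : ℝ) + 1) := Real.log_nonneg (by simp)
  split_ifs with hg
  · unfold selfNormalized; positivity
  have hQlt : 1 / 4 * (P.d * L + 4 * Real.log (t + 1)) < Q := by
    by_contra hle
    push Not at hle
    refine hg fun j => ?_
    -- Noise minus bias; Cauchy–Schwarz for `V_t⁻¹` turns these into the two summands of `rho`.
    have e : P.x t j ⬝ᵥ P.thetaHat t h - P.lam Θ t j =
        P.x t j ⬝ᵥ ((P.V t h)⁻¹ *ᵥ s) -
          P.γ * (P.x t j ⬝ᵥ ((P.V t h)⁻¹ *ᵥ thetaVec Θ)) := by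
      rw [hs, designState_snd, mulVec_add, mulVec_sub, inv_mulVec_mulVec hV, mulVec_smul,
        dotProduct_add, dotProduct_sub, dotProduct_smul, x_dotProduct_thetaVec, thetaHat,
        smul_eq_mul]
      ring
    set z := P.x t j ⬝ᵥ ((P.V t h)⁻¹ *ᵥ P.x t j) with hz
    have h1 : |P.x t j ⬝ᵥ ((P.V t h)⁻¹ *ᵥ s)| ≤ √z * √Q := by
      rw [← Real.sqrt_mul (dotProduct_inv_mulVec_nonneg hV _)]
      exact Real.abs_le_sqrt (dotProduct_inv_mulVec_sq_le hV _ _)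
    have h2 : |P.x t j ⬝ᵥ ((P.V t h)⁻¹ *ᵥ thetaVec Θ)| ≤
        √z * √(thetaVec Θ ⬝ᵥ ((P.V t h)⁻¹ *ᵥ thetaVec Θ)) := by
      rw [← Real.sqrt_mul (dotProduct_inv_mulVec_nonneg hV _)]
      exact Real.abs_le_sqrt (dotProduct_inv_mulVec_sq_le hV _ _)
    have h3 : √(thetaVec Θ ⬝ᵥ ((P.V t h)⁻¹ *ᵥ thetaVec Θ)) ≤ P.D / √P.γ := by
      refine Real.sqrt_le_iff.2 ⟨by positivity, ?_⟩
      rw [div_pow, Real.sq_sqrt hγ0.le]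
      refine (dotProduct_inv_mulVec_le hV hγ0 (mul_dotProduct_le_V t h) _).trans ?_
      rw [dotProduct_self_eq_norm_sq]
      gcongr
    have h4 : √Q ≤ 1 / 2 * √(P.d * L + 4 * Real.log (t + 1)) := by
      refine Real.sqrt_le_iff.2 ⟨by positivity, ?_⟩
      rw [mul_pow, Real.sq_sqrt (by positivity)]
      linarith
    have h5 : P.γ * (P.D / √P.γ) = P.D * √P.γ := by
      have := Real.mul_self_sqrt hγ0.le
      have hs0 : 0 < √P.γ := Real.sqrt_pos.2 hγ0
      field_simp
      nlinarith
    rw [e]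
    calc _ ≤ |P.x t j ⬝ᵥ ((P.V t h)⁻¹ *ᵥ s)| +
          |P.γ * (P.x t j ⬝ᵥ ((P.V t h)⁻¹ *ᵥ thetaVec Θ))| := abs_sub _ _
      _ ≤ √z * (1 / 2 * √(P.d * L + 4 * Real.log (t + 1))) + P.γ * (√z * (P.D / √P.γ)) := by
          rw [abs_mul, abs_of_pos hγ0]
          refine add_le_add (h1.trans (mul_le_mul_of_nonneg_left h4 (Real.sqrt_nonneg _)))
            (mul_le_mul_of_nonneg_left
              (h2.trans (mul_le_mul_of_nonneg_left h3 (Real.sqrt_nonneg _))) hγ0.le)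
      _ = √z * (1 / 2 * √(P.d * L + 4 * Real.log (t + 1)) + P.γ * (P.D / √P.γ)) := by ring
      _ = _ := by rw [h5, rho, mul_comm]
  have hlog := log_det_V_le hγ hd hlen hx
  have hl0 : Real.log (P.γ • (1 : Matrix (Fin dp × Fin dc) (Fin dp × Fin dc) ℝ)).det =
      P.d * Real.log P.γ := by simp [d]
  have hexp : ∀ A : Matrix (Fin dp × Fin dc) (Fin dp × Fin dc) ℝ, 0 < A.det →
      √A.det = Real.exp (1 / 2 * Real.log A.det) := by
    intro A hA
    rw [Real.sqrt_eq_rpow, Real.rpow_def_of_pos hA, mul_comm]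
  have ht2 : ((t : ℝ) + 1) ^ 2 = Real.exp (2 * Real.log (t + 1)) := by
    rw [mul_comm, Real.exp_mul, Real.exp_log ht0]; norm_num
  rw [selfNormalized, designState_fst, hexp _ hdet0, hexp _ hV.det_pos, ht2, ← Real.exp_sub,
    ← Real.exp_sub, ← Real.exp_add, hl0]
  refine Real.one_le_exp ?_
  show 0 ≤ 1 / 2 * (P.d * Real.log P.γ) - 2 * Real.log (t + 1) +
    (2 * Q - 1 / 2 * Real.log (P.V t h).det)
  linarith

open Classical in
lemma expect_thetaBad_le (hγ : 1 ≤ P.γ) (hD : 0 < P.D) (hd : 0 < P.d)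
    (hΘ : ‖WithLp.toLp 2 (thetaVec Θ)‖ ≤ P.D) (hp : P.IsRankUCB T p)
    (hlam : ∀ t < T, ∀ j, P.lam Θ t j ∈ Set.Icc (0 : ℝ) 1)
    (hx : ∀ t < T, ∀ j, ‖WithLp.toLp 2 (P.x t j)‖ ≤ 1) {t : ℕ} (ht : t < T) :
    P.expect Θ ν p t (fun h => if P.ThetaGood Θ t h then (0 : ℝ) else 1) ≤
      1 / ((t : ℝ) + 1) ^ 2 := by
  refine (P.expect_mono Θ ν p
    (F' := fun h => √(P.γ • (1 : Matrix (Fin dp × Fin dc) (Fin dp × Fin dc) ℝ)).det /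
      ((t : ℝ) + 1) ^ 2 * selfNormalized (P.designState Θ t h)) fun c => thetaBad_le hγ hD hd hΘ
    (hp.history_length_le ht.le c) fun s hs => hx s (by omega)).trans ?_
  rw [expect_const_mul]
  have h := expect_selfNormalized_le (ν := ν) hγ hp hlam ht.le
  have h0 := sqrt_det_smul_one_pos hγ
  calc _ ≤ _ := mul_le_mul_of_nonneg_left h (by positivity)
    _ = _ := by field_simp

/-! ### Total width of the confidence ellipsoids. -/

lemma rho_nonneg (hD : 0 < P.D) (t : ℕ) : 0 ≤ P.rho t := by
  unfold rho; positivity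

lemma rho_mono (hγ : 1 ≤ P.γ) : Monotone P.rho := by
  intro s t hst
  have h1 : (s : ℝ) ≤ t := by exact_mod_cast hst
  have h0 : (0 : ℝ) ≤ P.d := by unfold d; positivity
  have hγ0 : 0 < P.γ := by linarith
  unfold rho
  gcongr

/-- The error bound for the optimistic estimator of a purchase probability. -/
def width (P : Setting n dp dc) (t : ℕ) (h : Fin t → Round n) (j : Fin n) : ℝ :=
  min 1 (2 * P.rho t * √(P.x t j ⬝ᵥ ((P.V t h)⁻¹ *ᵥ P.x t j)))

lemma width_nonneg (hD : 0 < P.D) (t : ℕ) (h : Fin t → Round n) (j : Fin n) :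
    0 ≤ P.width t h j :=
  le_min zero_le_one (mul_nonneg (mul_nonneg zero_le_two (rho_nonneg hD t)) (Real.sqrt_nonneg _))

/-- The free weight `κ`, optimized later, replaces Cauchy–Schwarz over rounds and expectations. -/
lemma sqrt_le_mul_add {κ z : ℝ} (hκ : 0 < κ) (hz : 0 ≤ z) : √z ≤ κ / 2 * z + 1 / (2 * κ) := by
  have h := Real.sq_sqrt hz
  have h2 : κ / 2 * z + 1 / (2 * κ) - √z = (κ * √z - 1) ^ 2 / (2 * κ) := by
    field_simp
    nlinarith
  have : 0 ≤ (κ * √z - 1) ^ 2 / (2 * κ) := by positivity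
  linarith

lemma integral_affine {Ω : Type*} [MeasurableSpace Ω] {μ : Measure Ω} [IsProbabilityMeasure μ]
    {f : Ω → ℝ} (hf : Integrable f μ) (a b c e : ℝ) :
    ∫ ω, a * (b * (f ω - c) + e) ∂μ = a * (b * (∫ ω, f ω ∂μ - c) + e) := by
  have h1 : Integrable (fun ω => f ω - c) μ := hf.sub (integrable_const _)
  rw [integral_const_mul, integral_add (h1.const_mul b) (integrable_const _), integral_const_mul,
    integral_sub hf (integrable_const _)]
  simp

/-- Elliptical potential: the square roots are traded for the quadratic forms, whose sum is
controlled by increments of `log det V`; these telescope in expectation to at most `d L`. -/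
lemma expect_width_le (hγ : 1 ≤ P.γ) (hD : 0 < P.D) (hd : 0 < P.d) (hM : 1 ≤ P.M)
    (hp : P.IsRankUCB T p) (hT : 1 ≤ T)
    (hx : ∀ t < T, ∀ j, ‖WithLp.toLp 2 (P.x t j)‖ ≤ 1) :
    ∑ t ∈ Finset.range T, P.expect Θ ν p t (fun h => ∫ c,
        (observe (p t h) c).sumViewed (fun j _ => P.width t h j) ∂P.custLaw Θ ν t) ≤
      2 * P.rho (T - 1) * P.M *
        √(2 * T * P.d * Real.log (1 + T * P.M / (P.γ * P.d))) := by
  have hγ0 : 0 < P.γ := by linarith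
  have hT0 : (0 : ℝ) < T := by exact_mod_cast hT
  have hM0 : (0 : ℝ) < P.M := by exact_mod_cast hM
  set L := Real.log (1 + T * P.M / (P.γ * P.d)) with hL
  have hL0 : 0 < L := Real.log_pos (lt_add_of_pos_right _ (by positivity))
  -- This weight balances `κ M d L` against `T M / (2 κ)`.
  set κ := √(T / (2 * P.d * L)) with hκd
  have hκ : 0 < κ := Real.sqrt_pos.2 (by positivity)
  have hρ := rho_nonneg hD (T - 1)
  have hround : ∀ t ∈ Finset.range T, P.expect Θ ν p t (fun h => ∫ c,
      (observe (p t h) c).sumViewed (fun j _ => P.width t h j) ∂P.custLaw Θ ν t) ≤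
      2 * P.rho (T - 1) * (κ * P.M * (P.expect Θ ν p (t + 1) (fun h => Real.log (P.V (t + 1) h).det) -
        P.expect Θ ν p t (fun h => Real.log (P.V t h).det)) + P.M * (1 / (2 * κ))) := by
    intro t ht
    rw [Finset.mem_range] at ht
    rw [expect_succ_sub, ← expect_const_mul]
    rw [← P.expect_const Θ ν p t (P.M * (1 / (2 * κ)))]
    rw [← expect_add, ← expect_const_mul]
    refine P.expect_mono Θ ν p fun c => ?_
    set h := history p t c
    have hint := integrable_observe (p t h) (P.custLaw Θ ν t)
      fun o => Real.log (P.V (t + 1) (Fin.snoc (α := fun _ => Round n) h o)).det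
    have hrhs : 2 * P.rho (T - 1) * (κ * P.M * ((∫ c', Real.log (P.V (t + 1)
          (Fin.snoc (α := fun _ => Round n) h (observe (p t h) c'))).det ∂P.custLaw Θ ν t) -
        Real.log (P.V t h).det) + P.M * (1 / (2 * κ))) =
        ∫ c', 2 * P.rho (T - 1) * (κ * P.M * (Real.log (P.V (t + 1)
          (Fin.snoc (α := fun _ => Round n) h (observe (p t h) c'))).det -
        Real.log (P.V t h).det) + P.M * (1 / (2 * κ))) ∂P.custLaw Θ ν t := by
      exact (integral_affine hint _ _ _ _).symm
    rw [hrhs]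
    refine integral_mono (integrable_observe (p t h) (P.custLaw Θ ν t)
      fun o => o.sumViewed (fun j _ => P.width t h j))
      (((hint.sub (integrable_const _)).const_mul _).add (integrable_const _) |>.const_mul _)
      fun c' => ?_
    set o := observe (p t h) c'
    have hlen : o.ranking.length ≤ P.M := hp.length_le ht h
    have hs := sum_width_le hγ h (hx t ht) (o := o) hlen
    show ∑ k : Fin o.ranking.length, o.OZ (k + 1) • P.width t h (o.ranking.get k) ≤
      2 * P.rho (T - 1) * (κ * P.M * (Real.log (P.V (t + 1)
          (Fin.snoc (α := fun _ => Round n) h o)).det - Real.log (P.V t h).det) +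
        P.M * (1 / (2 * κ)))
    calc ∑ k : Fin o.ranking.length, o.OZ (k + 1) • P.width t h (o.ranking.get k)
        ≤ ∑ k : Fin o.ranking.length, 2 * P.rho (T - 1) * (κ / 2 * (o.OZ (k + 1) *
            (P.x t (o.ranking.get k) ⬝ᵥ ((P.V t h)⁻¹ *ᵥ P.x t (o.ranking.get k)))) +
            1 / (2 * κ)) := by
          refine Finset.sum_le_sum fun k _ => ?_
          set z := P.x t (o.ranking.get k) ⬝ᵥ ((P.V t h)⁻¹ *ᵥ P.x t (o.ranking.get k)) with hz
          have hz0 : 0 ≤ z := dotProduct_inv_mulVec_nonneg (V_posDef hγ t h) _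
          have hw : P.width t h (o.ranking.get k) ≤
              2 * P.rho (T - 1) * (κ / 2 * z + 1 / (2 * κ)) := by
            refine (min_le_right _ _).trans ?_
            have h1 := rho_mono hγ (show t ≤ T - 1 by omega)
            have h2 := sqrt_le_mul_add hκ hz0
            have h3 := rho_nonneg hD t
            gcongr
          have hO1 := OZ_le_one o (k + 1)
          have hO0 := OZ_nonneg o (k + 1)
          rw [smul_eq_mul]
          refine (mul_le_mul_of_nonneg_left hw hO0).trans ?_
          have h4 : o.OZ (k + 1) * (1 / (2 * κ)) ≤ 1 / (2 * κ) :=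
            mul_le_of_le_one_left (by positivity) hO1
          have := mul_le_mul_of_nonneg_left h4 (mul_nonneg zero_le_two hρ)
          linarith
      _ = 2 * P.rho (T - 1) * (κ / 2 * ∑ k : Fin o.ranking.length, o.OZ (k + 1) *
            (P.x t (o.ranking.get k) ⬝ᵥ ((P.V t h)⁻¹ *ᵥ P.x t (o.ranking.get k))) +
            o.ranking.length * (1 / (2 * κ))) := by
          rw [← Finset.mul_sum, Finset.sum_add_distrib, ← Finset.mul_sum]
          simp
      _ ≤ 2 * P.rho (T - 1) * (κ / 2 * (2 * P.M * (Real.log (P.V (t + 1)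
          (Fin.snoc (α := fun _ => Round n) h o)).det - Real.log (P.V t h).det)) +
            P.M * (1 / (2 * κ))) := by
          have : (o.ranking.length : ℝ) ≤ P.M := by exact_mod_cast hlen
          gcongr
      _ = _ := by ring
  refine (Finset.sum_le_sum hround).trans ?_
  rw [← Finset.mul_sum, Finset.sum_add_distrib, ← Finset.mul_sum,
    Finset.sum_range_sub (fun t => P.expect Θ ν p t (fun h => Real.log (P.V t h).det)), expect_zero,
    log_det_V_zero]
  have hfin : P.expect Θ ν p T (fun h => Real.log (P.V T h).det) ≤
      P.d * Real.log P.γ + P.d * L := by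
    rw [← P.expect_const Θ ν p T (P.d * Real.log P.γ + P.d * L)]
    exact P.expect_mono Θ ν p fun c => log_det_V_le hγ hd (hp.history_length_le le_rfl c) hx
  have hκ2 : κ * (P.M * P.d * L) + T * (P.M * (1 / (2 * κ))) = P.M * √(2 * T * P.d * L) := by
    have h1 : κ ^ 2 = T / (2 * P.d * L) := Real.sq_sqrt (by positivity)
    have h2 : √(2 * T * P.d * L) = κ * (2 * P.d * L) := by
      rw [Real.sqrt_eq_iff_mul_self_eq (by positivity) (by positivity)]
      have : κ * (2 * P.d * L) * (κ * (2 * P.d * L)) = κ ^ 2 * (2 * P.d * L) ^ 2 := by ring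
      rw [this, h1]
      field_simp
    have h3 : (T : ℝ) = κ ^ 2 * (2 * P.d * L) := by rw [h1]; field_simp
    rw [h2]
    nth_rewrite 1 [h3]
    field_simp
    ring
  calc _ ≤ 2 * P.rho (T - 1) * (κ * P.M * (P.d * L) + T * (P.M * (1 / (2 * κ)))) := by
        refine mul_le_mul_of_nonneg_left (add_le_add ?_ (by simp)) (by positivity)
        exact mul_le_mul_of_nonneg_left (by linarith) (by positivity)
    _ = 2 * P.rho (T - 1) * (κ * (P.M * P.d * L) + T * (P.M * (1 / (2 * κ)))) := by ring
    _ = _ := by rw [hκ2]; ring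

end Setting

/-! ### Estimation of the failure rates -/

/-- Each term with `i ≥ 1` is at most `2 √i - 2 √(i - 1)`; the term `i = 0` is `0` by the convention
for division. -/
lemma sum_one_div_sqrt_le (T : ℕ) : ∑ i ∈ Finset.range T, 1 / √(i : ℝ) ≤ 2 * √T := by
  have h : ∀ T : ℕ, ∑ i ∈ Finset.range (T + 1), 1 / √(i : ℝ) ≤ 2 * √T := by
    intro T
    induction T with
    | zero => simp
    | succ T ih =>
      rw [Finset.sum_range_succ]
      have h1 : (0 : ℝ) < √((T + 1 : ℕ) : ℝ) := Real.sqrt_pos.2 (by positivity)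
      have h2 : 1 / √((T + 1 : ℕ) : ℝ) ≤ 2 * √((T + 1 : ℕ) : ℝ) - 2 * √T := by
        rw [div_le_iff₀ h1]
        have a := Real.sq_sqrt (show (0 : ℝ) ≤ ((T + 1 : ℕ) : ℝ) by positivity)
        have b := Real.sq_sqrt (show (0 : ℝ) ≤ (T : ℝ) by positivity)
        have c : ((T + 1 : ℕ) : ℝ) = T + 1 := by push_cast; ring
        nlinarith [sq_nonneg (√((T + 1 : ℕ) : ℝ) - √T)]
      linarith
  refine le_trans ?_ (h T)
  exact Finset.sum_le_sum_of_subset_of_nonneg (Finset.range_subset_range.2 T.le_succ)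
    fun i _ _ => by positivity

/-- Bounds the accumulated failure probability at one position, by `t / (t + 1) ^ 2 ≤ 1 / (t + 1) ≤
log ((t + 1) / t)` for `t ≥ 1`. -/
lemma sum_div_succ_sq_le_log (T : ℕ) (hT : 1 ≤ T) :
    ∑ t ∈ Finset.range T, (t : ℝ) / ((t : ℝ) + 1) ^ 2 ≤ Real.log T := by
  induction T, hT using Nat.le_induction with
  | base => simp
  | succ T hT ih =>
    rw [Finset.sum_range_succ]
    have hT0 : (0 : ℝ) < T := by exact_mod_cast hT
    have h := Real.one_sub_inv_le_log_of_pos (show (0 : ℝ) < (T + 1) / T by positivity)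
    rw [Real.log_div (by positivity) hT0.ne'] at h
    have h2 : (T : ℝ) / ((T : ℝ) + 1) ^ 2 ≤ 1 - ((T + 1) / T : ℝ)⁻¹ := by
      have : 1 - ((T + 1) / T : ℝ)⁻¹ = 1 / (T + 1) := by field_simp; ring
      rw [this, div_le_div_iff₀ (by positivity) (by positivity)]
      nlinarith
    push_cast
    linarith

namespace Setting

variable {n dp dc : ℕ} (P : Setting n dp dc)

/-- How often the attention span was observed to end at position `k`. -/
def failures (t : ℕ) (h : Fin t → Round n) (k : ℕ) : ℝ :=
  ∑ s : Fin t, (h s).OY P.M k * (h s).Y k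

lemma N_snoc (t : ℕ) (h : Fin t → Round n) (o : Round n) (k : ℕ) :
    P.N (t + 1) (Fin.snoc (α := fun _ => Round n) h o) k = P.N t h k + o.OY P.M k := by
  simp [N, Fin.sum_univ_castSucc]

lemma failures_snoc (t : ℕ) (h : Fin t → Round n) (o : Round n) (k : ℕ) :
    P.failures (t + 1) (Fin.snoc (α := fun _ => Round n) h o) k =
      P.failures t h k + o.OY P.M k * o.Y k := by
  simp [failures, Fin.sum_univ_castSucc]

lemma OY_eq (M : ℕ) (o : Round n) (k : ℕ) : o.OY M k = 0 ∨ o.OY M k = 1 := by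
  unfold Round.OY; split_ifs <;> simp

lemma N_eq_natCast (t : ℕ) (h : Fin t → Round n) (k : ℕ) :
    ∃ m : ℕ, m ≤ t ∧ P.N t h k = m := by
  induction t with
  | zero => exact ⟨0, le_rfl, by simp [N]⟩
  | succ t ih =>
    obtain ⟨m, hm, e⟩ := ih (Fin.init h)
    rw [← Fin.snoc_init_self h, N_snoc, e]
    rcases OY_eq P.M (h (Fin.last t)) k with e | e <;> rw [e]
    · exact ⟨m, by omega, by simp⟩
    · exact ⟨m + 1, by omega, by push_cast; rfl⟩

variable (Θ : Matrix (Fin dp) (Fin dc) ℝ) {ν : Measure ℕ} [IsProbabilityMeasure ν]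
  {p : Policy n} {T : ℕ} {P}

/-- Mean change of a function of the observed numbers of trials and failures in one round. -/
lemma expect_span_succ (hp : P.IsRankUCB T p)
    (hlam : ∀ t < T, ∀ j, P.lam Θ t j ∈ Set.Icc (0 : ℝ) 1) {t : ℕ} (ht : t < T) {k : ℕ}
    (hk : k < P.M) (Ψ : ℝ → ℝ → ℝ) :
    P.expect Θ ν p (t + 1) (fun h => Ψ (P.N (t + 1) h k) (P.failures (t + 1) h k)) =
      P.expect Θ ν p t fun h => Ψ (P.N t h k) (P.failures t h k) +
        spanObsProb (P.lam Θ t) ν (p t h) k *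
          (failureRate ν k * Ψ (P.N t h k + 1) (P.failures t h k + 1) +
            (1 - failureRate ν k) * Ψ (P.N t h k + 1) (P.failures t h k) -
            Ψ (P.N t h k) (P.failures t h k)) := by
  rw [expect_succ]
  congr 1
  funext h
  simp only [N_snoc, failures_snoc]
  have := integral_span_observation (ν := ν) (hlam t ht) (hp.nodup ht h) hk
    fun a b => Ψ (P.N t h k + a) (P.failures t h k + b)
  simp only [add_zero] at this
  exact this

lemma failureRate_mem (k : ℕ) : failureRate ν k ∈ Set.Icc (0 : ℝ) 1 :=
  ⟨failureRate_nonneg k, failureRate_le_one k⟩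

/-- The exponential supermartingale of the observed failures. -/
lemma expect_exp_failures_le (hp : P.IsRankUCB T p)
    (hlam : ∀ t < T, ∀ j, P.lam Θ t j ∈ Set.Icc (0 : ℝ) 1) {k : ℕ} (hk : k < P.M) (s : ℝ)
    {t : ℕ} (ht : t ≤ T) :
    P.expect Θ ν p t (fun h => Real.exp (s * (P.failures t h k - failureRate ν k * P.N t h k) -
      P.N t h k * (s ^ 2 / 8))) ≤ 1 := by
  induction t with
  | zero => rw [expect_zero]; simp [failures, N]
  | succ t ih =>
    refine le_trans ?_ (ih (by omega))
    rw [expect_span_succ Θ hp hlam ht hk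
      fun N C => Real.exp (s * (C - failureRate ν k * N) - N * (s ^ 2 / 8))]
    refine P.expect_mono Θ ν p fun c => ?_
    set h := history p t c
    set N := P.N t h k
    set C := P.failures t h k
    set q := failureRate ν k
    have hb := bernoulli_mgf_le (failureRate_mem (ν := ν) k) s
    have e1 : Real.exp (s * (C + 1 - q * (N + 1)) - (N + 1) * (s ^ 2 / 8)) =
        Real.exp (s * (C - q * N) - N * (s ^ 2 / 8)) * Real.exp (-(s ^ 2 / 8)) *
          Real.exp (s * (1 - q)) := by
      rw [← Real.exp_add, ← Real.exp_add]; congr 1; ring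
    have e2 : Real.exp (s * (C - q * (N + 1)) - (N + 1) * (s ^ 2 / 8)) =
        Real.exp (s * (C - q * N) - N * (s ^ 2 / 8)) * Real.exp (-(s ^ 2 / 8)) *
          Real.exp (-s * q) := by
      rw [← Real.exp_add, ← Real.exp_add]; congr 1; ring
    have hstep : q * Real.exp (s * (C + 1 - q * (N + 1)) - (N + 1) * (s ^ 2 / 8)) +
        (1 - q) * Real.exp (s * (C - q * (N + 1)) - (N + 1) * (s ^ 2 / 8)) -
        Real.exp (s * (C - q * N) - N * (s ^ 2 / 8)) ≤ 0 := by
      rw [e1, e2]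
      have h1 : Real.exp (-(s ^ 2 / 8)) * Real.exp (s ^ 2 / 8) = 1 := by
        rw [← Real.exp_add]; simp
      have h2 := mul_le_mul_of_nonneg_left hb (mul_pos
        (Real.exp_pos (s * (C - q * N) - N * (s ^ 2 / 8))) (Real.exp_pos (-(s ^ 2 / 8)))).le
      rw [mul_assoc _ _ (Real.exp (s ^ 2 / 8)), h1, mul_one] at h2
      linarith
    have := mul_nonneg (spanObsProb_nonneg (ν := ν) (fun j => (hlam t ht j).2) (p t h) k)
      (neg_nonneg.2 hstep)
    linarith

open Classical in
-- Chernoff's bound with a union over the values `m` of the random count. The tilt `4 √(log (t + 1)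
-- / m)` is the optimal one for count `m`; the term of the actual count has exponent at least `2 log
-- (t + 1)`.
lemma hLow_bad_le {t : ℕ} (h : Fin t → Round n) (k : ℕ) :
    (if P.hLow t h k ≤ failureRate ν k then (0 : ℝ) else 1) ≤
      ∑ m ∈ Finset.Icc 1 t, 1 / ((t : ℝ) + 1) ^ 2 *
        Real.exp (4 * √(Real.log (t + 1) / m) * (P.failures t h k - failureRate ν k * P.N t h k) -
          P.N t h k * ((4 * √(Real.log (t + 1) / m)) ^ 2 / 8)) := by
  split_ifs with hb
  · exact Finset.sum_nonneg fun m _ => by positivity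
  push Not at hb
  obtain ⟨m, hmt, hm⟩ := P.N_eq_natCast t h k
  have hq := failureRate_nonneg (ν := ν) k
  have hN : P.N t h k ≠ 0 := by
    intro h0
    rw [hLow, if_pos h0] at hb
    linarith
  have hm0 : m ≠ 0 := by rintro rfl; exact hN (by simpa using hm)
  have hm1 : (0 : ℝ) < m := by exact_mod_cast Nat.pos_of_ne_zero hm0
  rw [hLow, if_neg hN, proj] at hb
  have ha : failureRate ν k < P.hHat t h k - √(Real.log (t + 1) / P.N t h k) := by
    rcases lt_max_iff.1 hb with h1 | h1
    · linarith
    · exact h1.trans_le (min_le_right _ _)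
  rw [hHat, hm] at ha
  have hl : 0 ≤ Real.log ((t : ℝ) + 1) := Real.log_nonneg (by simp)
  refine le_trans ?_ (Finset.single_le_sum (f := fun m : ℕ => 1 / ((t : ℝ) + 1) ^ 2 *
    Real.exp (4 * √(Real.log (t + 1) / m) * (P.failures t h k - failureRate ν k * P.N t h k) -
          P.N t h k * ((4 * √(Real.log (t + 1) / m)) ^ 2 / 8))) (fun i _ => by positivity)
    (Finset.mem_Icc.2 ⟨Nat.one_le_iff_ne_zero.2 hm0, hmt⟩))
  rw [hm]
  set r := √(Real.log (t + 1) / m) with hr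
  have hr0 : 0 ≤ r := Real.sqrt_nonneg _
  have hr2 : r ^ 2 = Real.log (t + 1) / m := Real.sq_sqrt (by positivity)
  have hC : (failureRate ν k + r) * m ≤ P.failures t h k :=
    ((le_div_iff₀ hm1).1 (by unfold failures; linarith))
  have h2 : 2 * Real.log (t + 1) ≤
      4 * r * (P.failures t h k - failureRate ν k * m) - m * ((4 * r) ^ 2 / 8) := by
    have h3 : Real.log (t + 1) = m * r ^ 2 := by rw [hr2]; field_simp
    have h4 := mul_le_mul_of_nonneg_left (show r * m ≤ P.failures t h k - failureRate ν k * m by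
      linarith) (mul_nonneg zero_le_four hr0)
    rw [h3]
    nlinarith
  have ht2 : ((t : ℝ) + 1) ^ 2 = Real.exp (2 * Real.log (t + 1)) := by
    rw [mul_comm, Real.exp_mul, Real.exp_log (by positivity)]; norm_num
  rw [one_div, inv_mul_eq_div, one_le_div (by positivity), ht2]
  exact Real.exp_le_exp.2 h2

open Classical in
lemma expect_hLow_bad_le (hp : P.IsRankUCB T p)
    (hlam : ∀ t < T, ∀ j, P.lam Θ t j ∈ Set.Icc (0 : ℝ) 1) {k : ℕ} (hk : k < P.M)
    {t : ℕ} (ht : t ≤ T) :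
    P.expect Θ ν p t (fun h => if P.hLow t h k ≤ failureRate ν k then (0 : ℝ) else 1) ≤
      t / ((t : ℝ) + 1) ^ 2 := by
  refine (P.expect_mono Θ ν p (F' := fun h => ∑ m ∈ Finset.Icc 1 t, 1 / ((t : ℝ) + 1) ^ 2 *
        Real.exp (4 * √(Real.log (t + 1) / m) * (P.failures t h k - failureRate ν k * P.N t h k) -
          P.N t h k * ((4 * √(Real.log (t + 1) / m)) ^ 2 / 8)))
    fun c => hLow_bad_le _ k).trans ?_
  rw [expect_sum]
  simp_rw [expect_const_mul]
  calc _ ≤ ∑ m ∈ Finset.Icc 1 t, 1 / ((t : ℝ) + 1) ^ 2 * 1 :=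
        Finset.sum_le_sum fun m _ => mul_le_mul_of_nonneg_left
          (expect_exp_failures_le Θ hp hlam hk _ ht) (by positivity)
    _ = _ := by simp; ring

/-! ### Total error of the failure rate estimates. -/

/-- A bound for the error of the lower confidence bound of the failure rate at position `k`. -/
def spanWidth (P : Setting n dp dc) (ν : Measure ℕ) (t : ℕ) (h : Fin t → Round n) (k : ℕ) : ℝ :=
  if P.N t h k = 0 then 1
  else √(Real.log (t + 1) / P.N t h k) + |P.failures t h k / P.N t h k - failureRate ν k|

omit [IsProbabilityMeasure ν] in
lemma spanWidth_nonneg (t : ℕ) (h : Fin t → Round n) (k : ℕ) : 0 ≤ P.spanWidth ν t h k := by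
  unfold spanWidth; split_ifs <;> positivity

lemma hLow_nonneg (t : ℕ) (h : Fin t → Round n) (k : ℕ) : 0 ≤ P.hLow t h k := by
  unfold hLow
  split_ifs
  · exact le_rfl
  · exact le_max_left _ _

omit [IsProbabilityMeasure ν] in
-- Valid on every history. Keeping the actual deviation instead of a second confidence radius needs
-- no upper confidence event, and its total is of order `√T` without the logarithm.
lemma failureRate_sub_hLow_le (t : ℕ) (h : Fin t → Round n) (k : ℕ) :
    failureRate ν k - P.hLow t h k ≤ P.spanWidth ν t h k := by
  have h1 := failureRate_le_one (ν := ν) k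
  unfold spanWidth hLow
  split_ifs
  · linarith
  · have e : P.hHat t h k = P.failures t h k / P.N t h k := rfl
    rw [e, proj]
    have hs := Real.sqrt_nonneg (Real.log (t + 1) / P.N t h k)
    have ha := neg_abs_le (P.failures t h k / P.N t h k - failureRate ν k)
    have hb := abs_nonneg (P.failures t h k / P.N t h k - failureRate ν k)
    have : failureRate ν k - (√(Real.log (t + 1) / P.N t h k) +
        |P.failures t h k / P.N t h k - failureRate ν k|) ≤
        min 1 (P.failures t h k / P.N t h k - √(Real.log (t + 1) / P.N t h k)) :=
      le_min (by linarith) (by linarith)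
    have := this.trans (le_max_right 0 _)
    linarith

/-- Weights of the squared deviations in `spanPotential`. -/
def deviationWeight (T m : ℕ) : ℝ := ∑ i ∈ Finset.Ico m T, 1 / ((i : ℝ) * √i)

lemma deviationWeight_nonneg (T m : ℕ) : 0 ≤ deviationWeight T m :=
  Finset.sum_nonneg fun _ _ => by positivity

lemma deviationWeight_eq {T m : ℕ} (hm : m < T) :
    deviationWeight T m = 1 / ((m : ℝ) * √m) + deviationWeight T (m + 1) :=
  Finset.sum_eq_sum_Ico_succ_bot hm _

/-- The guaranteed increments of `spanPotential`. -/
def spanRate (T m : ℕ) : ℝ :=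
  (if m = 0 then 1 else 0) + (√(Real.log T) + 1 / 4) * (1 / √m) + 1 / 4 * deviationWeight T (m + 1)

lemma spanRate_nonneg (T m : ℕ) : 0 ≤ spanRate T m := by
  have := deviationWeight_nonneg T (m + 1)
  unfold spanRate
  split_ifs <;> positivity

/-- After exchanging the sums, the weight `1 / (i √i)` is counted `i` times, leaving once more a sum
of `1 / √i`. -/
lemma sum_spanRate_le (T : ℕ) (hT : 1 ≤ T) :
    ∑ m ∈ Finset.range T, spanRate T m ≤ 1 + 2 * √(T * Real.log T) + √T := by
  have h1 : ∑ m ∈ Finset.range T, deviationWeight T (m + 1) ≤ 2 * √T := by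
    unfold deviationWeight
    rw [Finset.sum_comm' (t' := Finset.range T) (s' := fun l => Finset.range l)
      (by intro i l; simp; omega)]
    refine le_trans (le_of_eq (Finset.sum_congr rfl fun l _ => ?_)) (sum_one_div_sqrt_le T)
    rcases Nat.eq_zero_or_pos l with rfl | hl
    · simp
    · have : (0 : ℝ) < l := by exact_mod_cast hl
      simp only [Finset.sum_const, Finset.card_range, nsmul_eq_mul]
      field_simp
  have h2 := sum_one_div_sqrt_le T
  unfold spanRate
  rw [Finset.sum_add_distrib, Finset.sum_add_distrib, ← Finset.mul_sum, ← Finset.mul_sum]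
  have h3 : ∑ m ∈ Finset.range T, (if m = 0 then (1 : ℝ) else 0) = 1 := by
    rw [Finset.sum_ite_eq' (Finset.range T) 0]
    simp; omega
  rw [h3, Real.sqrt_mul (by positivity)]
  have hL := Real.sqrt_nonneg (Real.log T)
  have := mul_le_mul_of_nonneg_left h2 (show 0 ≤ √(Real.log T) + 1 / 4 by positivity)
  linarith

/-- A potential for the sum of the widths `spanWidth` over the rounds in which the attention span
is observed. -/
def spanPotential (T : ℕ) (q N C : ℝ) : ℝ :=
  ∑ m ∈ Finset.range ⌊N⌋₊, spanRate T m - (C - q * N) ^ 2 * deviationWeight T ⌊N⌋₊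

/-- With `S = C - q m`, one has `|S| / m ≤ 1 / (4 √m) + S² / (m √m)`. The square is paid for by the
drop of `deviationWeight`, and the mean growth `q (1 - q) ≤ 1 / 4` of `S²` in a trial by the last
term of `spanRate`. -/
lemma spanWidth_le_potential {t : ℕ} (ht : t < T) (h : Fin t → Round n) (k : ℕ) :
    P.spanWidth ν t h k ≤
      failureRate ν k * spanPotential T (failureRate ν k) (P.N t h k + 1) (P.failures t h k + 1) +
        (1 - failureRate ν k) *
          spanPotential T (failureRate ν k) (P.N t h k + 1) (P.failures t h k) -
        spanPotential T (failureRate ν k) (P.N t h k) (P.failures t h k) := by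
  obtain ⟨m, hmt, hm⟩ := P.N_eq_natCast t h k
  have hfl : ⌊(m : ℝ) + 1⌋₊ = m + 1 := by exact_mod_cast Nat.floor_natCast (R := ℝ) (m + 1)
  unfold spanPotential
  rw [hm, hfl, Nat.floor_natCast, Finset.sum_range_succ, deviationWeight_eq (show m < T by omega)]
  have hq0 := failureRate_nonneg (ν := ν) k
  have hq1 := failureRate_le_one (ν := ν) k
  have hw := deviationWeight_nonneg T (m + 1)
  have key : P.spanWidth ν t h k ≤ (if m = 0 then 1 else 0) + (√(Real.log T) + 1 / 4) * (1 / √m) +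
      (P.failures t h k - failureRate ν k * m) ^ 2 * (1 / ((m : ℝ) * √m)) := by
    unfold spanWidth
    rw [hm]
    rcases Nat.eq_zero_or_pos m with rfl | hm0
    · simp
    have hm1 : (0 : ℝ) < m := by exact_mod_cast hm0
    rw [if_neg hm1.ne', if_neg hm0.ne', zero_add]
    have hs : 0 < √(m : ℝ) := Real.sqrt_pos.2 hm1
    have hss := Real.mul_self_sqrt hm1.le
    have h1 : √(Real.log (t + 1) / m) ≤ √(Real.log T) * (1 / √m) := by
      rw [Real.sqrt_div' _ hm1.le, mul_one_div]
      have : Real.log ((t : ℝ) + 1) ≤ Real.log T :=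
        Real.log_le_log (by positivity) (by exact_mod_cast ht)
      gcongr
    set S := P.failures t h k - failureRate ν k * m with hS
    have h2 : |P.failures t h k / m - failureRate ν k| = |S| / m := by
      rw [← abs_of_pos hm1, ← abs_div, abs_of_pos hm1, hS]
      congr 1; field_simp
    have h3 : |S| / m ≤ 1 / 4 * (1 / √m) + S ^ 2 * (1 / (m * √m)) := by
      have e : 1 / 4 * (1 / √m) + S ^ 2 * (1 / (m * √m)) - |S| / m =
          (|S| / √m - 1 / 2) ^ 2 / √m := by
        rw [← sq_abs S]
        generalize √(m : ℝ) = y at hs hss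
        rw [← hss]
        field_simp
        ring
      have : 0 ≤ (|S| / √m - 1 / 2) ^ 2 / √m := by positivity
      linarith
    rw [h2]
    linarith
  refine key.trans ?_
  set q := failureRate ν k
  set C := P.failures t h k
  set w := deviationWeight T (m + 1)
  unfold spanRate
  have hqq : q * (1 - q) * w ≤ 1 / 4 * w :=
    mul_le_mul_of_nonneg_right (by nlinarith [sq_nonneg (q - 1 / 2)]) hw
  have e : q * (C + 1 - q * (m + 1)) ^ 2 + (1 - q) * (C - q * (m + 1)) ^ 2 =
      (C - q * m) ^ 2 + q * (1 - q) := by ring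
  have e2 : (q * (C + 1 - q * (m + 1)) ^ 2 + (1 - q) * (C - q * (m + 1)) ^ 2) * w =
      ((C - q * m) ^ 2 + q * (1 - q)) * w := by rw [e]
  linarith

/-- The mean increments of `spanPotential` telescope. It starts at zero and, its square being
subtracted, ends below the sum of all rates. -/
lemma expect_spanWidth_le (hp : P.IsRankUCB T p) (hT : 1 ≤ T)
    (hlam : ∀ t < T, ∀ j, P.lam Θ t j ∈ Set.Icc (0 : ℝ) 1) {k : ℕ} (hk : k < P.M) :
    ∑ t ∈ Finset.range T, P.expect Θ ν p t (fun h =>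
        spanObsProb (P.lam Θ t) ν (p t h) k * P.spanWidth ν t h k) ≤
      1 + 2 * √(T * Real.log T) + √T := by
  set q := failureRate ν k
  have hround : ∀ t ∈ Finset.range T, P.expect Θ ν p t (fun h =>
        spanObsProb (P.lam Θ t) ν (p t h) k * P.spanWidth ν t h k) ≤
      P.expect Θ ν p (t + 1) (fun h =>
        spanPotential T q (P.N (t + 1) h k) (P.failures (t + 1) h k)) -
      P.expect Θ ν p t (fun h => spanPotential T q (P.N t h k) (P.failures t h k)) := by
    intro t ht
    rw [Finset.mem_range] at ht
    rw [expect_span_succ Θ hp hlam ht hk, ← expect_sub]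
    refine P.expect_mono Θ ν p fun c => ?_
    have := mul_le_mul_of_nonneg_left (spanWidth_le_potential (P := P) (ν := ν) ht (history p t c) k)
      (spanObsProb_nonneg (ν := ν) (fun j => (hlam t ht j).2) (p t (history p t c)) k)
    show _ ≤ _
    linarith
  refine (Finset.sum_le_sum hround).trans ?_
  rw [Finset.sum_range_sub (fun t => P.expect Θ ν p t
    (fun h => spanPotential T q (P.N t h k) (P.failures t h k))), expect_zero]
  have h0 : spanPotential T q (P.N 0 (Fin.elim0 : Fin 0 → Round n) k)
      (P.failures 0 (Fin.elim0 : Fin 0 → Round n) k) = 0 := by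
    simp [spanPotential, N, failures]
  rw [h0, sub_zero]
  refine le_trans ?_ (sum_spanRate_le T hT)
  rw [← P.expect_const Θ ν p T (∑ m ∈ Finset.range T, spanRate T m)]
  refine P.expect_mono Θ ν p fun c => ?_
  obtain ⟨m, hmt, hm⟩ := P.N_eq_natCast T (history p T c) k
  unfold spanPotential
  rw [hm, Nat.floor_natCast]
  have h1 := mul_nonneg (sq_nonneg (P.failures T (history p T c) k - q * m))
    (deviationWeight_nonneg T m)
  have h2 := Finset.sum_le_sum_of_subset_of_nonneg (Finset.range_subset_range.2 hmt)
    fun i _ _ => spanRate_nonneg T i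
  linarith

end Setting

/-! ### The regret bound -/

lemma sum_one_div_succ_sq_le (T : ℕ) :
    ∑ t ∈ Finset.range T, 1 / ((t : ℝ) + 1) ^ 2 ≤ Real.pi ^ 2 / 6 := by
  have h := (hasSum_nat_add_iff' (f := fun n : ℕ => 1 / (n : ℝ) ^ 2) 1).2 hasSum_zeta_two
  simp only [Finset.range_one, Finset.sum_singleton, Nat.cast_zero, ne_eq, OfNat.ofNat_ne_zero,
    not_false_eq_true, zero_pow, div_zero, sub_zero, Nat.cast_add, Nat.cast_one] at h
  exact sum_le_hasSum _ (fun i _ => by positivity) h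

/-- The cost of one position. The spare `2 e √(T log T)` absorbs the lower-order terms because
`√(log T) ≥ 0.832` and `log T ≤ 2 √T / e`. The inequality fails at `T = 1`. -/
lemma exp_mul_add_log_le {T : ℕ} (hT : 2 ≤ T) :
    Real.exp 1 * (1 + 2 * √(T * Real.log T) + √T) + Real.log T ≤
      4 * Real.exp 1 * √(T * Real.log T) + Real.pi ^ 2 / 6 := by
  have hT2 : (2 : ℝ) ≤ T := by exact_mod_cast hT
  have hlog : Real.log 2 ≤ Real.log T := Real.log_le_log two_pos hT2
  have hl2 := Real.log_two_gt_d9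
  have he := Real.exp_one_gt_d9
  have he' := Real.exp_one_lt_d9
  have hb : (0.832 : ℝ) ≤ √(Real.log T) := Real.le_sqrt_of_sq_le (by norm_num; linarith)
  have ha : (1.414 : ℝ) ≤ √T := Real.le_sqrt_of_sq_le (by norm_num; linarith)
  have ha0 : 0 < √(T : ℝ) := by linarith
  have hlogT : Real.log T = 2 * Real.log √T := by rw [Real.log_sqrt (by linarith)]; ring
  have hla : Real.log √T ≤ √T / Real.exp 1 := by
    have := Real.log_le_sub_one_of_pos (div_pos ha0 (Real.exp_pos 1))
    rw [Real.log_div ha0.ne' (Real.exp_pos 1).ne', Real.log_exp] at this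
    linarith
  have hla' : √(T : ℝ) / Real.exp 1 ≤ 0.368 * √T := by
    rw [div_le_iff₀ (Real.exp_pos 1)]
    nlinarith
  have hpi : (1.643 : ℝ) ≤ Real.pi ^ 2 / 6 := by nlinarith [Real.pi_gt_d2]
  rw [Real.sqrt_mul (by linarith)]
  have hab : √(T : ℝ) * 0.832 ≤ √T * √(Real.log T) := mul_le_mul_of_nonneg_left hb ha0.le
  have h1 : Real.exp 1 * (√(T : ℝ) * 0.832) ≤ Real.exp 1 * (√T * √(Real.log T)) :=
    mul_le_mul_of_nonneg_left hab (Real.exp_pos 1).le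
  have h2 : (2.718 : ℝ) * √T ≤ Real.exp 1 * √T :=
    mul_le_mul_of_nonneg_right (by linarith) ha0.le
  nlinarith

namespace Setting

variable {n dp dc : ℕ} {P : Setting n dp dc} {Θ : Matrix (Fin dp) (Fin dc) ℝ} {ν : Measure ℕ}
  [IsProbabilityMeasure ν] {p : Policy n} {T : ℕ}

lemma le_rmax (P : Setting n dp dc) (j : Fin n) : P.r j ≤ P.rmax :=
  le_ciSup (Set.finite_range P.r).bddAbove j

lemma rmax_nonneg (hr0 : ∀ j, 0 ≤ P.r j) : 0 ≤ P.rmax := Real.iSup_nonneg hr0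

lemma d_pos (hn : 1 ≤ n) (hlam : ∀ j, 0 < P.lam Θ 0 j) : 0 < P.d := by
  have h := hlam ⟨0, hn⟩
  unfold d
  rcases Nat.eq_zero_or_pos dp with rfl | hp
  · simp [lam, dotProduct] at h
  rcases Nat.eq_zero_or_pos dc with rfl | hc
  · simp [lam, dotProduct, mulVec] at h
  positivity

lemma u_le_one (t : ℕ) (h : Fin t → Round n) (j : Fin n) : P.u t h j ≤ 1 :=
  max_le zero_le_one (min_le_left _ _)

lemma ThetaGood.lam_le_u {t : ℕ} {h : Fin t → Round n} (hg : P.ThetaGood Θ t h) {j : Fin n}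
    (h1 : P.lam Θ t j ≤ 1) : P.lam Θ t j ≤ P.u t h j := by
  have := (abs_le.1 (hg j)).1
  exact (le_min h1 (by linarith)).trans (le_max_right _ _)

lemma ThetaGood.u_sub_lam_le_width (hD : 0 < P.D) {t : ℕ} {h : Fin t → Round n}
    (hg : P.ThetaGood Θ t h) {j : Fin n} (h0 : 0 ≤ P.lam Θ t j) :
    P.u t h j - P.lam Θ t j ≤ P.width t h j := by
  have h1 := (abs_le.1 (hg j)).2
  have h2 := u_le_one (P := P) t h j
  have h3 := mul_nonneg (rho_nonneg (P := P) hD t)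
    (Real.sqrt_nonneg (P.x t j ⬝ᵥ ((P.V t h)⁻¹ *ᵥ P.x t j)))
  refine le_min (by linarith) ?_
  rw [sub_le_iff_le_add]
  refine max_le (by linarith) ((min_le_right _ _).trans (by linarith))

lemma integral_sumViewed_width (t : ℕ) (h : Fin t → Round n)
    (hl : ∀ j, P.lam Θ t j ∈ Set.Icc (0 : ℝ) 1) {σ : List (Fin n)} (hn : σ.Nodup) :
    ∫ c, (observe σ c).sumViewed (fun j _ => P.width t h j) ∂P.custLaw Θ ν t =
      ∑ k : Fin σ.length, tail ν (k + 1) * noneProb (P.lam Θ t) (σ.take k) *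
        P.width t h (σ.get k) := by
  have e : ∀ c, (observe σ c).sumViewed (fun j _ => P.width t h j) =
      ∑ k : Fin σ.length, (observe σ c).OZ (k + 1) * P.width t h (σ.get k) := fun c => rfl
  simp only [e]
  rw [integral_finsetSum _ fun (k : Fin σ.length) _ =>
    (integrable_observe σ (P.custLaw Θ ν t) fun o => o.OZ (k + 1)).mul_const _]
  refine Finset.sum_congr rfl fun k _ => ?_
  rw [integral_mul_const, custLaw, integral_OZ hl hn k.2]

open Classical in
/-- The expected regret of one round is at most the widths of the confidence bounds that matter,
plus a constant on the failure of the confidence bounds. -/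
lemma round_regret_le (hM : 1 ≤ P.M) (hMn : P.M ≤ n) (hr0 : ∀ j, 0 ≤ P.r j) (hr : Antitone P.r)
    (hD : 0 < P.D) (hν : ν {0} = 0) (hIFR : HasIFR P.M ν) (hp : P.IsRankUCB T p) {t : ℕ}
    (ht : t < T) (hl : ∀ j, P.lam Θ t j ∈ Set.Icc (0 : ℝ) 1) (h : Fin t → Round n) :
    optimalRevenue P.M P.r (P.lam Θ t) ν -
        Real.exp 1 * expectedRevenue P.r (P.lam Θ t) ν (p t h) ≤
      Real.exp 1 * P.rmax *
        ((∫ c, (observe (p t h) c).sumViewed (fun j _ => P.width t h j) ∂P.custLaw Θ ν t) +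
          ∑ k ∈ Finset.Ico 1 P.M, spanObsProb (P.lam Θ t) ν (p t h) k * P.spanWidth ν t h k) +
      P.rmax * ((if P.ThetaGood Θ t h then 0 else 1) +
        ∑ k ∈ Finset.Ico 1 P.M, if P.hLow t h k ≤ failureRate ν k then 0 else 1) := by
  have h0 : ∀ j, 0 ≤ P.lam Θ t j := fun j => (hl j).1
  have h1 : ∀ j, P.lam Θ t j ≤ 1 := fun j => (hl j).2
  have hρ0 := rmax_nonneg hr0
  have he := Real.exp_pos 1
  rw [integral_sumViewed_width t h hl (hp.nodup ht h)]
  have hw : 0 ≤ ∑ k : Fin (p t h).length, tail ν (k + 1) *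
      noneProb (P.lam Θ t) ((p t h).take k) * P.width t h ((p t h).get k) :=
    Finset.sum_nonneg fun k _ => mul_nonneg (mul_nonneg (tail_nonneg _) (noneProb_nonneg h1 _))
      (width_nonneg hD _ _ _)
  have hs : 0 ≤ ∑ k ∈ Finset.Ico 1 P.M,
      spanObsProb (P.lam Θ t) ν (p t h) k * P.spanWidth ν t h k :=
    Finset.sum_nonneg fun k _ => mul_nonneg (spanObsProb_nonneg h1 _ _) (spanWidth_nonneg _ _ _)
  have hi : ∀ k ∈ Finset.Ico 1 P.M, (0 : ℝ) ≤ if P.hLow t h k ≤ failureRate ν k then 0 else 1 :=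
    fun k _ => by split_ifs <;> norm_num
  have hi0 : (0 : ℝ) ≤ if P.ThetaGood Θ t h then 0 else 1 := by split_ifs <;> norm_num
  -- If some confidence bound fails, the regret is still at most `rmax`, which is charged to the
  -- indicators.
  by_cases hgood : P.ThetaGood Θ t h ∧ ∀ k ∈ Finset.Ico 1 P.M, P.hLow t h k ≤ failureRate ν k
  · obtain ⟨hg, hk⟩ := hgood
    obtain ⟨σ, rest, hσ, e, -, -⟩ := hp t ht h
    have hmain := optimistic_regret_le (a := P.hLow t h) (rest := rest) hM hMn hν hIFR hr0 hr
      P.le_rmax hρ0 h0 (fun j => hg.lam_le_u (h1 j)) (fun j => u_le_one t h j)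
      (fun k _ _ => hLow_nonneg t h k)
      (fun k hk1 hk2 => hk k (Finset.mem_Ico.2 ⟨hk1, hk2⟩)) hσ
    rw [← e] at hmain
    refine hmain.trans ((mul_le_mul_of_nonneg_left (add_le_add ?_ ?_) (by positivity)).trans
      (le_add_of_nonneg_right (mul_nonneg hρ0 (add_nonneg hi0 (Finset.sum_nonneg hi)))))
    · exact Finset.sum_le_sum fun k _ => mul_le_mul_of_nonneg_left
        (hg.u_sub_lam_le_width hD (h0 _)) (mul_nonneg (tail_nonneg _) (noneProb_nonneg h1 _))
    · exact Finset.sum_le_sum fun k _ => mul_le_mul_of_nonneg_left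
        (failureRate_sub_hLow_le t h k) (spanObsProb_nonneg h1 _ _)
  · have hbad : (1 : ℝ) ≤ (if P.ThetaGood Θ t h then 0 else 1) +
        ∑ k ∈ Finset.Ico 1 P.M, if P.hLow t h k ≤ failureRate ν k then 0 else 1 := by
      by_cases hg : P.ThetaGood Θ t h
      · have : ∃ k ∈ Finset.Ico 1 P.M, ¬ P.hLow t h k ≤ failureRate ν k := by
          by_contra! hc
          exact hgood ⟨hg, hc⟩
        obtain ⟨k, hk, hkb⟩ := this
        have := Finset.single_le_sum hi hk
        rw [if_neg hkb] at this
        linarith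
      · have := Finset.sum_nonneg hi
        rw [if_neg hg]
        linarith
    have h2 := optimalRevenue_le (ν := ν) hMn P.le_rmax hρ0 hr0 h0 h1
    have h3 := mul_nonneg he.le (expectedRevenue_nonneg (ν := ν) hr0 h0 h1 (p t h))
    have h4 := mul_le_mul_of_nonneg_left hbad hρ0
    have h5 := mul_nonneg (mul_nonneg he.le hρ0) (add_nonneg hw hs)
    linarith

variable (P Θ ν p) in
lemma integrable_regret (T : ℕ) : Integrable (P.regret Θ ν p T) (P.customerLaw Θ ν T) :=
  P.integrable_history Θ ν p T fun h => ∑ t : Fin T, (optimalRevenue P.M P.r (P.lam Θ t) ν -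
    Real.exp 1 * expectedRevenue P.r (P.lam Θ t) ν (h t).ranking)

variable (P Θ ν p) in
-- The list shown to a customer depends only on earlier records, so each summand reduces to an
-- expectation over those.
lemma integral_regret (T : ℕ) :
    ∫ c, P.regret Θ ν p T c ∂P.customerLaw Θ ν T =
      ∑ t ∈ Finset.range T, P.expect Θ ν p t fun h => optimalRevenue P.M P.r (P.lam Θ t) ν -
        Real.exp 1 * expectedRevenue P.r (P.lam Θ t) ν (p t h) := by
  have e : ∀ T, ∫ c, P.regret Θ ν p T c ∂P.customerLaw Θ ν T = P.expect Θ ν p T fun h =>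
      ∑ t : Fin T, (optimalRevenue P.M P.r (P.lam Θ t) ν -
        Real.exp 1 * expectedRevenue P.r (P.lam Θ t) ν (h t).ranking) := fun T => rfl
  induction T with
  | zero => rw [e, expect_zero]; simp
  | succ T ih =>
    rw [Finset.sum_range_succ, ← ih, e, e, expect_succ, ← expect_add]
    congr 1
    funext h
    simp only [Fin.sum_univ_castSucc, Fin.snoc_castSucc, Fin.snoc_last, Fin.val_castSucc,
      Fin.val_last]
    simp [observe]

/-- The regret bound in terms of the widths of the confidence bounds. -/
lemma sum_round_regret_le (hM : 1 ≤ P.M) (hMn : P.M ≤ n) (hr0 : ∀ j, 0 ≤ P.r j)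
    (hr : Antitone P.r) (hγ : 1 ≤ P.γ) (hD : 0 < P.D) (hd : 0 < P.d) (hT : 1 ≤ T)
    (hν : ν {0} = 0) (hIFR : HasIFR P.M ν)
    (hl : ∀ t < T, ∀ j, P.lam Θ t j ∈ Set.Icc (0 : ℝ) 1)
    (hx : ∀ t < T, ∀ j, ‖WithLp.toLp 2 (P.x t j)‖ ≤ 1)
    (hΘ : ‖WithLp.toLp 2 (thetaVec Θ)‖ ≤ P.D) (hp : P.IsRankUCB T p) :
    (∑ t ∈ Finset.range T, P.expect Θ ν p t fun h => optimalRevenue P.M P.r (P.lam Θ t) ν -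
        Real.exp 1 * expectedRevenue P.r (P.lam Θ t) ν (p t h)) ≤
      Real.exp 1 * P.rmax * (2 * P.rho (T - 1) * P.M *
          √(2 * T * P.d * Real.log (1 + T * P.M / (P.γ * P.d))) +
        ((P.M : ℝ) - 1) * (1 + 2 * √(T * Real.log T) + √T)) +
      P.rmax * (Real.pi ^ 2 / 6 + ((P.M : ℝ) - 1) * Real.log T) := by
  classical
  have hρ0 := rmax_nonneg hr0
  have hcard : ((Finset.Ico 1 P.M).card : ℝ) = (P.M : ℝ) - 1 := by
    rw [Nat.card_Ico, Nat.cast_sub hM, Nat.cast_one]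
  have hround : ∀ t ∈ Finset.range T, (P.expect Θ ν p t fun h =>
      optimalRevenue P.M P.r (P.lam Θ t) ν -
        Real.exp 1 * expectedRevenue P.r (P.lam Θ t) ν (p t h)) ≤
      Real.exp 1 * P.rmax * ((P.expect Θ ν p t fun h => ∫ c, (observe (p t h) c).sumViewed
          (fun j _ => P.width t h j) ∂P.custLaw Θ ν t) +
        ∑ k ∈ Finset.Ico 1 P.M, P.expect Θ ν p t fun h =>
          spanObsProb (P.lam Θ t) ν (p t h) k * P.spanWidth ν t h k) +
      P.rmax * ((P.expect Θ ν p t fun h => if P.ThetaGood Θ t h then 0 else 1) +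
        ∑ k ∈ Finset.Ico 1 P.M, P.expect Θ ν p t fun h =>
          if P.hLow t h k ≤ failureRate ν k then 0 else 1) := by
    intro t ht
    rw [Finset.mem_range] at ht
    rw [← expect_sum, ← expect_sum, ← expect_add, ← expect_add, ← expect_const_mul,
      ← expect_const_mul, ← expect_add]
    exact P.expect_mono Θ ν p fun c =>
      round_regret_le hM hMn hr0 hr hD hν hIFR hp ht (hl t ht) _
  refine (Finset.sum_le_sum hround).trans ?_
  rw [Finset.sum_add_distrib, ← Finset.mul_sum, ← Finset.mul_sum, Finset.sum_add_distrib,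
    Finset.sum_add_distrib, Finset.sum_comm, Finset.sum_comm (s := Finset.range T)]
  refine add_le_add
    (mul_le_mul_of_nonneg_left (add_le_add (expect_width_le hγ hD hd hM hp hT hx) ?_)
      (mul_nonneg (Real.exp_pos 1).le hρ0))
    (mul_le_mul_of_nonneg_left (add_le_add ?_ ?_) hρ0)
  · rw [← hcard, ← nsmul_eq_mul]
    exact Finset.sum_le_card_nsmul _ _ _ fun k hk =>
      expect_spanWidth_le Θ hp hT hl (Finset.mem_Ico.1 hk).2
  · exact (Finset.sum_le_sum fun t ht => expect_thetaBad_le hγ hD hd hΘ hp hl hx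
      (Finset.mem_range.1 ht)).trans (sum_one_div_succ_sq_le T)
  · rw [← hcard, ← nsmul_eq_mul]
    exact Finset.sum_le_card_nsmul _ _ _ fun k hk =>
      (Finset.sum_le_sum fun t ht => expect_hLow_bad_le Θ hp hl (Finset.mem_Ico.1 hk).2
        (Finset.mem_range.1 ht).le).trans (sum_div_succ_sq_le_log T hT)

end Setting

end

end ProductRanking

open ProductRanking

theorem theorem3 {n dp dc : ℕ} (P : Setting n dp dc)
    (hM : 1 ≤ P.M) (hMn : P.M ≤ n)
    (hr_pos : ∀ j, 0 < P.r j) (hr : Antitone P.r)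
    (hγ : 1 ≤ P.γ) (hD : 0 < P.D)
    (T : ℕ) (hT : 1 ≤ T)
    -- the unknown parameter and the unknown law of the attention span
    (Θ : Matrix (Fin dp) (Fin dc) ℝ)
    (ν : Measure ℕ) [IsProbabilityMeasure ν] (hν : ν {0} = 0) (hIFR : HasIFR P.M ν)
    (hlam : ∀ t < T, ∀ j, P.lam Θ t j ∈ Set.Ioo (0 : ℝ) 1)
    (hx : ∀ t < T, ∀ j, ‖WithLp.toLp 2 (P.x t j)‖ ≤ 1)
    (hΘ : ‖WithLp.toLp 2 (fun q : Fin dp × Fin dc => Θ q.1 q.2)‖ ≤ P.D)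
    (p : Policy n) (hp : P.IsRankUCB T p) :
    Integrable (P.regret Θ ν p T) (P.customerLaw Θ ν T) ∧
      ∫ c, P.regret Θ ν p T c ∂(P.customerLaw Θ ν T) ≤
        4 * Real.exp 1 * P.M * P.rmax * √(T * Real.log T) +
        2 * Real.exp 1 * P.rho (T - 1) * P.M * P.rmax *
          √(2 * T * P.d * Real.log (1 + T * P.M / (P.γ * P.d))) +
        P.M * Real.pi ^ 2 * P.rmax / 6 := by
  have hr0 : ∀ j, 0 ≤ P.r j := fun j => (hr_pos j).le
  have hl : ∀ t < T, ∀ j, P.lam Θ t j ∈ Set.Icc (0 : ℝ) 1 :=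
    fun t ht j => Set.Ioo_subset_Icc_self (hlam t ht j)
  have hd : 0 < P.d := Setting.d_pos (hM.trans hMn) fun j => (hlam 0 hT j).1
  have hρ0 := Setting.rmax_nonneg hr0
  have he := Real.exp_pos 1
  have hM1 : (1 : ℝ) ≤ P.M := by exact_mod_cast hM
  have hrho := Setting.rho_nonneg hD (T - 1)
  refine ⟨P.integrable_regret Θ ν p T, ?_⟩
  rw [P.integral_regret]
  set W := √(2 * T * P.d * Real.log (1 + T * P.M / (P.γ * P.d)))
  set S := √(T * Real.log T)
  have hW : 0 ≤ W := Real.sqrt_nonneg _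
  have hS : 0 ≤ S := Real.sqrt_nonneg _
  -- At `T = 1` the term `√(T log T)` vanishes and absorbs nothing, but a single round costs at most
  -- `rmax ≤ M π² rmax / 6`.
  rcases hT.eq_or_lt with rfl | hT2
  · have h1 : P.expect Θ ν p 0 (fun h => optimalRevenue P.M P.r (P.lam Θ 0) ν -
        Real.exp 1 * expectedRevenue P.r (P.lam Θ 0) ν (p 0 h)) ≤ P.rmax := by
      have h0 : ∀ j, 0 ≤ P.lam Θ 0 j := fun j => (hl 0 hT j).1
      have h1 : ∀ j, P.lam Θ 0 j ≤ 1 := fun j => (hl 0 hT j).2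
      rw [← P.expect_const Θ ν p 0 P.rmax]
      refine P.expect_mono Θ ν p fun c => ?_
      have h2 := optimalRevenue_le (ν := ν) hMn P.le_rmax hρ0 hr0 h0 h1
      have h3 := mul_nonneg he.le (expectedRevenue_nonneg (ν := ν) hr0 h0 h1 (p 0 (history p 0 c)))
      linarith
    have h2 : P.rmax ≤ P.M * Real.pi ^ 2 * P.rmax / 6 := by
      have hpi : (6 : ℝ) ≤ Real.pi ^ 2 := by nlinarith [Real.pi_gt_three]
      have : (6 : ℝ) ≤ P.M * Real.pi ^ 2 := by nlinarith
      nlinarith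
    have h3 : 0 ≤ 4 * Real.exp 1 * P.M * P.rmax * S := by positivity
    have h4 : 0 ≤ 2 * Real.exp 1 * P.rho (1 - 1) * P.M * P.rmax * W := by positivity
    rw [Finset.sum_range_one]
    linarith
  · have hmain := Setting.sum_round_regret_le (ν := ν) hM hMn hr0 hr hγ hD hd hT hν hIFR hl hx hΘ hp
    refine hmain.trans ?_
    -- Used for each of the `M - 1` positions with a failure rate; the ellipsoids account for the
    -- remaining `π² / 6`.
    have hnum := exp_mul_add_log_le hT2
    have h1 := mul_le_mul_of_nonneg_left hnum (mul_nonneg hρ0 (sub_nonneg.2 hM1))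
    have h2 : 0 ≤ P.rmax * (4 * Real.exp 1 * S) := by positivity
    simp only [← show S = √(T * Real.log T) from rfl] at h1
    linarith
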